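/- Consider intensional Martin-Löf type theory with judgments $\Gamma\ \mathsf{ctx}$, $\Gamma \vdash a : A$ and $\Gamma \vdash a \equiv b : A$, with dependent function types $\Pi$ (with judgmental $\eta$), dependent pair types $\Sigma$, coproducts, the empty type $\mathbf 0$, the unit type $\mathbf 1$, the type $\mathbb N$ of natural numbers, intensional identity types $a =_A b$ with path induction, and a cumulative hierarchy of universes $\mathcal U_0 : \mathcal U_1 : \mathcal U_2 : \cdots$ à la Russell (that is, the theory of Appendix A.2 of the book *Homotopy Type Theory: Univalent Foundations of Mathematics*), without higher inductive types. Assume as the only axiom that every universe is univalent: for every $i$ and all types $A, B : \mathcal U_i$ there is a given term witnessing that the canonical map $\mathsf{idtoeqv} : (A =_{\mathcal U_i} B) \to (A \simeq B)$, defined by path induction from the identity equivalence, is an equivalence. Here $A \simeq B$ is $\sum_{f : A \to B} \mathsf{isequiv}(f)$, where $\mathsf{isequiv}(f)$ says that $f$ has a right inverse and a left inverse. For a type $A$ put $$\mathsf{is}\text{-}(-2)\text{-}\mathsf{type}(A) :\equiv \sum_{a : A} \prod_{x : A} a =_A x, \qquad \mathsf{is}\text{-}(n+1)\text{-}\mathsf{type}(A)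 :\equiv \prod_{x, y : A} \mathsf{is}\text{-}n\text{-}\mathsf{type}(x =_A y),$$ and $\neg A :\equiv A \to \mathbf 0$. **Theorem 1.** For every (external) natural number $n$, the type $\neg\, \mathsf{is}\text{-}n\text{-}\mathsf{type}(\mathcal U_n)$ is inhabited: there is a closed term $t$ such that $\vdash t : \neg\, \mathsf{is}\text{-}n\text{-}\mathsf{type}(\mathcal U_n)$ is derivable. That is, the universe $\mathcal U_n$ is not an $n$-type. -/

import Mathlib

namespace MLTT

/-! ### Raw syntax, with de Bruijn indices -/

/-- Raw terms. Types are terms (universes à la Russell). The comments list, for each argument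
that lies under binders, the variables it binds, outermost first; index `0` is the innermost. -/
inductive Tm : Type
  | var (k : ℕ) : Tm
  /-- the universe `U_i` -/
  | univ (i : ℕ) : Tm
  /-- `Π (x : A), B`; `B` binds `x` -/
  | pi (A B : Tm) : Tm
  /-- `λ (x : A), b`; `b` binds `x` -/
  | lam (A b : Tm) : Tm
  | app (f a : Tm) : Tm
  /-- `Σ (x : A), B`; `B` binds `x` -/
  | sigma (A B : Tm) : Tm
  | pair (a b : Tm) : Tm
  /-- `ind_Σ(z.C, x.y.g, p)` -/
  | sigmaInd (C g p : Tm) : Tm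
  /-- the coproduct `A + B` -/
  | sum (A B : Tm) : Tm
  | inl (a : Tm) : Tm
  | inr (b : Tm) : Tm
  /-- `ind_+(z.C, x.g, y.h, e)` -/
  | sumInd (C g h e : Tm) : Tm
  /-- the empty type `0` -/
  | empty : Tm
  /-- `ind_0(x.C, e)` -/
  | emptyInd (C e : Tm) : Tm
  /-- the unit type `1` -/
  | unit : Tm
  | star : Tm
  /-- `ind_1(x.C, c, e)` -/
  | unitInd (C c e : Tm) : Tm
  | nat : Tm
  | zero : Tm
  | succ (n : Tm) : Tm
  /-- `ind_ℕ(x.C, c₀, x.y.c₁, n)` -/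
  | natInd (C c₀ c₁ n : Tm) : Tm
  /-- the identity type `a =_A b` -/
  | path (A a b : Tm) : Tm
  | refl (a : Tm) : Tm
  /-- `ind_=(x.y.p.C, z.c, a, b, p)` -/
  | pathInd (C c a b p : Tm) : Tm
  /-- the constant witnessing univalence of `U_i` at the types `A` and `B` -/
  | univalence (i : ℕ) (A B : Tm) : Tm

/-- A renaming, moved under one binder. -/
def upRen (ρ : ℕ → ℕ) : ℕ → ℕ
  | 0 => 0
  | k + 1 => ρ k + 1

/-- Renaming of the free variables. -/
def Tm.rename : (ℕ → ℕ) → Tm → Tm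
  | ρ, var k => var (ρ k)
  | _, univ i => univ i
  | ρ, pi A B => pi (A.rename ρ) (B.rename (upRen ρ))
  | ρ, lam A b => lam (A.rename ρ) (b.rename (upRen ρ))
  | ρ, app f a => app (f.rename ρ) (a.rename ρ)
  | ρ, sigma A B => sigma (A.rename ρ) (B.rename (upRen ρ))
  | ρ, pair a b => pair (a.rename ρ) (b.rename ρ)
  | ρ, sigmaInd C g p =>
      sigmaInd (C.rename (upRen ρ)) (g.rename (upRen (upRen ρ))) (p.rename ρ)
  | ρ, sum A B => sum (A.rename ρ) (B.rename ρ)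
  | ρ, inl a => inl (a.rename ρ)
  | ρ, inr b => inr (b.rename ρ)
  | ρ, sumInd C g h e =>
      sumInd (C.rename (upRen ρ)) (g.rename (upRen ρ)) (h.rename (upRen ρ)) (e.rename ρ)
  | _, empty => empty
  | ρ, emptyInd C e => emptyInd (C.rename (upRen ρ)) (e.rename ρ)
  | _, unit => unit
  | _, star => star
  | ρ, unitInd C c e => unitInd (C.rename (upRen ρ)) (c.rename ρ) (e.rename ρ)
  | _, nat => nat
  | _, zero => zero
  | ρ, succ n => succ (n.rename ρ)
  | ρ, natInd C c₀ c₁ n =>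
      natInd (C.rename (upRen ρ)) (c₀.rename ρ) (c₁.rename (upRen (upRen ρ))) (n.rename ρ)
  | ρ, path A a b => path (A.rename ρ) (a.rename ρ) (b.rename ρ)
  | ρ, refl a => refl (a.rename ρ)
  | ρ, pathInd C c a b p =>
      pathInd (C.rename (upRen (upRen (upRen ρ)))) (c.rename (upRen ρ))
        (a.rename ρ) (b.rename ρ) (p.rename ρ)
  | ρ, univalence i A B => univalence i (A.rename ρ) (B.rename ρ)

/-- Weakening by one fresh innermost variable. -/
def Tm.wk (t : Tm) : Tm := t.rename Nat.succ

/-- A substitution, moved under one binder. -/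
def upSub (σ : ℕ → Tm) : ℕ → Tm
  | 0 => .var 0
  | k + 1 => (σ k).wk

/-- Simultaneous capture-avoiding substitution. -/
def Tm.subst : (ℕ → Tm) → Tm → Tm
  | σ, var k => σ k
  | _, univ i => univ i
  | σ, pi A B => pi (A.subst σ) (B.subst (upSub σ))
  | σ, lam A b => lam (A.subst σ) (b.subst (upSub σ))
  | σ, app f a => app (f.subst σ) (a.subst σ)
  | σ, sigma A B => sigma (A.subst σ) (B.subst (upSub σ))
  | σ, pair a b => pair (a.subst σ) (b.subst σ)
  | σ, sigmaInd C g p =>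
      sigmaInd (C.subst (upSub σ)) (g.subst (upSub (upSub σ))) (p.subst σ)
  | σ, sum A B => sum (A.subst σ) (B.subst σ)
  | σ, inl a => inl (a.subst σ)
  | σ, inr b => inr (b.subst σ)
  | σ, sumInd C g h e =>
      sumInd (C.subst (upSub σ)) (g.subst (upSub σ)) (h.subst (upSub σ)) (e.subst σ)
  | _, empty => empty
  | σ, emptyInd C e => emptyInd (C.subst (upSub σ)) (e.subst σ)
  | _, unit => unit
  | _, star => star
  | σ, unitInd C c e => unitInd (C.subst (upSub σ)) (c.subst σ) (e.subst σ)
  | _, nat => nat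
  | _, zero => zero
  | σ, succ n => succ (n.subst σ)
  | σ, natInd C c₀ c₁ n =>
      natInd (C.subst (upSub σ)) (c₀.subst σ) (c₁.subst (upSub (upSub σ))) (n.subst σ)
  | σ, path A a b => path (A.subst σ) (a.subst σ) (b.subst σ)
  | σ, refl a => refl (a.subst σ)
  | σ, pathInd C c a b p =>
      pathInd (C.subst (upSub (upSub (upSub σ)))) (c.subst (upSub σ))
        (a.subst σ) (b.subst σ) (p.subst σ)
  | σ, univalence i A B => univalence i (A.subst σ) (B.subst σ)

/-- The substitution that sends the innermost variable to `t` and the others along `σ`. -/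
def consSub (t : Tm) (σ : ℕ → Tm) : ℕ → Tm
  | 0 => t
  | k + 1 => σ k

/-- `b[a/x]`, where `x` is the innermost variable of `b`. -/
def Tm.inst (b a : Tm) : Tm := b.subst (consSub a Tm.var)

/-- `C[t/z]` in a context that has `m` fresh variables instead of `z`. -/
def Tm.instUnder (m : ℕ) (C t : Tm) : Tm := C.subst (consSub t (fun k => Tm.var (k + m)))

/-- `C[a/x, b/y, p/q]`, where `x, y, q` are the three innermost variables of `C`. -/
def Tm.inst₃ (C a b p : Tm) : Tm := C.subst (consSub p (consSub b (consSub a Tm.var)))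

/-- `C[z/x, z/y, refl z/q]` in a context that has one fresh variable `z` instead of `x, y, q`. -/
def Tm.instRefl (C : Tm) : Tm :=
  C.subst (consSub (.refl (.var 0)) (consSub (.var 0) (consSub (.var 0)
    (fun k => .var (k + 1)))))

/-! ### Defined type formers -/

/-- `A → B` -/
def Tm.arrow (A B : Tm) : Tm := .pi A B.wk

/-- `A × B` -/
def Tm.prod (A B : Tm) : Tm := .sigma A B.wk

/-- `¬ A`, that is, `A → 0` -/
def Tm.neg (A : Tm) : Tm := A.arrow .empty

/-- `Σ (a : A), Π (x : A), a =_A x` -/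
def Tm.isContr (A : Tm) : Tm :=
  .sigma A (.pi A.wk (.path A.wk.wk (.var 1) (.var 0)))

/-- The type expressing that `A` is of h-level `k`, i.e. that `A` is a `(k - 2)`-type: for `k = 0`
this is contractibility, and for `k + 1` it is `Π (x y : A), hasHLevel k (x =_A y)`. -/
def Tm.hasHLevel : ℕ → Tm → Tm
  | 0, A => A.isContr
  | k + 1, A => .pi A (.pi A.wk (Tm.hasHLevel k (.path A.wk.wk (.var 1) (.var 0))))

/-- `is-n-type(A)` for a natural number `n`; this is h-level `n + 2`. -/
def Tm.isNType (n : ℕ) (A : Tm) : Tm := A.hasHLevel (n + 2)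

/-- `isequiv(f)` for `f : A → B`, as the type of pairs of a right inverse and a left inverse:
`(Σ (g : B → A), Π (b : B), f (g b) = b) × (Σ (h : B → A), Π (a : A), h (f a) = a)`. -/
def Tm.isEquiv (A B f : Tm) : Tm :=
  Tm.prod
    (.sigma (B.arrow A) (.pi B.wk
      (.path B.wk.wk (.app f.wk.wk (.app (.var 1) (.var 0))) (.var 0))))
    (.sigma (B.arrow A) (.pi A.wk
      (.path A.wk.wk (.app (.var 1) (.app f.wk.wk (.var 0))) (.var 0))))

/-- `A ≃ B`, that is, `Σ (f : A → B), isequiv(f)` -/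
def Tm.equiv (A B : Tm) : Tm := .sigma (A.arrow B) (Tm.isEquiv A.wk B.wk (.var 0))

/-- The identity function of `A`. -/
def Tm.idFun (A : Tm) : Tm := .lam A (.var 0)

/-- The identity equivalence of `A`: the identity function, with itself as right and left inverse
and with reflexivity as the homotopies. -/
def Tm.idEquiv (A : Tm) : Tm :=
  .pair A.idFun
    (.pair (.pair A.idFun (.lam A (.refl (.var 0)))) (.pair A.idFun (.lam A (.refl (.var 0)))))

/-- `idtoeqv : (A =_{U_i} B) → (A ≃ B)`, defined by path induction from the identity
equivalence. -/
def Tm.idToEquiv (i : ℕ) (A B : Tm) : Tm :=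
  .lam (.path (.univ i) A B)
    (.pathInd (Tm.equiv (.var 2) (.var 1)) (Tm.idEquiv (.var 0)) A.wk B.wk (.var 0))

/-! ### Judgments and their derivations -/

/-- Contexts; the head of the list is the type of the innermost variable. -/
abbrev Ctx : Type := List Tm

/-- `Lookup Γ k A`: the variable of index `k` has the type `A` in `Γ`. -/
inductive Lookup : Ctx → ℕ → Tm → Prop
  | here (Γ : Ctx) (A : Tm) : Lookup (A :: Γ) 0 A.wk
  | there {Γ : Ctx} {k : ℕ} {A : Tm} (B : Tm) : Lookup Γ k A → Lookup (B :: Γ) (k + 1) A.wk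

/-- The three forms of judgment: `Γ ctx`, `Γ ⊢ a : A` and `Γ ⊢ a ≡ b : A`. -/
inductive Judgment : Type
  | isCtx (Γ : Ctx) : Judgment
  | hasType (Γ : Ctx) (a A : Tm) : Judgment
  | defEq (Γ : Ctx) (a b A : Tm) : Judgment

open Judgment in
/-- Derivability in intensional Martin-Löf type theory with `Π` (with judgmental `η`), `Σ`, `+`,
`0`, `1`, `ℕ`, identity types and a cumulative hierarchy of univalent universes. There are no higher
inductive types, and function extensionality is not an axiom. Besides formation, introduction,
elimination and computation rules there are, with names ending in `_eq`, the rules by which each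
constructor preserves judgmental equality in each of its arguments. Some rules repeat as a premise
that a type to the left of a turnstile, or in the conclusion, is well-formed. -/
inductive Derivable : Judgment → Prop
  -- contexts and variables
  | ctx_nil : Derivable (isCtx [])
  | ctx_cons {Γ A i} : Derivable (isCtx Γ) → Derivable (hasType Γ A (.univ i)) →
      Derivable (isCtx (A :: Γ))
  | var {Γ k A} : Derivable (isCtx Γ) → Lookup Γ k A → Derivable (hasType Γ (.var k) A)
  -- judgmental equality and conversion
  | eq_refl {Γ a A} : Derivable (hasType Γ a A) → Derivable (defEq Γ a a A)
  | eq_symm {Γ a b A} : Derivable (defEq Γ a b A) → Derivable (defEq Γ b a A)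
  | eq_trans {Γ a b c A} : Derivable (defEq Γ a b A) → Derivable (defEq Γ b c A) →
      Derivable (defEq Γ a c A)
  | conv {Γ a A B i} : Derivable (hasType Γ a A) → Derivable (defEq Γ A B (.univ i)) →
      Derivable (hasType Γ a B)
  | eq_conv {Γ a b A B i} : Derivable (defEq Γ a b A) → Derivable (defEq Γ A B (.univ i)) →
      Derivable (defEq Γ a b B)
  -- universes
  | univ_intro {Γ} (i : ℕ) : Derivable (isCtx Γ) → Derivable (hasType Γ (.univ i) (.univ (i + 1)))
  | univ_cumul {Γ A i} : Derivable (hasType Γ A (.univ i)) →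
      Derivable (hasType Γ A (.univ (i + 1)))
  | univ_cumul_eq {Γ A B i} : Derivable (defEq Γ A B (.univ i)) →
      Derivable (defEq Γ A B (.univ (i + 1)))
  -- dependent functions
  | pi_form {Γ A B i} : Derivable (hasType Γ A (.univ i)) →
      Derivable (hasType (A :: Γ) B (.univ i)) → Derivable (hasType Γ (.pi A B) (.univ i))
  | pi_form_eq {Γ A A' B B' i} : Derivable (hasType Γ A (.univ i)) →
      Derivable (defEq Γ A A' (.univ i)) → Derivable (defEq (A :: Γ) B B' (.univ i)) →
      Derivable (defEq Γ (.pi A B) (.pi A' B') (.univ i))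
  | pi_intro {Γ A B b i} : Derivable (hasType Γ A (.univ i)) →
      Derivable (hasType (A :: Γ) b B) → Derivable (hasType Γ (.lam A b) (.pi A B))
  | pi_intro_eq {Γ A A' B b b' i} : Derivable (hasType Γ A (.univ i)) →
      Derivable (defEq Γ A A' (.univ i)) → Derivable (defEq (A :: Γ) b b' B) →
      Derivable (defEq Γ (.lam A b) (.lam A' b') (.pi A B))
  | pi_elim {Γ A B f a} : Derivable (hasType Γ f (.pi A B)) → Derivable (hasType Γ a A) →
      Derivable (hasType Γ (.app f a) (B.inst a))
  | pi_elim_eq {Γ A B f f' a a'} : Derivable (defEq Γ f f' (.pi A B)) →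
      Derivable (defEq Γ a a' A) → Derivable (defEq Γ (.app f a) (.app f' a') (B.inst a))
  | pi_comp {Γ A B b a i} : Derivable (hasType Γ A (.univ i)) →
      Derivable (hasType (A :: Γ) b B) → Derivable (hasType Γ a A) →
      Derivable (defEq Γ (.app (.lam A b) a) (b.inst a) (B.inst a))
  | pi_uniq {Γ A B f} : Derivable (hasType Γ f (.pi A B)) →
      Derivable (defEq Γ f (.lam A (.app f.wk (.var 0))) (.pi A B))
  -- dependent pairs
  | sigma_form {Γ A B i} : Derivable (hasType Γ A (.univ i)) →
      Derivable (hasType (A :: Γ) B (.univ i)) → Derivable (hasType Γ (.sigma A B) (.univ i))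
  | sigma_form_eq {Γ A A' B B' i} : Derivable (hasType Γ A (.univ i)) →
      Derivable (defEq Γ A A' (.univ i)) → Derivable (defEq (A :: Γ) B B' (.univ i)) →
      Derivable (defEq Γ (.sigma A B) (.sigma A' B') (.univ i))
  | sigma_intro {Γ A B a b i} : Derivable (hasType Γ A (.univ i)) →
      Derivable (hasType (A :: Γ) B (.univ i)) → Derivable (hasType Γ a A) →
      Derivable (hasType Γ b (B.inst a)) → Derivable (hasType Γ (.pair a b) (.sigma A B))
  | sigma_intro_eq {Γ A B a a' b b' i} : Derivable (hasType Γ A (.univ i)) →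
      Derivable (hasType (A :: Γ) B (.univ i)) → Derivable (defEq Γ a a' A) →
      Derivable (defEq Γ b b' (B.inst a)) →
      Derivable (defEq Γ (.pair a b) (.pair a' b') (.sigma A B))
  | sigma_elim {Γ A B C g p i j} : Derivable (hasType Γ A (.univ i)) →
      Derivable (hasType (A :: Γ) B (.univ i)) →
      Derivable (hasType (.sigma A B :: Γ) C (.univ j)) →
      Derivable (hasType (B :: A :: Γ) g (C.instUnder 2 (.pair (.var 1) (.var 0)))) →
      Derivable (hasType Γ p (.sigma A B)) →
      Derivable (hasType Γ (.sigmaInd C g p) (C.inst p))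
  | sigma_elim_eq {Γ A B C C' g g' p p' i j} : Derivable (hasType Γ A (.univ i)) →
      Derivable (hasType (A :: Γ) B (.univ i)) →
      Derivable (defEq (.sigma A B :: Γ) C C' (.univ j)) →
      Derivable (defEq (B :: A :: Γ) g g' (C.instUnder 2 (.pair (.var 1) (.var 0)))) →
      Derivable (defEq Γ p p' (.sigma A B)) →
      Derivable (defEq Γ (.sigmaInd C g p) (.sigmaInd C' g' p') (C.inst p))
  | sigma_comp {Γ A B C g a b i j} : Derivable (hasType Γ A (.univ i)) →
      Derivable (hasType (A :: Γ) B (.univ i)) →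
      Derivable (hasType (.sigma A B :: Γ) C (.univ j)) →
      Derivable (hasType (B :: A :: Γ) g (C.instUnder 2 (.pair (.var 1) (.var 0)))) →
      Derivable (hasType Γ a A) → Derivable (hasType Γ b (B.inst a)) →
      Derivable (defEq Γ (.sigmaInd C g (.pair a b))
        (g.subst (consSub b (consSub a Tm.var))) (C.inst (.pair a b)))
  -- coproducts
  | sum_form {Γ A B i} : Derivable (hasType Γ A (.univ i)) → Derivable (hasType Γ B (.univ i)) →
      Derivable (hasType Γ (.sum A B) (.univ i))
  | sum_form_eq {Γ A A' B B' i} : Derivable (defEq Γ A A' (.univ i)) →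
      Derivable (defEq Γ B B' (.univ i)) →
      Derivable (defEq Γ (.sum A B) (.sum A' B') (.univ i))
  | sum_intro₁ {Γ A B a i} : Derivable (hasType Γ A (.univ i)) →
      Derivable (hasType Γ B (.univ i)) → Derivable (hasType Γ a A) →
      Derivable (hasType Γ (.inl a) (.sum A B))
  | sum_intro₁_eq {Γ A B a a' i} : Derivable (hasType Γ A (.univ i)) →
      Derivable (hasType Γ B (.univ i)) → Derivable (defEq Γ a a' A) →
      Derivable (defEq Γ (.inl a) (.inl a') (.sum A B))
  | sum_intro₂ {Γ A B b i} : Derivable (hasType Γ A (.univ i)) →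
      Derivable (hasType Γ B (.univ i)) → Derivable (hasType Γ b B) →
      Derivable (hasType Γ (.inr b) (.sum A B))
  | sum_intro₂_eq {Γ A B b b' i} : Derivable (hasType Γ A (.univ i)) →
      Derivable (hasType Γ B (.univ i)) → Derivable (defEq Γ b b' B) →
      Derivable (defEq Γ (.inr b) (.inr b') (.sum A B))
  | sum_elim {Γ A B C g h e i j} : Derivable (hasType Γ A (.univ i)) →
      Derivable (hasType Γ B (.univ i)) →
      Derivable (hasType (.sum A B :: Γ) C (.univ j)) →
      Derivable (hasType (A :: Γ) g (C.instUnder 1 (.inl (.var 0)))) →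
      Derivable (hasType (B :: Γ) h (C.instUnder 1 (.inr (.var 0)))) →
      Derivable (hasType Γ e (.sum A B)) →
      Derivable (hasType Γ (.sumInd C g h e) (C.inst e))
  | sum_elim_eq {Γ A B C C' g g' h h' e e' i j} : Derivable (hasType Γ A (.univ i)) →
      Derivable (hasType Γ B (.univ i)) →
      Derivable (defEq (.sum A B :: Γ) C C' (.univ j)) →
      Derivable (defEq (A :: Γ) g g' (C.instUnder 1 (.inl (.var 0)))) →
      Derivable (defEq (B :: Γ) h h' (C.instUnder 1 (.inr (.var 0)))) →
      Derivable (defEq Γ e e' (.sum A B)) →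
      Derivable (defEq Γ (.sumInd C g h e) (.sumInd C' g' h' e') (C.inst e))
  | sum_comp₁ {Γ A B C g h a i j} : Derivable (hasType Γ A (.univ i)) →
      Derivable (hasType Γ B (.univ i)) →
      Derivable (hasType (.sum A B :: Γ) C (.univ j)) →
      Derivable (hasType (A :: Γ) g (C.instUnder 1 (.inl (.var 0)))) →
      Derivable (hasType (B :: Γ) h (C.instUnder 1 (.inr (.var 0)))) →
      Derivable (hasType Γ a A) →
      Derivable (defEq Γ (.sumInd C g h (.inl a)) (g.inst a) (C.inst (.inl a)))
  | sum_comp₂ {Γ A B C g h b i j} : Derivable (hasType Γ A (.univ i)) →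
      Derivable (hasType Γ B (.univ i)) →
      Derivable (hasType (.sum A B :: Γ) C (.univ j)) →
      Derivable (hasType (A :: Γ) g (C.instUnder 1 (.inl (.var 0)))) →
      Derivable (hasType (B :: Γ) h (C.instUnder 1 (.inr (.var 0)))) →
      Derivable (hasType Γ b B) →
      Derivable (defEq Γ (.sumInd C g h (.inr b)) (h.inst b) (C.inst (.inr b)))
  -- the empty type
  | empty_form {Γ} (i : ℕ) : Derivable (isCtx Γ) → Derivable (hasType Γ .empty (.univ i))
  | empty_elim {Γ C e j} : Derivable (hasType (.empty :: Γ) C (.univ j)) →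
      Derivable (hasType Γ e .empty) → Derivable (hasType Γ (.emptyInd C e) (C.inst e))
  | empty_elim_eq {Γ C C' e e' j} : Derivable (defEq (.empty :: Γ) C C' (.univ j)) →
      Derivable (defEq Γ e e' .empty) →
      Derivable (defEq Γ (.emptyInd C e) (.emptyInd C' e') (C.inst e))
  -- the unit type
  | unit_form {Γ} (i : ℕ) : Derivable (isCtx Γ) → Derivable (hasType Γ .unit (.univ i))
  | unit_intro {Γ} : Derivable (isCtx Γ) → Derivable (hasType Γ .star .unit)
  | unit_elim {Γ C c e j} : Derivable (hasType (.unit :: Γ) C (.univ j)) →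
      Derivable (hasType Γ c (C.inst .star)) → Derivable (hasType Γ e .unit) →
      Derivable (hasType Γ (.unitInd C c e) (C.inst e))
  | unit_elim_eq {Γ C C' c c' e e' j} : Derivable (defEq (.unit :: Γ) C C' (.univ j)) →
      Derivable (defEq Γ c c' (C.inst .star)) → Derivable (defEq Γ e e' .unit) →
      Derivable (defEq Γ (.unitInd C c e) (.unitInd C' c' e') (C.inst e))
  | unit_comp {Γ C c j} : Derivable (hasType (.unit :: Γ) C (.univ j)) →
      Derivable (hasType Γ c (C.inst .star)) →
      Derivable (defEq Γ (.unitInd C c .star) c (C.inst .star))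
  -- natural numbers
  | nat_form {Γ} (i : ℕ) : Derivable (isCtx Γ) → Derivable (hasType Γ .nat (.univ i))
  | nat_intro₁ {Γ} : Derivable (isCtx Γ) → Derivable (hasType Γ .zero .nat)
  | nat_intro₂ {Γ n} : Derivable (hasType Γ n .nat) → Derivable (hasType Γ (.succ n) .nat)
  | nat_intro₂_eq {Γ n n'} : Derivable (defEq Γ n n' .nat) →
      Derivable (defEq Γ (.succ n) (.succ n') .nat)
  | nat_elim {Γ C c₀ c₁ n j} : Derivable (hasType (.nat :: Γ) C (.univ j)) →
      Derivable (hasType Γ c₀ (C.inst .zero)) →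
      Derivable (hasType (C :: .nat :: Γ) c₁ (C.instUnder 2 (.succ (.var 1)))) →
      Derivable (hasType Γ n .nat) →
      Derivable (hasType Γ (.natInd C c₀ c₁ n) (C.inst n))
  | nat_elim_eq {Γ C C' c₀ c₀' c₁ c₁' n n' j} : Derivable (hasType (.nat :: Γ) C (.univ j)) →
      Derivable (defEq (.nat :: Γ) C C' (.univ j)) →
      Derivable (defEq Γ c₀ c₀' (C.inst .zero)) →
      Derivable (defEq (C :: .nat :: Γ) c₁ c₁' (C.instUnder 2 (.succ (.var 1)))) →
      Derivable (defEq Γ n n' .nat) →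
      Derivable (defEq Γ (.natInd C c₀ c₁ n) (.natInd C' c₀' c₁' n') (C.inst n))
  | nat_comp₁ {Γ C c₀ c₁ j} : Derivable (hasType (.nat :: Γ) C (.univ j)) →
      Derivable (hasType Γ c₀ (C.inst .zero)) →
      Derivable (hasType (C :: .nat :: Γ) c₁ (C.instUnder 2 (.succ (.var 1)))) →
      Derivable (defEq Γ (.natInd C c₀ c₁ .zero) c₀ (C.inst .zero))
  | nat_comp₂ {Γ C c₀ c₁ n j} : Derivable (hasType (.nat :: Γ) C (.univ j)) →
      Derivable (hasType Γ c₀ (C.inst .zero)) →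
      Derivable (hasType (C :: .nat :: Γ) c₁ (C.instUnder 2 (.succ (.var 1)))) →
      Derivable (hasType Γ n .nat) →
      Derivable (defEq Γ (.natInd C c₀ c₁ (.succ n))
        (c₁.subst (consSub (.natInd C c₀ c₁ n) (consSub n Tm.var))) (C.inst (.succ n)))
  -- identity types
  | path_form {Γ A a b i} : Derivable (hasType Γ A (.univ i)) → Derivable (hasType Γ a A) →
      Derivable (hasType Γ b A) → Derivable (hasType Γ (.path A a b) (.univ i))
  | path_form_eq {Γ A A' a a' b b' i} : Derivable (defEq Γ A A' (.univ i)) →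
      Derivable (defEq Γ a a' A) → Derivable (defEq Γ b b' A) →
      Derivable (defEq Γ (.path A a b) (.path A' a' b') (.univ i))
  | path_intro {Γ A a i} : Derivable (hasType Γ A (.univ i)) → Derivable (hasType Γ a A) →
      Derivable (hasType Γ (.refl a) (.path A a a))
  | path_intro_eq {Γ A a a' i} : Derivable (hasType Γ A (.univ i)) →
      Derivable (defEq Γ a a' A) → Derivable (defEq Γ (.refl a) (.refl a') (.path A a a))
  | path_elim {Γ A C c a b p i j} : Derivable (hasType Γ A (.univ i)) →
      Derivable (hasType (.path A.wk.wk (.var 1) (.var 0) :: A.wk :: A :: Γ) C (.univ j)) →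
      Derivable (hasType (A :: Γ) c C.instRefl) →
      Derivable (hasType Γ a A) → Derivable (hasType Γ b A) →
      Derivable (hasType Γ p (.path A a b)) →
      Derivable (hasType Γ (.pathInd C c a b p) (C.inst₃ a b p))
  | path_elim_eq {Γ A C C' c c' a a' b b' p p' i j} : Derivable (hasType Γ A (.univ i)) →
      Derivable (defEq (.path A.wk.wk (.var 1) (.var 0) :: A.wk :: A :: Γ) C C' (.univ j)) →
      Derivable (defEq (A :: Γ) c c' C.instRefl) →
      Derivable (defEq Γ a a' A) → Derivable (defEq Γ b b' A) →
      Derivable (defEq Γ p p' (.path A a b)) →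
      Derivable (defEq Γ (.pathInd C c a b p) (.pathInd C' c' a' b' p') (C.inst₃ a b p))
  | path_comp {Γ A C c a i j} : Derivable (hasType Γ A (.univ i)) →
      Derivable (hasType (.path A.wk.wk (.var 1) (.var 0) :: A.wk :: A :: Γ) C (.univ j)) →
      Derivable (hasType (A :: Γ) c C.instRefl) → Derivable (hasType Γ a A) →
      Derivable (defEq Γ (.pathInd C c a a (.refl a)) (c.inst a) (C.inst₃ a a (.refl a)))
  -- univalence of every universe
  | univalence {Γ A B i} : Derivable (hasType Γ A (.univ i)) →
      Derivable (hasType Γ B (.univ i)) →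
      Derivable (hasType Γ (.univalence i A B)
        (Tm.isEquiv (.path (.univ i) A B) (Tm.equiv A B) (Tm.idToEquiv i A B)))
  | univalence_eq {Γ A A' B B' i} : Derivable (hasType Γ A (.univ i)) →
      Derivable (hasType Γ B (.univ i)) →
      Derivable (defEq Γ A A' (.univ i)) → Derivable (defEq Γ B B' (.univ i)) →
      Derivable (defEq Γ (.univalence i A B) (.univalence i A' B')
        (Tm.isEquiv (.path (.univ i) A B) (Tm.equiv A B) (Tm.idToEquiv i A B)))

/-- A closed type is inhabited if some closed term has that type in the empty context. -/
def IsInhabited (A : Tm) : Prop := ∃ t : Tm, Derivable (.hasType [] t A)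

end MLTT

/-! Write Ω^k(X, x) for iterated loop spaces, and let T(i, k) say that for every k-type A in U_i all
elements of Ω^(k+1)(U_i, A) are trivial (`TrivialLoops`). If U_n is an n-type, its (n+1)-fold loop
spaces are propositions, so T(n, n) holds (`trivialOfHLevel`). On the other hand T(0, 0) is false: ℕ
is a set, and univalence turns the transposition of 0 and 1 into a nontrivial loop of U_0 at ℕ
(`nontrivialLoop`). What joins the two ends is the descent from T(i+1, k+1) to T(i, k) (`descent`).

For the descent, let L be the type of triples (A, h, q) with A in U_i, h a proof that A is a k-type,
and q in Ω^(k+1)(U_i, A). It lives in U_(i+1), and it is a (k+1)-type, because paths between k-types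
form a k-type and the fibre over A is a set (`loopedTypesHLevel`). By univalence and function
extensionality, a double loop of U_(i+1) at L is the same as a family of paths x = x for x in L
(`coeEquiv`). Iterating, every section of x ↦ Ω^(k+1)(L, x) comes from an element of
Ω^(k+2)(U_(i+1), L), so T(i+1, k+1) makes every such section trivial (`trivialSections`). There is a
tautological section: at (A, h, q), lift q itself along the projection from L to U_i
(`loopedTypesLift`). For k > 0 the lift exists because a projection with set-valued fibres is an
equivalence on double loops; for k = 0 it exists because q commutes with itself. The lift is trivial
and projects to q, so q is trivial.

Function extensionality is not an axiom and is derived from univalence (`weakFunext`, `funext`).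
Identity types are recognized throughout by `fundamentalThm`: a fibrewise map from x ↦ (a = x) to a
family with contractible total space is an equivalence.

Since the claim is derivability in a deeply embedded theory, all these arguments must be terms of
that theory. They are written in a higher-order notation and accepted by a type checker that is
proved sound (`Checker.sound_check`) and evaluated by the kernel. The checker works on annotated
terms and contracts a redex only after it has found the annotations of eliminator and constructor
convertible. Soundness of normalization (`nfSound`) therefore needs neither injectivity of Π nor
confluence nor termination, and nothing is claimed about completeness. Univalence and η enter the
checked terms as hypotheses, and each lemma is checked as a function of the lemmas it uses
(`IsTheorem.of_verify`).

The number k is internal, while universe levels are external. The descent is checked once, from U_1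
to U_0, and `Derivable.shift` carries it to all levels. At numerals the internal recursion for
h-levels agrees judgmentally with `Tm.hasHLevel` (`hLevelFun_app`), which connects the checked terms
with the statement. -/

namespace MLTT

/-! ### Annotated terms -/

/-- Terms whose constructors and eliminators carry the types that a contraction has to compare. -/
inductive Exp : Type
  | var (k : ℕ) : Exp
  | univ (i : ℕ) : Exp
  | pi (A B : Exp) : Exp
  | lam (A B b : Exp) : Exp
  | app (A B f a : Exp) : Exp
  | sigma (A B : Exp) : Exp
  | pair (A B a b : Exp) : Exp
  | sigmaInd (A B C g p : Exp) : Exp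
  | fst (A B p : Exp) : Exp
  | snd (A B p : Exp) : Exp
  | empty : Exp
  | emptyInd (C e : Exp) : Exp
  | nat : Exp
  | zero : Exp
  | succ (n : Exp) : Exp
  | natInd (C c₀ c₁ n : Exp) : Exp
  | path (A a b : Exp) : Exp
  | refl (A a : Exp) : Exp
  | pathInd (A C c a b p : Exp) : Exp

/-! The functions that the kernel has to evaluate are defined by the recursors, which is much faster
than the compilation of structural recursion. -/

/-- The first projection. -/
def Tm.fst (A p : Tm) : Tm := .sigmaInd A.wk (.var 1) p

/-- The second projection. -/
def Tm.snd (A B p : Tm) : Tm := .sigmaInd (B.instUnder 1 (Tm.fst A.wk (.var 0))) (.var 0) p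

namespace Exp

/-- The raw term under an annotated one. -/
noncomputable def erase (e : Exp) : Tm :=
  Exp.rec (motive := fun _ => Tm)
    (var := .var)
    (univ := .univ)
    (pi := fun _ _ A B => .pi A B)
    (lam := fun _ _ _ A _ b => .lam A b)
    (app := fun _ _ _ _ _ _ f a => .app f a)
    (sigma := fun _ _ A B => .sigma A B)
    (pair := fun _ _ _ _ _ _ a b => .pair a b)
    (sigmaInd := fun _ _ _ _ _ _ _ C g p => .sigmaInd C g p)
    (fst := fun _ _ _ A _ p => Tm.fst A p)
    (snd := fun _ _ _ A B p => Tm.snd A B p)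
    (empty := .empty)
    (emptyInd := fun _ _ C e => .emptyInd C e)
    (nat := .nat)
    (zero := .zero)
    (succ := fun _ n => .succ n)
    (natInd := fun _ _ _ _ C z s n => .natInd C z s n)
    (path := fun _ _ _ A a b => .path A a b)
    (refl := fun _ _ _ a => .refl a)
    (pathInd := fun _ _ _ _ _ _ _ C c a b p => .pathInd C c a b p)
    e

noncomputable def rename (e : Exp) : (ℕ → ℕ) → Exp :=
  Exp.rec (motive := fun _ => (ℕ → ℕ) → Exp)
    (var := fun k ρ => var (ρ k))
    (univ := fun i _ => univ i)
    (pi := fun _ _ A B ρ => pi (A ρ) (B (upRen ρ)))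
    (lam := fun _ _ _ A B b ρ => lam (A ρ) (B (upRen ρ)) (b (upRen ρ)))
    (app := fun _ _ _ _ A B f a ρ => app (A ρ) (B (upRen ρ)) (f ρ) (a ρ))
    (sigma := fun _ _ A B ρ => sigma (A ρ) (B (upRen ρ)))
    (pair := fun _ _ _ _ A B a b ρ => pair (A ρ) (B (upRen ρ)) (a ρ) (b ρ))
    (sigmaInd := fun _ _ _ _ _ A B C g p ρ =>
      sigmaInd (A ρ) (B (upRen ρ)) (C (upRen ρ)) (g (upRen (upRen ρ))) (p ρ))
    (fst := fun _ _ _ A B p ρ => fst (A ρ) (B (upRen ρ)) (p ρ))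
    (snd := fun _ _ _ A B p ρ => snd (A ρ) (B (upRen ρ)) (p ρ))
    (empty := fun _ => empty)
    (emptyInd := fun _ _ C e ρ => emptyInd (C (upRen ρ)) (e ρ))
    (nat := fun _ => nat)
    (zero := fun _ => zero)
    (succ := fun _ n ρ => succ (n ρ))
    (natInd := fun _ _ _ _ C z s n ρ =>
      natInd (C (upRen ρ)) (z ρ) (s (upRen (upRen ρ))) (n ρ))
    (path := fun _ _ _ A a b ρ => path (A ρ) (a ρ) (b ρ))
    (refl := fun _ _ A a ρ => refl (A ρ) (a ρ))
    (pathInd := fun _ _ _ _ _ _ A C c a b p ρ =>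
      pathInd (A ρ) (C (upRen (upRen (upRen ρ)))) (c (upRen ρ)) (a ρ) (b ρ) (p ρ))
    e

noncomputable def wk (e : Exp) : Exp := e.rename Nat.succ

/-- A substitution, moved under one binder. -/
noncomputable def up (σ : ℕ → Exp) (k : ℕ) : Exp :=
  Nat.rec (motive := fun _ => Exp) (var 0) (fun k _ => (σ k).wk) k

noncomputable def subst (e : Exp) : (ℕ → Exp) → Exp :=
  Exp.rec (motive := fun _ => (ℕ → Exp) → Exp)
    (var := fun k σ => σ k)
    (univ := fun i _ => univ i)
    (pi := fun _ _ A B σ => pi (A σ) (B (up σ)))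
    (lam := fun _ _ _ A B b σ => lam (A σ) (B (up σ)) (b (up σ)))
    (app := fun _ _ _ _ A B f a σ => app (A σ) (B (up σ)) (f σ) (a σ))
    (sigma := fun _ _ A B σ => sigma (A σ) (B (up σ)))
    (pair := fun _ _ _ _ A B a b σ => pair (A σ) (B (up σ)) (a σ) (b σ))
    (sigmaInd := fun _ _ _ _ _ A B C g p σ =>
      sigmaInd (A σ) (B (up σ)) (C (up σ)) (g (up (up σ))) (p σ))
    (fst := fun _ _ _ A B p σ => fst (A σ) (B (up σ)) (p σ))
    (snd := fun _ _ _ A B p σ => snd (A σ) (B (up σ)) (p σ))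
    (empty := fun _ => empty)
    (emptyInd := fun _ _ C e σ => emptyInd (C (up σ)) (e σ))
    (nat := fun _ => nat)
    (zero := fun _ => zero)
    (succ := fun _ n σ => succ (n σ))
    (natInd := fun _ _ _ _ C z s n σ => natInd (C (up σ)) (z σ) (s (up (up σ))) (n σ))
    (path := fun _ _ _ A a b σ => path (A σ) (a σ) (b σ))
    (refl := fun _ _ A a σ => refl (A σ) (a σ))
    (pathInd := fun _ _ _ _ _ _ A C c a b p σ =>
      pathInd (A σ) (C (up (up (up σ)))) (c (up σ)) (a σ) (b σ) (p σ))
    e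

/-- Extension of a substitution by the value of the innermost variable. -/
noncomputable def cons (t : Exp) (σ : ℕ → Exp) (k : ℕ) : Exp :=
  Nat.rec (motive := fun _ => Exp) t (fun k _ => σ k) k

noncomputable def inst (b a : Exp) : Exp := b.subst (cons a var)

noncomputable def instUnder (m : ℕ) (C t : Exp) : Exp :=
  C.subst (cons t (fun k => var (k + m)))

noncomputable def inst₃ (C a b p : Exp) : Exp := C.subst (cons p (cons b (cons a var)))

noncomputable def instRefl (C A : Exp) : Exp :=
  C.subst (cons (refl A.wk (var 0)) (cons (var 0) (cons (var 0) (fun k => var (k + 1)))))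

/-- Equality of the underlying raw terms. -/
noncomputable def same (e : Exp) : Exp → Bool :=
  Exp.rec (motive := fun _ => Exp → Bool)
    (var := fun k e => match e with | var k' => Nat.beq k k' | _ => false)
    (univ := fun i e => match e with | univ i' => Nat.beq i i' | _ => false)
    (pi := fun _ _ A B e => match e with | pi A' B' => A A' && B B' | _ => false)
    (lam := fun _ _ _ A _ b e => match e with | lam A' _ b' => A A' && b b' | _ => false)
    (app := fun _ _ _ _ _ _ f a e => match e with | app _ _ f' a' => f f' && a a' | _ => false)
    (sigma := fun _ _ A B e => match e with | sigma A' B' => A A' && B B' | _ => false)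
    (pair := fun _ _ _ _ _ _ a b e => match e with | pair _ _ a' b' => a a' && b b' | _ => false)
    (sigmaInd := fun _ _ _ _ _ _ _ C g p e => match e with
      | sigmaInd _ _ C' g' p' => p p' && (g g' && C C') | _ => false)
    (fst := fun _ _ _ A _ p e => match e with | fst A' _ p' => p p' && A A' | _ => false)
    (snd := fun _ _ _ A B p e => match e with
      | snd A' B' p' => p p' && (A A' && B B') | _ => false)
    (empty := fun e => match e with | empty => true | _ => false)
    (emptyInd := fun _ _ C n e => match e with | emptyInd C' n' => n n' && C C' | _ => false)
    (nat := fun e => match e with | nat => true | _ => false)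
    (zero := fun e => match e with | zero => true | _ => false)
    (succ := fun _ n e => match e with | succ n' => n n' | _ => false)
    (natInd := fun _ _ _ _ C z s n e => match e with
      | natInd C' z' s' n' => n n' && (z z' && (s s' && C C')) | _ => false)
    (path := fun _ _ _ A a b e => match e with
      | path A' a' b' => a a' && (b b' && A A') | _ => false)
    (refl := fun _ _ _ a e => match e with | refl _ a' => a a' | _ => false)
    (pathInd := fun _ _ _ _ _ _ _ C c a b p e => match e with
      | pathInd _ C' c' a' b' p' => p p' && (a a' && (b b' && (c c' && C C'))) | _ => false)
    e

/-! Normalization; a redex is contracted only if its annotations agree. The parameter `nf` stands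
for normalization with less fuel. -/

section
variable (nf : Exp → Exp)

/-- Do `A` and `B` have the same normal form? -/
noncomputable def agree (A B : Exp) : Bool :=
  match A.same B with
  | true => true
  | false => (nf A).same (nf B)

/-- In a stuck application `A` and `B` stay unnormalized: they do not survive erasure, and `same`
does not look at them. -/
noncomputable def nfApp (A B f' a : Exp) : Exp := match f' with
  | lam A₁ B₁ b => match agree nf A A₁ && agree nf B B₁ with
    | true => nf (b.inst a)
    | false => app A B (lam A₁ B₁ b) (nf a)
  | f' => app A B f' (nf a)

noncomputable def nfSigmaInd (A B C g p' : Exp) : Exp := match p' with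
  | pair A₁ B₁ a b => match agree nf A A₁ && agree nf B B₁ with
    | true => nf (g.subst (cons b (cons a var)))
    | false => sigmaInd A B (nf C) (nf g) (pair A₁ B₁ a b)
  | p' => sigmaInd A B (nf C) (nf g) p'

/-- The caller passes a normalized pair, so its component is returned as it is. Unlike in `nfApp`,
the stuck form normalizes `A`, because the raw first projection contains `A` in its motive. -/
noncomputable def nfFst (A B p' : Exp) : Exp := match p' with
  | pair A₁ B₁ a b => match agree nf A A₁ && agree nf B B₁ with
    | true => a
    | false => fst (nf A) B (pair A₁ B₁ a b)
  | p' => fst (nf A) B p'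

noncomputable def nfSnd (A B p' : Exp) : Exp := match p' with
  | pair A₁ B₁ a b => match agree nf A A₁ && agree nf B B₁ with
    | true => b
    | false => snd (nf A) (nf B) (pair A₁ B₁ a b)
  | p' => snd (nf A) (nf B) p'

noncomputable def nfNatInd (C z s n' : Exp) : Exp := match n' with
  | zero => nf z
  | succ n => nf (s.subst (cons (natInd C z s n) (cons n var)))
  | n' => natInd (nf C) (nf z) (nf s) n'

noncomputable def nfPathInd (A C c a b p' : Exp) : Exp := match p' with
  | refl A₁ a₁ => match agree nf A A₁ && (agree nf a a₁ && agree nf b a₁) with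
    | true => nf (c.inst a)
    | false => pathInd A (nf C) (nf c) (nf a) (nf b) (refl A₁ a₁)
  | p' => pathInd A (nf C) (nf c) (nf a) (nf b) p'

noncomputable def nfStep (e : Exp) : Exp :=
  Exp.rec (motive := fun _ => Exp)
    (var := fun k => var k)
    (univ := fun i => univ i)
    (pi := fun A B _ _ => pi (nf A) (nf B))
    (lam := fun A B b _ _ _ => lam (nf A) B (nf b))
    (app := fun A B f a _ _ _ _ => nfApp nf A B (nf f) a)
    (sigma := fun A B _ _ => sigma (nf A) (nf B))
    (pair := fun A B a b _ _ _ _ => pair A B (nf a) (nf b))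
    (sigmaInd := fun A B C g p _ _ _ _ _ => nfSigmaInd nf A B C g (nf p))
    (fst := fun A B p _ _ _ => nfFst nf A B (nf p))
    (snd := fun A B p _ _ _ => nfSnd nf A B (nf p))
    (empty := empty)
    (emptyInd := fun C e _ _ => emptyInd (nf C) (nf e))
    (nat := nat)
    (zero := zero)
    (succ := fun n _ => succ (nf n))
    (natInd := fun C z s n _ _ _ _ => nfNatInd nf C z s (nf n))
    (path := fun A a b _ _ _ => path (nf A) (nf a) (nf b))
    (refl := fun A a _ _ => refl A (nf a))
    (pathInd := fun A C c a b p _ _ _ _ _ _ => nfPathInd nf A C c a b (nf p))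
    e

end

/-- Without fuel the term is returned unchanged, which is still sound; so termination of reduction
is never an issue, and the amount of fuel affects only what is accepted. -/
noncomputable def nfFuel (m : ℕ) : Exp → Exp :=
  Nat.rec (motive := fun _ => Exp → Exp) (fun e => e) (fun _ nf => nfStep nf) m

noncomputable def nf : Exp → Exp := nfFuel 1000

/-! ### Conversion, and the recognition of the shape of a type. -/

/-- Convertibility, by comparing normal forms. -/
noncomputable def conv (S T : Exp) : Bool := agree nf S T

/-- Cumulativity is recognized only between two universes, not below Π or Σ. -/
noncomputable def subNf (S T : Exp) : Bool :=
  match S with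
  | univ i => match T with
    | univ j => Nat.ble i j
    | _ => false
  | S => S.same T

/-- Convertibility of types, or inclusion of universes. -/
noncomputable def sub (S T : Exp) : Bool :=
  match S.same T with
  | true => true
  | false => subNf (nf S) (nf T)

/-- The level, if `T` is a universe. -/
noncomputable def asUniv (T : Exp) : Option ℕ := match T with
  | univ i => some i
  | T => match nf T with
    | univ i => some i
    | _ => none

noncomputable def asPi (T : Exp) : Option (Exp × Exp) := match T with
  | pi A B => some (A, B)
  | T => match nf T with
    | pi A B => some (A, B)
    | _ => none

noncomputable def asSigma (T : Exp) : Option (Exp × Exp) := match T with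
  | sigma A B => some (A, B)
  | T => match nf T with
    | sigma A B => some (A, B)
    | _ => none

noncomputable def asPath (T : Exp) : Option (Exp × Exp × Exp) := match T with
  | path A a b => some (A, a, b)
  | T => match nf T with
    | path A a b => some (A, a, b)
    | _ => none

/-- The type of a variable. -/
noncomputable def lookup (Γ : List Exp) : ℕ → Option Exp :=
  List.rec (motive := fun _ => ℕ → Option Exp) (fun _ => none)
    (fun A _ ih k => Nat.rec (motive := fun _ => Option Exp) (some A) (fun k _ => ih k) k) Γ

/-- Compare the inferred type of `e` with the expected one, if there is one. -/
noncomputable def expect (e S : Exp) (m : Option Exp) : Option (Exp × Exp) := match m with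
  | none => some (e, S)
  | some T => match S.sub T with
    | true => some (e, T)
    | false => none

end Exp
open Exp

/-! The type checker, for every constructor of raw terms; the arguments are the checkers of the
subterms. With an expected type a checker checks, without one it infers. -/

/-- The result is an annotated term and its type. -/
abbrev Checker := List Exp → Option Exp → Option (Exp × Exp)

namespace Checker

/-- Check that the term is a type. -/
noncomputable def type (A : Checker) (Γ : List Exp) (k : Exp → ℕ → Option (Exp × Exp)) :
    Option (Exp × Exp) :=
  match A Γ none with
  | some (A', U) => match asUniv U with
    | some i => k A' i
    | none => none
  | none => none

/-- Check that the term has type `T`. -/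
noncomputable def ofType (a : Checker) (Γ : List Exp) (T : Exp) (k : Exp → Option (Exp × Exp)) :
    Option (Exp × Exp) :=
  match a Γ (some T) with
  | some (a', _) => k a'
  | none => none

noncomputable def pi (A B : Checker) : Checker := fun Γ m =>
  A.type Γ fun A i => B.type (A :: Γ) fun B j => expect (.pi A B) (.univ (max i j)) m

/-- Against an expected type the domain is taken from that type, and the annotation of the raw λ is
discarded. The checker may thus return a term that erases to something other than its input;
soundness concerns the returned term. -/
noncomputable def lam (A b : Checker) : Checker := fun Γ m => match m with
  | none => A.type Γ fun A _ => match b (A :: Γ) none with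
    | some (b, B) => some (.lam A B b, .pi A B)
    | none => none
  | some T => match asPi T with
    | some (A, B) => b.ofType (A :: Γ) B fun b => some (.lam A B b, T)
    | none => none

noncomputable def app (f a : Checker) : Checker := fun Γ m => match f Γ none with
  | some (f, T) => match asPi T with
    | some (A, B) => a.ofType Γ A fun a => expect (.app A B f a) (B.inst a) m
    | none => none
  | none => none

noncomputable def sigma (A B : Checker) : Checker := fun Γ m =>
  A.type Γ fun A i => B.type (A :: Γ) fun B j => expect (.sigma A B) (.univ (max i j)) m

noncomputable def pair (a b : Checker) : Checker := fun Γ m => match m with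
  | none => none
  | some T => match asSigma T with
    | some (A, B) => a.ofType Γ A fun a => b.ofType Γ (B.inst a) fun b => some (.pair A B a b, T)
    | none => none

noncomputable def sigmaInd (C g p : Checker) : Checker := fun Γ m => match p Γ none with
  | some (p, T) => match asSigma T with
    | some (A, B) => C.type (.sigma A B :: Γ) fun C _ =>
      g.ofType (B :: A :: Γ) (C.instUnder 2
        (.pair (A.rename (· + 2)) (B.rename (upRen (· + 2))) (.var 1) (.var 0))) fun g =>
      expect (.sigmaInd A B C g p) (C.inst p) m
    | none => none
  | none => none

noncomputable def fst (p : Checker) : Checker := fun Γ m => match p Γ none with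
  | some (p, T) => match asSigma T with
    | some (A, B) => expect (.fst A B p) A m
    | none => none
  | none => none

noncomputable def snd (p : Checker) : Checker := fun Γ m => match p Γ none with
  | some (p, T) => match asSigma T with
    | some (A, B) => expect (.snd A B p) (B.inst (.fst A B p)) m
    | none => none
  | none => none

noncomputable def emptyInd (C e : Checker) : Checker := fun Γ m =>
  C.type (.empty :: Γ) fun C _ => e.ofType Γ .empty fun e => expect (.emptyInd C e) (C.inst e) m

noncomputable def succ (n : Checker) : Checker := fun Γ m =>
  n.ofType Γ .nat fun n => expect (.succ n) .nat m

noncomputable def natInd (C z s n : Checker) : Checker := fun Γ m =>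
  C.type (.nat :: Γ) fun C _ => z.ofType Γ (C.inst .zero) fun z =>
  s.ofType (C :: .nat :: Γ) (C.instUnder 2 (.succ (.var 1))) fun s =>
  n.ofType Γ .nat fun n => expect (.natInd C z s n) (C.inst n) m

noncomputable def path (A a b : Checker) : Checker := fun Γ m =>
  A.type Γ fun A i => a.ofType Γ A fun a => b.ofType Γ A fun b => expect (.path A a b) (.univ i) m

noncomputable def refl (a : Checker) : Checker := fun Γ m => match m with
  | none => match a Γ none with
    | some (a, A) => some (.refl A a, .path A a a)
    | none => none
  | some T => match asPath T with
    | some (A, x, y) => a.ofType Γ A fun a => match a.conv x && a.conv y with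
      | true => some (.refl A a, T)
      | false => none
    | none => none

noncomputable def pathInd (C c a b p : Checker) : Checker := fun Γ m => match p Γ none with
  | some (p, T) => match asPath T with
    | some (A, x, y) =>
      C.type (.path A.wk.wk (.var 1) (.var 0) :: A.wk :: A :: Γ) fun C _ =>
      c.ofType (A :: Γ) (C.instRefl A) fun c => a.ofType Γ A fun a => b.ofType Γ A fun b =>
      match a.conv x && b.conv y with
      | true => expect (.pathInd A C c a b p) (C.inst₃ a b p) m
      | false => none
    | none => none
  | none => none

noncomputable def fail : Checker := fun _ _ => none

end Checker

/-- Bidirectional type checking. -/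
noncomputable def Tm.check (t : Tm) : Checker :=
  Tm.rec (motive := fun _ => Checker)
    (var := fun k Γ m => match lookup Γ k with
      -- `lookup` returns the type as it was declared, in the tail of the context; it has to be
      -- weakened past the variable itself and the `k` later ones.
      | some S => expect (.var k) (S.rename (· + (k + 1))) m
      | none => none)
    (univ := fun i _ m => expect (.univ i) (.univ (i + 1)) m)
    (pi := fun _ _ A B => .pi A B)
    (lam := fun _ _ A b => .lam A b)
    (app := fun _ _ f a => .app f a)
    (sigma := fun _ _ A B => .sigma A B)
    (pair := fun _ _ a b => .pair a b)
    -- A branch that is a bare variable marks a projection. Its motive is ignored and recomputed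
    -- from the type of `p`, so proof terms may carry a dummy there.
    (sigmaInd := fun _ g₀ _ C g p => match g₀ with
      | .var 0 => .snd p
      | .var 1 => .fst p
      | _ => .sigmaInd C g p)
    -- Coproducts, the unit type and the univalence constant do not occur in the checked terms.
    -- Univalence is passed to them as a hypothesis.
    (sum := fun _ _ _ _ => .fail)
    (inl := fun _ _ => .fail)
    (inr := fun _ _ => .fail)
    (sumInd := fun _ _ _ _ _ _ _ _ => .fail)
    (empty := fun _ m => expect .empty (.univ 0) m)
    (emptyInd := fun _ _ C e => .emptyInd C e)
    (unit := .fail)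
    (star := .fail)
    (unitInd := fun _ _ _ _ _ _ => .fail)
    (nat := fun _ m => expect .nat (.univ 0) m)
    (zero := fun _ m => expect .zero .nat m)
    (succ := fun _ n => .succ n)
    (natInd := fun _ _ _ _ C z s n => .natInd C z s n)
    (path := fun _ _ _ A a b => .path A a b)
    (refl := fun _ a => .refl a)
    (pathInd := fun _ _ _ _ _ C c a b p => .pathInd C c a b p)
    (univalence := fun _ _ _ _ _ => .fail)
    t

end MLTT

/-! ### Metatheory: admissible rules, and soundness of the checker. -/

namespace MLTT

/-! ### The algebra of renamings and substitutions -/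

theorem upRen_comp (ρ τ : ℕ → ℕ) : (fun k => upRen τ (upRen ρ k)) = upRen fun k => τ (ρ k) := by
  funext k; cases k <;> rfl

theorem upSub_var : upSub Tm.var = Tm.var := by
  funext k; cases k <;> rfl

theorem upSub_ren (ρ : ℕ → ℕ) : (upSub fun k => .var (ρ k)) = fun k => .var (upRen ρ k) := by
  funext k; cases k <;> rfl

@[simp] theorem upSub_zero (σ : ℕ → Tm) : upSub σ 0 = .var 0 := rfl

@[simp] theorem upSub_succ (σ : ℕ → Tm) (k : ℕ) : upSub σ (k + 1) = (σ k).wk := rfl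

@[simp] theorem consSub_zero (t : Tm) (σ : ℕ → Tm) : consSub t σ 0 = t := rfl

@[simp] theorem consSub_succ (t : Tm) (σ : ℕ → Tm) (k : ℕ) : consSub t σ (k + 1) = σ k := rfl

namespace Tm

theorem rename_eq_subst (t : Tm) (ρ : ℕ → ℕ) : t.rename ρ = t.subst fun k => .var (ρ k) := by
  induction t generalizing ρ <;> simp_all [rename, subst, upSub_ren]

theorem subst_var (t : Tm) : t.subst var = t := by
  induction t <;> simp_all [subst, upSub_var]

theorem rename_rename (t : Tm) (ρ τ : ℕ → ℕ) :
    (t.rename ρ).rename τ = t.rename fun k => τ (ρ k) := by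
  induction t generalizing ρ τ <;> simp_all [rename, upRen_comp]

theorem rename_subst (t : Tm) (ρ : ℕ → ℕ) (σ : ℕ → Tm) :
    (t.rename ρ).subst σ = t.subst fun k => σ (ρ k) := by
  have up (ρ : ℕ → ℕ) (σ : ℕ → Tm) :
      (fun k => upSub σ (upRen ρ k)) = upSub fun k => σ (ρ k) := by
    funext k; cases k <;> rfl
  induction t generalizing ρ σ <;> simp_all [rename, subst]

theorem subst_rename (t : Tm) (σ : ℕ → Tm) (ρ : ℕ → ℕ) :
    (t.subst σ).rename ρ = t.subst fun k => (σ k).rename ρ := by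
  have up (σ : ℕ → Tm) (ρ : ℕ → ℕ) :
      (fun k => (upSub σ k).rename (upRen ρ)) = upSub fun k => (σ k).rename ρ := by
    funext k; cases k <;> simp [upSub, wk, rename_rename, upRen, rename]
  induction t generalizing ρ σ <;> simp_all [rename, subst]

theorem subst_subst (t : Tm) (σ τ : ℕ → Tm) :
    (t.subst σ).subst τ = t.subst fun k => (σ k).subst τ := by
  have up (σ τ : ℕ → Tm) :
      (fun k => (upSub σ k).subst (upSub τ)) = upSub fun k => (σ k).subst τ := by
    funext k; cases k <;> simp [upSub, wk, rename_subst, subst_rename, subst]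
  induction t generalizing σ τ <;> simp_all [subst]

@[simp] theorem wk_subst_upSub (t : Tm) (σ : ℕ → Tm) : t.wk.subst (upSub σ) = (t.subst σ).wk := by
  simp [wk, rename_subst, subst_rename, upSub]

theorem wk_subst_consSub (t a : Tm) (σ : ℕ → Tm) : t.wk.subst (consSub a σ) = t.subst σ := by
  simp [wk, rename_subst, consSub]

@[simp] theorem wk_inst (t a : Tm) : t.wk.inst a = t := by
  simp [inst, wk_subst_consSub, subst_var]

@[simp] theorem inst_subst (B a : Tm) (σ : ℕ → Tm) :
    (B.inst a).subst σ = (B.subst (upSub σ)).inst (a.subst σ) := by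
  simp only [inst, subst_subst]
  congr 1; funext k
  cases k <;> simp [consSub, upSub, subst, wk_subst_consSub, subst_var]

@[simp] theorem instUnder_subst_upSub (C t : Tm) (σ : ℕ → Tm) :
    (C.instUnder 1 t).subst (upSub σ) = (C.subst (upSub σ)).instUnder 1 (t.subst (upSub σ)) := by
  simp only [instUnder, subst_subst]
  congr 1; funext k
  cases k <;> simp [consSub, upSub, subst, wk_subst_consSub]
  simp [wk, rename_eq_subst]

@[simp] theorem instUnder_subst_upSub₂ (C t : Tm) (σ : ℕ → Tm) :
    (C.instUnder 2 t).subst (upSub (upSub σ)) =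
      (C.subst (upSub σ)).instUnder 2 (t.subst (upSub (upSub σ))) := by
  simp only [instUnder, subst_subst]
  congr 1; funext k
  cases k <;> simp [consSub, upSub, subst, wk_subst_consSub]
  simp [wk, rename_eq_subst, subst_subst, subst]

@[simp] theorem inst₃_subst (C a b p : Tm) (σ : ℕ → Tm) : (C.inst₃ a b p).subst σ =
    (C.subst (upSub (upSub (upSub σ)))).inst₃ (a.subst σ) (b.subst σ) (p.subst σ) := by
  simp only [inst₃, subst_subst]
  congr 1; funext k
  match k with
  | 0 | 1 | 2 => simp [consSub, upSub, subst, wk, rename]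
  | k + 3 => simp [consSub, upSub, subst, wk_subst_consSub, subst_var]

@[simp] theorem instRefl_subst (C : Tm) (σ : ℕ → Tm) :
    C.instRefl.subst (upSub σ) = (C.subst (upSub (upSub (upSub σ)))).instRefl := by
  simp only [instRefl, subst_subst]
  congr 1; funext k
  match k with
  | 0 | 1 | 2 => simp [consSub, upSub, subst, wk, rename]
  | k + 3 =>
    simp [consSub, upSub, subst, wk_subst_consSub]
    simp [wk, rename_eq_subst]

@[simp] theorem subst_cons₂_subst (g a b : Tm) (σ : ℕ → Tm) :
    (g.subst (consSub b (consSub a var))).subst σ =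
      (g.subst (upSub (upSub σ))).subst (consSub (b.subst σ) (consSub (a.subst σ) var)) := by
  simp only [subst_subst]
  congr 1; funext k
  match k with
  | 0 | 1 => simp [consSub, upSub, subst, wk, rename]
  | k + 2 => simp [consSub, upSub, subst, wk_subst_consSub, subst_var]

@[simp] theorem arrow_subst (A B : Tm) (σ : ℕ → Tm) :
    (A.arrow B).subst σ = (A.subst σ).arrow (B.subst σ) := by
  simp [arrow, subst, wk_subst_upSub]

@[simp] theorem prod_subst (A B : Tm) (σ : ℕ → Tm) :
    (A.prod B).subst σ = (A.subst σ).prod (B.subst σ) := by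
  simp [prod, subst, wk_subst_upSub]

@[simp] theorem isEquiv_subst (A B f : Tm) (σ : ℕ → Tm) :
    (isEquiv A B f).subst σ = isEquiv (A.subst σ) (B.subst σ) (f.subst σ) := by
  simp [isEquiv, prod_subst, arrow_subst, subst, wk_subst_upSub, upSub]
  simp [wk, rename]

@[simp] theorem equiv_subst (A B : Tm) (σ : ℕ → Tm) :
    (equiv A B).subst σ = equiv (A.subst σ) (B.subst σ) := by
  simp [equiv, subst, isEquiv_subst, arrow_subst, wk_subst_upSub, upSub]

theorem idEquiv_subst (A : Tm) (σ : ℕ → Tm) : (idEquiv A).subst σ = idEquiv (A.subst σ) := by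
  simp [idEquiv, idFun, subst, upSub]

@[simp] theorem idToEquiv_subst (i : ℕ) (A B : Tm) (σ : ℕ → Tm) :
    (idToEquiv i A B).subst σ = idToEquiv i (A.subst σ) (B.subst σ) := by
  simp [idToEquiv, subst, equiv_subst, idEquiv_subst, wk_subst_upSub, upSub]
  simp [wk, rename]

end Tm
end MLTT

namespace MLTT
open Judgment

/-! ### Substitution and weakening are admissible -/

/-- Substitution in a judgment, except for its context. -/
def Judgment.substs (Δ : Ctx) (σ : ℕ → Tm) : Judgment → Judgment
  | isCtx _ => isCtx Δ
  | hasType _ a A => hasType Δ (a.subst σ) (A.subst σ)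
  | defEq _ a b A => defEq Δ (a.subst σ) (b.subst σ) (A.subst σ)

def Judgment.ctx : Judgment → Ctx
  | isCtx Γ => Γ
  | hasType Γ _ _ => Γ
  | defEq Γ _ _ _ => Γ

theorem Derivable.ctx {J : Judgment} (h : Derivable J) : Derivable (isCtx J.ctx) := by
  induction h with
  | ctx_nil => exact .ctx_nil
  | ctx_cons hΓ hA => exact .ctx_cons hΓ hA
  | _ => assumption

/-- One induction over derivations serves twice, for an abstract class `R` of substitutions. Pushing
a substitution under a binder needs weakening, so renamings come first (`substs_renaming`), and
general substitutions afterwards (`substs`). -/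
theorem Derivable.subst_of {R : Ctx → (ℕ → Tm) → Ctx → Prop}
    (var : ∀ {Δ σ Γ k A}, R Δ σ Γ → Derivable (isCtx Δ) → Lookup Γ k A →
      Derivable (hasType Δ (σ k) (A.subst σ)))
    (up : ∀ {Δ σ Γ i} A, R Δ σ Γ → Derivable (hasType Δ (A.subst σ) (.univ i)) →
      R (A.subst σ :: Δ) (upSub σ) (A :: Γ))
    (wk : ∀ {Δ σ Γ i} A, R Δ σ Γ → Derivable (hasType Δ A (.univ i)) →
      R (A :: Δ) (fun k => (σ k).wk) Γ)
    {J : Judgment} (h : Derivable J) {Δ : Ctx} {σ : ℕ → Tm} (hσ : R Δ σ J.ctx)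
    (hΔ : Derivable (isCtx Δ)) : Derivable (J.substs Δ σ) := by
  -- The motive of a path elimination lives in a context that contains `A.wk`, for which there is no
  -- induction hypothesis. The one for `A` is used instead, along `σ` followed by weakening; this is
  -- what the closure condition `wk` is for.
  have path {Δ σ Γ i} (A : Tm) (hσ : R Δ σ Γ) (hΔ : Derivable (isCtx Δ))
      (ih : ∀ {Δ σ}, R Δ σ Γ → Derivable (isCtx Δ) →
        Derivable (hasType Δ (A.subst σ) (.univ i))) : ∃ Δ', Derivable (isCtx Δ') ∧
      R Δ' (upSub (upSub (upSub σ))) (.path A.wk.wk (.var 1) (.var 0) :: A.wk :: A :: Γ) ∧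
      Δ' = .path (A.subst σ).wk.wk (.var 1) (.var 0) :: (A.subst σ).wk :: A.subst σ :: Δ := by
    have h := ih hσ hΔ
    have hwk : Derivable (hasType (A.subst σ :: Δ) (A.wk.subst (upSub σ)) (.univ i)) := by
      rw [Tm.wk_subst_upSub]
      simpa [Tm.wk, Tm.subst_rename] using ih (wk _ hσ h) (.ctx_cons hΔ h)
    have hΔ₂ := Derivable.ctx_cons (.ctx_cons hΔ h) hwk
    have hp : Derivable (hasType (A.wk.subst (upSub σ) :: A.subst σ :: Δ)
        ((Tm.path A.wk.wk (.var 1) (.var 0)).subst (upSub (upSub σ))) (.univ i)) := by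
      refine .path_form ?_ (.var hΔ₂ ?_) (.var hΔ₂ ?_)
      · have e : A.wk.wk.subst (upSub (upSub σ)) = A.subst fun k => (σ k).wk.wk := by
          simp [Tm.wk, Tm.rename_subst, upSub]
        exact e ▸ ih (wk _ (wk _ hσ h) hwk) hΔ₂
      · simpa using .there _ (.here _ _)
      · simpa using .here _ _
    refine ⟨_, .ctx_cons hΔ₂ hp, up _ (up _ (up _ hσ h) hwk) hp, ?_⟩
    simp [Tm.subst, upSub]
    simp [Tm.wk, Tm.rename]
  induction h generalizing Δ σ <;> simp only [Judgment.substs, Judgment.ctx, Tm.subst] at *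
  case ctx_nil => exact hΔ
  case ctx_cons => exact hΔ
  case var hl _ => exact var hσ hΔ hl
  case eq_refl ih => exact .eq_refl (ih hσ hΔ)
  case eq_symm ih => exact .eq_symm (ih hσ hΔ)
  case eq_trans ih₁ ih₂ => exact .eq_trans (ih₁ hσ hΔ) (ih₂ hσ hΔ)
  case conv ih₁ ih₂ => exact .conv (ih₁ hσ hΔ) (ih₂ hσ hΔ)
  case eq_conv ih₁ ih₂ => exact .eq_conv (ih₁ hσ hΔ) (ih₂ hσ hΔ)
  case univ_intro => exact .univ_intro _ hΔ
  case univ_cumul ih => exact .univ_cumul (ih hσ hΔ)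
  case univ_cumul_eq ih => exact .univ_cumul_eq (ih hσ hΔ)
  case pi_form ihA ihB =>
    have A := ihA hσ hΔ
    exact .pi_form A (ihB (up _ hσ A) (.ctx_cons hΔ A))
  case pi_form_eq ihA ihA' ihB =>
    have A := ihA hσ hΔ
    exact .pi_form_eq A (ihA' hσ hΔ) (ihB (up _ hσ A) (.ctx_cons hΔ A))
  case pi_intro ihA ihb =>
    have A := ihA hσ hΔ
    exact .pi_intro A (ihb (up _ hσ A) (.ctx_cons hΔ A))
  case pi_intro_eq ihA ihA' ihb =>
    have A := ihA hσ hΔ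
    exact .pi_intro_eq A (ihA' hσ hΔ) (ihb (up _ hσ A) (.ctx_cons hΔ A))
  case pi_elim ihf iha => simpa using .pi_elim (ihf hσ hΔ) (iha hσ hΔ)
  case pi_elim_eq ihf iha => simpa using .pi_elim_eq (ihf hσ hΔ) (iha hσ hΔ)
  case pi_comp ihA ihb iha =>
    have A := ihA hσ hΔ
    simpa using .pi_comp A (ihb (up _ hσ A) (.ctx_cons hΔ A)) (iha hσ hΔ)
  case pi_uniq ihf => simpa [upSub] using .pi_uniq (ihf hσ hΔ)
  case sigma_form ihA ihB =>
    have A := ihA hσ hΔ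
    exact .sigma_form A (ihB (up _ hσ A) (.ctx_cons hΔ A))
  case sigma_form_eq ihA ihA' ihB =>
    have A := ihA hσ hΔ
    exact .sigma_form_eq A (ihA' hσ hΔ) (ihB (up _ hσ A) (.ctx_cons hΔ A))
  case sigma_intro ihA ihB iha ihb =>
    have A := ihA hσ hΔ
    exact .sigma_intro A (ihB (up _ hσ A) (.ctx_cons hΔ A)) (iha hσ hΔ) (by simpa using ihb hσ hΔ)
  case sigma_intro_eq ihA ihB iha ihb =>
    have A := ihA hσ hΔ
    exact .sigma_intro_eq A (ihB (up _ hσ A) (.ctx_cons hΔ A)) (iha hσ hΔ)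
      (by simpa using ihb hσ hΔ)
  case sigma_elim ihA ihB ihC ihg ihp =>
    have A := ihA hσ hΔ
    have B := ihB (up _ hσ A) (.ctx_cons hΔ A)
    have S := Derivable.sigma_form A B
    have g := ihg (up _ (up _ hσ A) B) (.ctx_cons (.ctx_cons hΔ A) B)
    simpa using .sigma_elim A B (ihC (up (.sigma _ _) hσ S) (.ctx_cons hΔ S))
      (by simpa [Tm.subst, upSub, Tm.wk, Tm.rename] using g) (ihp hσ hΔ)
  case sigma_elim_eq ihA ihB ihC ihg ihp =>
    have A := ihA hσ hΔ
    have B := ihB (up _ hσ A) (.ctx_cons hΔ A)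
    have S := Derivable.sigma_form A B
    have g := ihg (up _ (up _ hσ A) B) (.ctx_cons (.ctx_cons hΔ A) B)
    simpa using .sigma_elim_eq A B (ihC (up (.sigma _ _) hσ S) (.ctx_cons hΔ S))
      (by simpa [Tm.subst, upSub, Tm.wk, Tm.rename] using g) (ihp hσ hΔ)
  case sigma_comp ihA ihB ihC ihg iha ihb =>
    have A := ihA hσ hΔ
    have B := ihB (up _ hσ A) (.ctx_cons hΔ A)
    have S := Derivable.sigma_form A B
    have g := ihg (up _ (up _ hσ A) B) (.ctx_cons (.ctx_cons hΔ A) B)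
    simpa [Tm.subst] using .sigma_comp A B (ihC (up (.sigma _ _) hσ S) (.ctx_cons hΔ S))
      (by simpa [Tm.subst, upSub, Tm.wk, Tm.rename] using g) (iha hσ hΔ) (by simpa using ihb hσ hΔ)
  case sum_form ihA ihB => exact .sum_form (ihA hσ hΔ) (ihB hσ hΔ)
  case sum_form_eq ihA ihB => exact .sum_form_eq (ihA hσ hΔ) (ihB hσ hΔ)
  case sum_intro₁ ihA ihB iha => exact .sum_intro₁ (ihA hσ hΔ) (ihB hσ hΔ) (iha hσ hΔ)
  case sum_intro₁_eq ihA ihB iha => exact .sum_intro₁_eq (ihA hσ hΔ) (ihB hσ hΔ) (iha hσ hΔ)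
  case sum_intro₂ ihA ihB iha => exact .sum_intro₂ (ihA hσ hΔ) (ihB hσ hΔ) (iha hσ hΔ)
  case sum_intro₂_eq ihA ihB iha => exact .sum_intro₂_eq (ihA hσ hΔ) (ihB hσ hΔ) (iha hσ hΔ)
  case sum_elim ihA ihB ihC ihg ihh ihe =>
    have A := ihA hσ hΔ
    have B := ihB hσ hΔ
    have S := Derivable.sum_form A B
    simpa using .sum_elim A B (ihC (up (.sum _ _) hσ S) (.ctx_cons hΔ S))
      (by simpa [Tm.subst, upSub] using ihg (up _ hσ A) (.ctx_cons hΔ A))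
      (by simpa [Tm.subst, upSub] using ihh (up _ hσ B) (.ctx_cons hΔ B)) (ihe hσ hΔ)
  case sum_elim_eq ihA ihB ihC ihg ihh ihe =>
    have A := ihA hσ hΔ
    have B := ihB hσ hΔ
    have S := Derivable.sum_form A B
    simpa using .sum_elim_eq A B (ihC (up (.sum _ _) hσ S) (.ctx_cons hΔ S))
      (by simpa [Tm.subst, upSub] using ihg (up _ hσ A) (.ctx_cons hΔ A))
      (by simpa [Tm.subst, upSub] using ihh (up _ hσ B) (.ctx_cons hΔ B)) (ihe hσ hΔ)
  case sum_comp₁ ihA ihB ihC ihg ihh iha =>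
    have A := ihA hσ hΔ
    have B := ihB hσ hΔ
    have S := Derivable.sum_form A B
    simpa [Tm.subst] using .sum_comp₁ A B (ihC (up (.sum _ _) hσ S) (.ctx_cons hΔ S))
      (by simpa [Tm.subst, upSub] using ihg (up _ hσ A) (.ctx_cons hΔ A))
      (by simpa [Tm.subst, upSub] using ihh (up _ hσ B) (.ctx_cons hΔ B)) (iha hσ hΔ)
  case sum_comp₂ ihA ihB ihC ihg ihh ihb =>
    have A := ihA hσ hΔ
    have B := ihB hσ hΔ
    have S := Derivable.sum_form A B
    simpa [Tm.subst] using .sum_comp₂ A B (ihC (up (.sum _ _) hσ S) (.ctx_cons hΔ S))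
      (by simpa [Tm.subst, upSub] using ihg (up _ hσ A) (.ctx_cons hΔ A))
      (by simpa [Tm.subst, upSub] using ihh (up _ hσ B) (.ctx_cons hΔ B)) (ihb hσ hΔ)
  case empty_form => exact .empty_form _ hΔ
  case empty_elim ihC ihe =>
    have E := Derivable.empty_form 0 hΔ
    simpa using .empty_elim (ihC (up .empty hσ E) (.ctx_cons hΔ E)) (ihe hσ hΔ)
  case empty_elim_eq ihC ihe =>
    have E := Derivable.empty_form 0 hΔ
    simpa using .empty_elim_eq (ihC (up .empty hσ E) (.ctx_cons hΔ E)) (ihe hσ hΔ)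
  case unit_form => exact .unit_form _ hΔ
  case unit_intro => exact .unit_intro hΔ
  case unit_elim ihC ihc ihe =>
    have E := Derivable.unit_form 0 hΔ
    simpa using .unit_elim (ihC (up .unit hσ E) (.ctx_cons hΔ E))
      (by simpa [Tm.subst] using ihc hσ hΔ) (ihe hσ hΔ)
  case unit_elim_eq ihC ihc ihe =>
    have E := Derivable.unit_form 0 hΔ
    simpa using .unit_elim_eq (ihC (up .unit hσ E) (.ctx_cons hΔ E))
      (by simpa [Tm.subst] using ihc hσ hΔ) (ihe hσ hΔ)
  case unit_comp ihC ihc =>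
    have E := Derivable.unit_form 0 hΔ
    simpa [Tm.subst] using .unit_comp (ihC (up .unit hσ E) (.ctx_cons hΔ E))
      (by simpa [Tm.subst] using ihc hσ hΔ)
  case nat_form => exact .nat_form _ hΔ
  case nat_intro₁ => exact .nat_intro₁ hΔ
  case nat_intro₂ ih => exact .nat_intro₂ (ih hσ hΔ)
  case nat_intro₂_eq ih => exact .nat_intro₂_eq (ih hσ hΔ)
  case nat_elim ihC ihz ihs ihn =>
    have N := Derivable.nat_form 0 hΔ
    have C := ihC (up .nat hσ N) (.ctx_cons hΔ N)
    have s := ihs (up _ (up .nat hσ N) C) (.ctx_cons (.ctx_cons hΔ N) C)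
    simpa using .nat_elim C (by simpa [Tm.subst] using ihz hσ hΔ)
      (by simpa [Tm.subst, upSub, Tm.wk, Tm.rename] using s) (ihn hσ hΔ)
  case nat_elim_eq ihC ihC' ihz ihs ihn =>
    have N := Derivable.nat_form 0 hΔ
    have C := ihC (up .nat hσ N) (.ctx_cons hΔ N)
    have s := ihs (up _ (up .nat hσ N) C) (.ctx_cons (.ctx_cons hΔ N) C)
    simpa using .nat_elim_eq C (ihC' (up .nat hσ N) (.ctx_cons hΔ N))
      (by simpa [Tm.subst] using ihz hσ hΔ)
      (by simpa [Tm.subst, upSub, Tm.wk, Tm.rename] using s) (ihn hσ hΔ)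
  case nat_comp₁ ihC ihz ihs =>
    have N := Derivable.nat_form 0 hΔ
    have C := ihC (up .nat hσ N) (.ctx_cons hΔ N)
    have s := ihs (up _ (up .nat hσ N) C) (.ctx_cons (.ctx_cons hΔ N) C)
    simpa [Tm.subst] using .nat_comp₁ C (by simpa [Tm.subst] using ihz hσ hΔ)
      (by simpa [Tm.subst, upSub, Tm.wk, Tm.rename] using s)
  case nat_comp₂ ihC ihz ihs ihn =>
    have N := Derivable.nat_form 0 hΔ
    have C := ihC (up .nat hσ N) (.ctx_cons hΔ N)
    have s := ihs (up _ (up .nat hσ N) C) (.ctx_cons (.ctx_cons hΔ N) C)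
    simpa [Tm.subst] using .nat_comp₂ C (by simpa [Tm.subst] using ihz hσ hΔ)
      (by simpa [Tm.subst, upSub, Tm.wk, Tm.rename] using s) (ihn hσ hΔ)
  case path_form ihA iha ihb => exact .path_form (ihA hσ hΔ) (iha hσ hΔ) (ihb hσ hΔ)
  case path_form_eq ihA iha ihb => exact .path_form_eq (ihA hσ hΔ) (iha hσ hΔ) (ihb hσ hΔ)
  case path_intro ihA iha => exact .path_intro (ihA hσ hΔ) (iha hσ hΔ)
  case path_intro_eq ihA iha => exact .path_intro_eq (ihA hσ hΔ) (iha hσ hΔ)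
  case path_elim A _ _ _ _ _ _ _ _ _ _ _ _ _ ihA ihC ihc iha ihb ihp =>
    obtain ⟨Δ₂, hΔ₂, hσ₂, e⟩ := path A hσ hΔ ihA
    have A := ihA hσ hΔ
    simpa using .path_elim A (e ▸ ihC hσ₂ hΔ₂)
      (by simpa using ihc (up _ hσ A) (.ctx_cons hΔ A)) (iha hσ hΔ) (ihb hσ hΔ) (ihp hσ hΔ)
  case path_elim_eq A _ _ _ _ _ _ _ _ _ _ _ _ _ _ _ _ _ _ ihA ihC ihc iha ihb ihp =>
    obtain ⟨Δ₂, hΔ₂, hσ₂, e⟩ := path A hσ hΔ ihA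
    have A := ihA hσ hΔ
    simpa using .path_elim_eq A (e ▸ ihC hσ₂ hΔ₂)
      (by simpa using ihc (up _ hσ A) (.ctx_cons hΔ A)) (iha hσ hΔ) (ihb hσ hΔ) (ihp hσ hΔ)
  case path_comp A _ _ _ _ _ _ _ _ _ ihA ihC ihc iha =>
    obtain ⟨Δ₂, hΔ₂, hσ₂, e⟩ := path A hσ hΔ ihA
    have A := ihA hσ hΔ
    simpa [Tm.subst] using .path_comp A (e ▸ ihC hσ₂ hΔ₂)
      (by simpa using ihc (up _ hσ A) (.ctx_cons hΔ A)) (iha hσ hΔ)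
  case univalence ihA ihB => simpa [Tm.subst] using .univalence (ihA hσ hΔ) (ihB hσ hΔ)
  case univalence_eq ihA ihB ihA' ihB' =>
    simpa [Tm.subst] using .univalence_eq (ihA hσ hΔ) (ihB hσ hΔ) (ihA' hσ hΔ) (ihB' hσ hΔ)

def IsRenaming (Δ : Ctx) (ρ : ℕ → ℕ) (Γ : Ctx) : Prop :=
  ∀ ⦃k A⦄, Lookup Γ k A → Lookup Δ (ρ k) (A.rename ρ)

theorem IsRenaming.succ (A : Tm) (Γ : Ctx) : IsRenaming (A :: Γ) Nat.succ Γ :=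
  fun _ _ h => .there _ h

theorem IsRenaming.up {Δ Γ : Ctx} {ρ : ℕ → ℕ} (h : IsRenaming Δ ρ Γ) (A : Tm) :
    IsRenaming (A.rename ρ :: Δ) (upRen ρ) (A :: Γ) := by
  intro k B hk
  cases hk with
  | here => simpa [Tm.wk, Tm.rename_rename, upRen] using Lookup.here Δ (A.rename ρ)
  | there _ hk =>
    simpa [Tm.wk, Tm.rename_rename, upRen] using Lookup.there (A.rename ρ) (h hk)

theorem Derivable.substs_renaming {J : Judgment} (h : Derivable J) {Δ : Ctx} {ρ : ℕ → ℕ}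
    (hρ : IsRenaming Δ ρ J.ctx) (hΔ : Derivable (isCtx Δ)) :
    Derivable (J.substs Δ fun k => .var (ρ k)) := by
  refine h.subst_of (R := fun Δ σ Γ => ∃ ρ, σ = (fun k => .var (ρ k)) ∧ IsRenaming Δ ρ Γ)
    ?_ ?_ ?_ ⟨ρ, rfl, hρ⟩ hΔ
  · rintro Δ σ Γ k A ⟨ρ, rfl, hρ⟩ hΔ hk
    simpa [Tm.rename_eq_subst] using Derivable.var hΔ (hρ hk)
  · rintro Δ σ Γ i A ⟨ρ, rfl, hρ⟩ -
    exact ⟨upRen ρ, upSub_ren ρ, Tm.rename_eq_subst A ρ ▸ hρ.up A⟩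
  · rintro Δ σ Γ i A ⟨ρ, rfl, hρ⟩ -
    exact ⟨fun k => ρ k + 1, rfl, fun _ _ hk => by
      simpa [Tm.wk, Tm.rename_rename] using Lookup.there A (hρ hk)⟩

theorem Derivable.renameType {Γ Δ : Ctx} {a A : Tm} {ρ : ℕ → ℕ} (h : Derivable (hasType Γ a A))
    (hρ : IsRenaming Δ ρ Γ) (hΔ : Derivable (isCtx Δ)) :
    Derivable (hasType Δ (a.rename ρ) (A.rename ρ)) := by
  simpa [substs, Tm.rename_eq_subst] using h.substs_renaming hρ hΔ

theorem Derivable.wkType {Γ : Ctx} {a A B : Tm} {i : ℕ} (h : Derivable (hasType Γ a A))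
    (hB : Derivable (hasType Γ B (.univ i))) : Derivable (hasType (B :: Γ) a.wk A.wk) :=
  h.renameType (.succ B Γ) (.ctx_cons hB.ctx hB)

/-- `σ` maps the variables of `Γ` to terms in context `Δ`. -/
def IsSubst (Δ : Ctx) (σ : ℕ → Tm) (Γ : Ctx) : Prop :=
  ∀ ⦃k A⦄, Lookup Γ k A → Derivable (hasType Δ (σ k) (A.subst σ))

theorem IsSubst.up {Δ Γ : Ctx} {σ : ℕ → Tm} (h : IsSubst Δ σ Γ) {A : Tm} {i : ℕ}
    (hA : Derivable (hasType Δ (A.subst σ) (.univ i))) :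
    IsSubst (A.subst σ :: Δ) (upSub σ) (A :: Γ) := by
  intro k B hk
  cases hk with
  | here => simpa using Derivable.var (Γ := _ :: Δ) (.ctx_cons hA.ctx hA) (.here Δ _)
  | there _ hk => simpa using (h hk).wkType hA

theorem Derivable.substs {J : Judgment} (h : Derivable J) {Δ : Ctx} {σ : ℕ → Tm}
    (hσ : IsSubst Δ σ J.ctx) (hΔ : Derivable (isCtx Δ)) : Derivable (J.substs Δ σ) := by
  refine h.subst_of (R := IsSubst) (fun hσ _ hk => hσ hk) (fun A hσ hA => hσ.up hA) ?_ hσ hΔ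
  intro Δ σ Γ i A hσ hA k B hk
  simpa [Tm.wk, Tm.subst_rename] using (hσ hk).wkType hA

theorem IsSubst.consSub {Δ Γ : Ctx} {σ : ℕ → Tm} (h : IsSubst Δ σ Γ) {a A : Tm}
    (ha : Derivable (hasType Δ a (A.subst σ))) : IsSubst Δ (consSub a σ) (A :: Γ) := by
  intro k B hk
  cases hk with
  | here => simpa [Tm.wk_subst_consSub] using ha
  | there _ hk => simpa [Tm.wk_subst_consSub] using h hk

theorem IsSubst.refl {Γ : Ctx} (h : Derivable (isCtx Γ)) : IsSubst Γ Tm.var Γ :=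
  fun _ _ hk => by simpa [Tm.subst_var] using Derivable.var h hk

end MLTT

namespace MLTT
open Judgment

/-! ### Derived rules -/

namespace Derivable
variable {Γ Δ : Ctx} {a b A B : Tm} {i j : ℕ}

theorem substType {σ : ℕ → Tm} (h : Derivable (hasType Γ a A)) (hσ : IsSubst Δ σ Γ)
    (hΔ : Derivable (isCtx Δ)) : Derivable (hasType Δ (a.subst σ) (A.subst σ)) :=
  h.substs hσ hΔ

theorem substEq {σ : ℕ → Tm} (h : Derivable (defEq Γ a b A)) (hσ : IsSubst Δ σ Γ)
    (hΔ : Derivable (isCtx Δ)) : Derivable (defEq Δ (a.subst σ) (b.subst σ) (A.subst σ)) :=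
  h.substs hσ hΔ

theorem isSubst_cons (ha : Derivable (hasType Γ a A)) : IsSubst Γ (consSub a Tm.var) (A :: Γ) :=
  (IsSubst.refl (Γ := Γ) ha.ctx).consSub (by simpa [Tm.subst_var] using ha)

theorem instEq {b' : Tm} (h : Derivable (defEq (A :: Γ) b b' B)) (ha : Derivable (hasType Γ a A)) :
    Derivable (defEq Γ (b.inst a) (b'.inst a) (B.inst a)) :=
  h.substEq ha.isSubst_cons ha.ctx

/-- Equal arguments give equal instances of a type. -/
theorem inst_congr {a' : Tm} (hA : Derivable (hasType Γ A (.univ i)))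
    (hB : Derivable (hasType (A :: Γ) b B)) (hBt : Derivable (hasType (A :: Γ) B (.univ j)))
    (ha : Derivable (hasType Γ a A)) (ha' : Derivable (hasType Γ a' A))
    (h : Derivable (defEq Γ a a' A)) : Derivable (defEq Γ (b.inst a) (b.inst a') (B.inst a)) := by
  -- No rule says that substitution respects equality of the substituted term. Both instances are
  -- β-contracta of one λ-abstraction, and application has a congruence rule. The argument is run
  -- for the type first, since the two instances have different types a priori.
  have e : Derivable (defEq Γ (B.inst a') (B.inst a) (.univ j)) :=
    .eq_trans (.eq_symm (.pi_comp hA hBt ha'))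
      (.eq_trans (.pi_elim_eq (B := .univ j) (.eq_refl (.pi_intro hA hBt)) (.eq_symm h))
        (.pi_comp hA hBt ha))
  exact .eq_trans (.eq_symm (.pi_comp hA hB ha)) (.eq_trans (.pi_elim_eq (.eq_refl
    (.pi_intro hA hB)) h) (.eq_conv (.pi_comp hA hB ha') e))

theorem inst_congr_type {a' : Tm} (hA : Derivable (hasType Γ A (.univ i)))
    (hB : Derivable (hasType (A :: Γ) B (.univ j)))
    (ha : Derivable (hasType Γ a A)) (ha' : Derivable (hasType Γ a' A))
    (h : Derivable (defEq Γ a a' A)) : Derivable (defEq Γ (B.inst a) (B.inst a') (.univ j)) :=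
  inst_congr hA hB (.univ_intro j (hB.ctx)) ha ha' h

theorem isSubst_path {p : Tm} (ha : Derivable (hasType Γ a A)) (hb : Derivable (hasType Γ b A))
    (hp : Derivable (hasType Γ p (.path A a b))) :
    IsSubst Γ (consSub p (consSub b (consSub a Tm.var)))
      (.path A.wk.wk (.var 1) (.var 0) :: A.wk :: A :: Γ) :=
  ((ha.isSubst_cons).consSub (by simpa [Tm.wk_subst_consSub, Tm.subst_var] using hb)).consSub
    (by simpa [Tm.subst, Tm.wk_subst_consSub, Tm.subst_var] using hp)

/-- The method of `inst_congr` with three abstractions: `F` is the motive as a curried function,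
`beta` evaluates it at a triple, and `cong` replaces the arguments. -/
theorem inst₃_congr_type {C a' b' p p' : Tm} (hA : Derivable (hasType Γ A (.univ i)))
    (hC : Derivable (hasType (.path A.wk.wk (.var 1) (.var 0) :: A.wk :: A :: Γ) C (.univ j)))
    (ha : Derivable (hasType Γ a A)) (ha' : Derivable (hasType Γ a' A))
    (haa : Derivable (defEq Γ a a' A))
    (hb : Derivable (hasType Γ b A)) (hb' : Derivable (hasType Γ b' A))
    (hbb : Derivable (defEq Γ b b' A)) (hp : Derivable (hasType Γ p (.path A a b)))
    (hp' : Derivable (hasType Γ p' (.path A a' b')))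
    (hpp : Derivable (defEq Γ p p' (.path A a b))) :
    Derivable (defEq Γ (C.inst₃ a b p) (C.inst₃ a' b' p') (.univ j)) := by
  have hwk := hA.wkType hA
  have h₂ : Derivable (isCtx (A.wk :: A :: Γ)) := .ctx_cons hwk.ctx hwk
  have hP : Derivable (hasType (A.wk :: A :: Γ) (.path A.wk.wk (.var 1) (.var 0)) (.univ i)) :=
    .path_form (hwk.wkType hwk) (.var h₂ (.there _ (.here _ _))) (.var h₂ (.here _ _))
  let P : Tm := .path A.wk.wk (.var 1) (.var 0)
  let F : Tm := .lam A (.lam A.wk (.lam P C))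
  have h3 : Derivable (hasType (A.wk :: A :: Γ) (.lam P C) (.pi P (.univ j))) := .pi_intro hP hC
  have h2 : Derivable (hasType (A :: Γ) (.lam A.wk (.lam P C)) (.pi A.wk (.pi P (.univ j)))) :=
    .pi_intro hwk h3
  have h1 : Derivable (hasType Γ F (.pi A (.pi A.wk (.pi P (.univ j))))) := .pi_intro hA h2
  have beta {a b p : Tm} (ha : Derivable (hasType Γ a A)) (hb : Derivable (hasType Γ b A))
      (hp : Derivable (hasType Γ p (.path A a b))) :
      Derivable (defEq Γ (.app (.app (.app F a) b) p) (C.inst₃ a b p) (.univ j)) := by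
    let Pa : Tm := .path A.wk a.wk (.var 0)
    let Ca : Tm := C.subst (upSub (upSub (consSub a Tm.var)))
    let Cb : Tm := Ca.subst (upSub (consSub b Tm.var))
    have wk_inst (t a : Tm) : t.wk.subst (consSub a .var) = t := t.wk_inst a
    have ea : (Tm.lam A.wk (.lam P C)).inst a = .lam A (.lam Pa Ca) := by
      simp [Tm.inst, Tm.subst, wk_inst, P, Pa, Ca]
    have eb : (Tm.lam Pa Ca).inst b = .lam (.path A a b) Cb := by
      simp [Tm.inst, Tm.subst, wk_inst, Pa, Cb]
    have ep : Cb.inst p = C.inst₃ a b p := by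
      simp only [Cb, Ca, Tm.inst, Tm.inst₃]
      rw [Tm.subst_subst C, Tm.subst_subst C]
      congr 1; funext k
      match k with
      | 0 | 1 | 2 => simp [Tm.subst, wk_inst]
      | k + 3 => simp [wk_inst]
    have σa := ha.isSubst_cons
    have hA₁ : Derivable (hasType Γ (A.wk.subst (consSub a Tm.var)) (.univ i)) := by
      rwa [wk_inst]
    have σa' := σa.up hA₁
    rw [wk_inst] at σa'
    have hPa := hP.substType σa' (hA.wkType hA).ctx
    have hCa := hC.substType (σa'.up hPa) (.ctx_cons hPa.ctx hPa)
    simp only [Tm.subst, Tm.wk_subst_upSub, wk_inst, upSub_zero, upSub_succ, consSub_zero]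
      at hPa hCa
    have hla : Derivable (hasType (A :: Γ) (.lam Pa Ca) (.pi Pa (.univ j))) := .pi_intro hPa hCa
    have hPb := hPa.substType hb.isSubst_cons hb.ctx
    have hCb := hCa.substType ((hb.isSubst_cons).up hPb) (.ctx_cons hPb.ctx hPb)
    simp only [Tm.subst, wk_inst, consSub_zero] at hPb hCb
    have e1 := Derivable.pi_comp hA h2 ha
    have e2 := Derivable.pi_comp hA hla hb
    have e3 := Derivable.pi_comp hPb hCb hp
    rw [ea] at e1
    rw [eb] at e2
    rw [show Tm.subst (upSub (consSub b Tm.var)) Ca = Cb from rfl, ep] at e3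
    have te1 : (Tm.pi A.wk (.pi P (.univ j))).inst a = .pi A (.pi Pa (.univ j)) := by
      simp [Tm.inst, Tm.subst, wk_inst, P, Pa]
    have te2 : (Tm.pi Pa (.univ j)).inst b = .pi (.path A a b) (.univ j) := by
      simp [Tm.inst, Tm.subst, wk_inst, Pa]
    rw [te1] at e1
    have e1' := Derivable.pi_elim_eq e1 (.eq_refl hb)
    rw [te2] at e1' e2
    exact .eq_trans (.pi_elim_eq (B := .univ j) (.eq_trans e1' e2) (.eq_refl hp)) e3
  have cong : Derivable (defEq Γ (.app (.app (.app F a) b) p) (.app (.app (.app F a') b') p')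
      (.univ j)) := by
    have wk_inst (t a : Tm) : t.wk.subst (consSub a .var) = t := t.wk_inst a
    have e1 := Derivable.pi_elim_eq (.eq_refl h1) haa
    have te1 : (Tm.pi A.wk (.pi P (.univ j))).inst a =
        .pi A (.pi (.path A.wk a.wk (.var 0)) (.univ j)) := by
      simp [Tm.inst, Tm.subst, wk_inst, P]
    rw [te1] at e1
    have e2 := Derivable.pi_elim_eq e1 hbb
    have te2 : (Tm.pi (.path A.wk a.wk (.var 0)) (.univ j)).inst b =
        .pi (.path A a b) (.univ j) := by
      simp [Tm.inst, Tm.subst, wk_inst]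
    rw [te2] at e2
    exact .pi_elim_eq (B := .univ j) e2 hpp
  exact .eq_trans (.eq_symm (beta ha hb hp)) (.eq_trans cong (beta ha' hb' hp'))

theorem wkEq {C : Tm} (h : Derivable (defEq Γ a b A)) (hC : Derivable (hasType Γ C (.univ i))) :
    Derivable (defEq (C :: Γ) a.wk b.wk A.wk) := by
  have := h.substs_renaming (.succ C Γ) (.ctx_cons hC.ctx hC)
  simpa only [Judgment.substs, Tm.wk, Tm.rename_eq_subst] using this

/-- Conversion in a context. -/
theorem conv_ctx {A' : Tm} {J : Judgment} (h : Derivable J) (hJ : J.ctx = A :: Γ)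
    (e : Derivable (defEq Γ A A' (.univ i))) (hA' : Derivable (hasType Γ A' (.univ i))) :
    Derivable (J.substs (A' :: Γ) .var) := by
  have hΓ : Derivable (isCtx (A' :: Γ)) := .ctx_cons hA'.ctx hA'
  refine h.substs ?_ hΓ
  rw [hJ]
  intro k B hk
  rw [Tm.subst_var]
  cases hk with
  | here => exact .conv (.var hΓ (.here _ _)) (.eq_symm (e.wkEq hA'))
  | there _ hk => exact .var hΓ (.there _ hk)

theorem conv_ctx_type {A' : Tm} (h : Derivable (hasType (A :: Γ) b B))
    (e : Derivable (defEq Γ A A' (.univ i))) (hA' : Derivable (hasType Γ A' (.univ i))) :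
    Derivable (hasType (A' :: Γ) b B) := by
  simpa [Judgment.substs, Tm.subst_var] using h.conv_ctx rfl e hA'

/-! The projections. -/

theorem wk_instUnder (t A : Tm) (m : ℕ) : A.wk.instUnder m t = A.rename (· + m) := by
  simp [Tm.instUnder, Tm.wk_subst_consSub, Tm.rename_eq_subst]

theorem rename_add_two (A : Tm) : A.rename (· + 2) = A.wk.wk := by
  simp [Tm.wk, Tm.rename_rename]

variable {p p' A' B' : Tm}

section
variable (hA : Derivable (hasType Γ A (.univ i))) (hB : Derivable (hasType (A :: Γ) B (.univ i)))
include hA hB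

theorem fst_type (hp : Derivable (hasType Γ p (.sigma A B))) :
    Derivable (hasType Γ (.fst A p) A) := by
  have hS := Derivable.sigma_form hA hB
  simpa [Tm.fst, Tm.wk_inst] using Derivable.sigma_elim hA hB (hA.wkType hS) (g := .var 1)
    (by
      rw [wk_instUnder, rename_add_two]
      exact .var (.ctx_cons hB.ctx hB) (.there _ (.here _ _))) hp

theorem fst_congr (hAA : Derivable (defEq Γ A A' (.univ i)))
    (hpp : Derivable (defEq Γ p p' (.sigma A B))) :
    Derivable (defEq Γ (.fst A p) (.fst A' p') A) := by
  have hS := Derivable.sigma_form hA hB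
  simpa [Tm.fst, Tm.wk_inst] using Derivable.sigma_elim_eq hA hB (hAA.wkEq hS) (g := .var 1)
    (g' := .var 1)
    (by
      rw [wk_instUnder, rename_add_two]
      exact .eq_refl (.var (.ctx_cons hB.ctx hB) (.there _ (.here _ _)))) hpp

theorem fst_pair (ha : Derivable (hasType Γ a A)) (hb : Derivable (hasType Γ b (B.inst a))) :
    Derivable (defEq Γ (.fst A (.pair a b)) a A) := by
  have hS := Derivable.sigma_form hA hB
  have := Derivable.sigma_comp hA hB (hA.wkType hS) (g := .var 1)
    (by
      rw [wk_instUnder, rename_add_two]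
      exact .var (.ctx_cons hB.ctx hB) (.there _ (.here _ _))) ha hb
  simpa [Tm.fst, Tm.wk_inst, Tm.subst] using this

theorem fst_var : Derivable (hasType (.sigma A B :: Γ) (.fst A.wk (.var 0)) A.wk) := by
  have hS := Derivable.sigma_form hA hB
  have hwk := hA.wkType hS
  have hB' := hB.renameType ((IsRenaming.succ (.sigma A B) Γ).up A) (.ctx_cons hwk.ctx hwk)
  exact fst_type hwk hB' (.var hwk.ctx (.here _ _))

theorem snd_motive : Derivable (hasType (.sigma A B :: Γ)
    (B.instUnder 1 (.fst A.wk (.var 0))) (.univ i)) := by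
  have hS := Derivable.sigma_form hA hB
  refine hB.substType (Δ := .sigma A B :: Γ) (IsSubst.consSub (σ := fun k => .var (k + 1)) ?_ ?_)
    (.ctx_cons hS.ctx hS)
  · intro k C hk
    simpa [Tm.wk, Tm.rename_eq_subst] using
      Derivable.var (Γ := _ :: Γ) (.ctx_cons hS.ctx hS) (.there _ hk)
  · simpa [Tm.wk, Tm.rename_eq_subst] using fst_var hA hB

/-- The type of the second projection of a generic pair. -/
theorem snd_motive_pair : Derivable (defEq (B :: A :: Γ)
    ((B.instUnder 1 (.fst A.wk (.var 0))).instUnder 2 (.pair (.var 1) (.var 0))) B.wk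
    (.univ i)) := by
  have hΓ : Derivable (isCtx (B :: A :: Γ)) := .ctx_cons hB.ctx hB
  have hA₂ := (hA.wkType hA).wkType hB
  have hB₂ := hB.renameType (ρ := upRen (· + 2)) (Δ := A.wk.wk :: B :: A :: Γ) (by
    have := IsRenaming.up (Δ := B :: A :: Γ) (ρ := (· + 2)) (Γ := Γ) (fun k C hk => by
      rw [rename_add_two]; exact .there _ (.there _ hk)) A
    rwa [rename_add_two] at this) (.ctx_cons hΓ hA₂)
  have h1 : Derivable (hasType (B :: A :: Γ) (.var 1) A.wk.wk) := .var hΓ (.there _ (.here _ _))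
  have e : (B.rename (upRen (· + 2))).inst (.var 1) = B.wk := by
    rw [Tm.inst, Tm.rename_subst, Tm.wk, Tm.rename_eq_subst]
    congr 1; funext k; cases k <;> simp [upRen]
  have h0 : Derivable (hasType (B :: A :: Γ) (.var 0)
      ((B.rename (upRen (· + 2))).inst (.var 1))) := by
    rw [e]; exact .var hΓ (.here _ _)
  have hf := fst_pair hA₂ hB₂ h1 h0
  have hp := fst_type hA₂ hB₂ (.sigma_intro hA₂ hB₂ h1 h0)
  have := inst_congr_type hA₂ hB₂ hp h1 hf
  rw [e] at this
  convert this using 2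
  simp only [Tm.instUnder, Tm.inst, Tm.subst_subst, Tm.rename_subst]
  congr 1; funext k
  cases k with
  | zero =>
    simp [upRen, Tm.fst, Tm.subst, Tm.wk_subst_consSub]
    simp [Tm.wk, Tm.rename_eq_subst, Tm.subst_subst, Tm.subst]
  | succ k => simp [upRen, Tm.subst]

theorem snd_body : Derivable (hasType (B :: A :: Γ) (.var 0)
    ((B.instUnder 1 (.fst A.wk (.var 0))).instUnder 2 (.pair (.var 1) (.var 0)))) :=
  .conv (.var (.ctx_cons hB.ctx hB) (.here _ _)) (.eq_symm (snd_motive_pair hA hB))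

omit hA hB in
theorem snd_motive_inst (A B p : Tm) :
    (B.instUnder 1 (.fst A.wk (.var 0))).inst p = B.inst (.fst A p) := by
  simp only [Tm.instUnder, Tm.inst, Tm.subst_subst]
  congr 1; funext k
  cases k with
  | zero => simp [Tm.fst, Tm.subst, Tm.wk_subst_consSub, Tm.subst_var]; rfl
  | succ k => simp [Tm.subst]

theorem snd_type (hp : Derivable (hasType Γ p (.sigma A B))) :
    Derivable (hasType Γ (.snd A B p) (B.inst (.fst A p))) := by
  rw [← snd_motive_inst]
  exact .sigma_elim hA hB (snd_motive hA hB) (snd_body hA hB) hp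

theorem fst_type_of_eq (hA' : Derivable (hasType Γ A' (.univ i)))
    (hAA : Derivable (defEq Γ A A' (.univ i))) (hp : Derivable (hasType Γ p (.sigma A B))) :
    Derivable (hasType Γ (.fst A' p) A) :=
  .conv (fst_type hA' (hB.conv_ctx_type hAA hA')
    (.conv hp (.sigma_form_eq hA hAA (.eq_refl hB)))) (.eq_symm hAA)

theorem snd_congr (hA' : Derivable (hasType Γ A' (.univ i)))
    (hB' : Derivable (hasType (A :: Γ) B' (.univ i)))
    (hAA : Derivable (defEq Γ A A' (.univ i)))
    (hBB : Derivable (defEq (A :: Γ) B B' (.univ i)))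
    (hpp : Derivable (defEq Γ p p' (.sigma A B))) :
    Derivable (defEq Γ (.snd A B p) (.snd A' B' p') (B.inst (.fst A p))) := by
  rw [← snd_motive_inst]
  have hS := Derivable.sigma_form hA hB
  have hΓ : Derivable (isCtx (.sigma A B :: Γ)) := .ctx_cons hS.ctx hS
  have up : IsSubst (A.wk :: .sigma A B :: Γ) (fun k => .var (upRen Nat.succ k)) (A :: Γ) := by
    intro k C hk
    rw [← Tm.rename_eq_subst]
    exact .var (.ctx_cons hΓ (hA.wkType hS)) ((IsRenaming.succ (.sigma A B) Γ).up A hk)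
  have hA₁ := hA.wkType hS
  have hB₁ := hB.substType up (.ctx_cons hΓ hA₁)
  have hB₁' := hB'.substType up (.ctx_cons hΓ hA₁)
  have v : Derivable (hasType (.sigma A B :: Γ) (.var 0)
      (.sigma A.wk (B.subst fun k => .var (upRen Nat.succ k)))) := by
    have := Derivable.var hΓ (.here Γ (.sigma A B))
    rwa [Tm.wk, Tm.rename, B.rename_eq_subst] at this
  have inst (C t : Tm) : (C.subst fun k => .var (upRen Nat.succ k)).inst t = C.instUnder 1 t := by
    simp only [Tm.inst, Tm.instUnder, Tm.subst_subst]
    congr 1; funext k; cases k <;> simp [Tm.subst, upRen]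
  -- The two motives differ in the family and in the projection substituted into it: `e₁` changes
  -- the family, `e₂` the projection.
  have e₁ := (hBB.substEq up (.ctx_cons hΓ hA₁)).instEq (fst_type hA₁ hB₁ v)
  have e₂ := inst_congr_type hA₁ hB₁' (fst_type hA₁ hB₁ v)
    (fst_type_of_eq hA₁ hB₁ (hA'.wkType hS) (hAA.wkEq hS) v)
    (fst_congr hA₁ hB₁ (hAA.wkEq hS) (.eq_refl v))
  rw [inst, inst] at e₁ e₂
  exact .sigma_elim_eq hA hB (.eq_trans e₁ e₂) (.eq_refl (snd_body hA hB)) hpp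

theorem snd_pair (ha : Derivable (hasType Γ a A)) (hb : Derivable (hasType Γ b (B.inst a))) :
    Derivable (defEq Γ (.snd A B (.pair a b)) b (B.inst (.fst A (.pair a b)))) := by
  rw [← snd_motive_inst]
  exact .sigma_comp hA hB (snd_motive hA hB) (snd_body hA hB) ha hb

end

end Derivable
end MLTT

namespace MLTT
namespace Exp

/-! ### Annotated terms: computation rules of the operations -/

@[simp] theorem up_zero (σ : ℕ → Exp) : up σ 0 = var 0 := rfl

@[simp] theorem up_succ (σ : ℕ → Exp) (k : ℕ) : up σ (k + 1) = (σ k).wk := rfl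

@[simp] theorem cons_zero (t : Exp) (σ : ℕ → Exp) : cons t σ 0 = t := rfl

@[simp] theorem cons_succ (t : Exp) (σ : ℕ → Exp) (k : ℕ) : cons t σ (k + 1) = σ k := rfl

@[simp] theorem rename_var (k : ℕ) (ρ : ℕ → ℕ) :
    (var k).rename ρ = var (ρ k) := rfl

@[simp] theorem subst_var (k : ℕ) (σ : ℕ → Exp) :
    (var k).subst σ = σ k := rfl

@[simp] theorem erase_var (k : ℕ) :
    (var k).erase = .var k := rfl

@[simp] theorem rename_univ (i : ℕ) (ρ : ℕ → ℕ) :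
    (univ i).rename ρ = univ i := rfl

@[simp] theorem subst_univ (i : ℕ) (σ : ℕ → Exp) :
    (univ i).subst σ = univ i := rfl

@[simp] theorem erase_univ (i : ℕ) :
    (univ i).erase = .univ i := rfl

@[simp] theorem rename_pi (A B : Exp) (ρ : ℕ → ℕ) :
    (pi A B).rename ρ = pi (A.rename ρ) (B.rename (upRen ρ)) := rfl

@[simp] theorem subst_pi (A B : Exp) (σ : ℕ → Exp) :
    (pi A B).subst σ = pi (A.subst σ) (B.subst (up σ)) := rfl

@[simp] theorem erase_pi (A B : Exp) :
    (pi A B).erase = .pi A.erase B.erase := rfl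

@[simp] theorem rename_lam (A B b : Exp) (ρ : ℕ → ℕ) :
    (lam A B b).rename ρ = lam (A.rename ρ) (B.rename (upRen ρ)) (b.rename (upRen ρ)) := rfl

@[simp] theorem subst_lam (A B b : Exp) (σ : ℕ → Exp) :
    (lam A B b).subst σ = lam (A.subst σ) (B.subst (up σ)) (b.subst (up σ)) := rfl

@[simp] theorem erase_lam (A B b : Exp) :
    (lam A B b).erase = .lam A.erase b.erase := rfl

@[simp] theorem rename_app (A B f a : Exp) (ρ : ℕ → ℕ) :
    (app A B f a).rename ρ = app (A.rename ρ) (B.rename (upRen ρ)) (f.rename ρ) (a.rename ρ) := rfl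

@[simp] theorem subst_app (A B f a : Exp) (σ : ℕ → Exp) :
    (app A B f a).subst σ = app (A.subst σ) (B.subst (up σ)) (f.subst σ) (a.subst σ) := rfl

@[simp] theorem erase_app (A B f a : Exp) :
    (app A B f a).erase = .app f.erase a.erase := rfl

@[simp] theorem rename_sigma (A B : Exp) (ρ : ℕ → ℕ) :
    (sigma A B).rename ρ = sigma (A.rename ρ) (B.rename (upRen ρ)) := rfl

@[simp] theorem subst_sigma (A B : Exp) (σ : ℕ → Exp) :
    (sigma A B).subst σ = sigma (A.subst σ) (B.subst (up σ)) := rfl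

@[simp] theorem erase_sigma (A B : Exp) :
    (sigma A B).erase = .sigma A.erase B.erase := rfl

@[simp] theorem rename_pair (A B a b : Exp) (ρ : ℕ → ℕ) :
    (pair A B a b).rename ρ =
      pair (A.rename ρ) (B.rename (upRen ρ)) (a.rename ρ) (b.rename ρ) := rfl

@[simp] theorem subst_pair (A B a b : Exp) (σ : ℕ → Exp) :
    (pair A B a b).subst σ = pair (A.subst σ) (B.subst (up σ)) (a.subst σ) (b.subst σ) := rfl

@[simp] theorem erase_pair (A B a b : Exp) :
    (pair A B a b).erase = .pair a.erase b.erase := rfl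

@[simp] theorem rename_sigmaInd (A B C g p : Exp) (ρ : ℕ → ℕ) :
    (sigmaInd A B C g p).rename ρ =
      sigmaInd (A.rename ρ) (B.rename (upRen ρ)) (C.rename (upRen ρ))
        (g.rename (upRen (upRen ρ))) (p.rename ρ) := rfl

@[simp] theorem subst_sigmaInd (A B C g p : Exp) (σ : ℕ → Exp) :
    (sigmaInd A B C g p).subst σ =
      sigmaInd (A.subst σ) (B.subst (up σ)) (C.subst (up σ)) (g.subst (up (up σ))) (p.subst σ) :=
        rfl

@[simp] theorem erase_sigmaInd (A B C g p : Exp) :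
    (sigmaInd A B C g p).erase = .sigmaInd C.erase g.erase p.erase := rfl

@[simp] theorem rename_fst (A B p : Exp) (ρ : ℕ → ℕ) :
    (fst A B p).rename ρ = fst (A.rename ρ) (B.rename (upRen ρ)) (p.rename ρ) := rfl

@[simp] theorem subst_fst (A B p : Exp) (σ : ℕ → Exp) :
    (fst A B p).subst σ = fst (A.subst σ) (B.subst (up σ)) (p.subst σ) := rfl

@[simp] theorem erase_fst (A B p : Exp) :
    (fst A B p).erase = Tm.fst A.erase p.erase := rfl

@[simp] theorem rename_snd (A B p : Exp) (ρ : ℕ → ℕ) :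
    (snd A B p).rename ρ = snd (A.rename ρ) (B.rename (upRen ρ)) (p.rename ρ) := rfl

@[simp] theorem subst_snd (A B p : Exp) (σ : ℕ → Exp) :
    (snd A B p).subst σ = snd (A.subst σ) (B.subst (up σ)) (p.subst σ) := rfl

@[simp] theorem erase_snd (A B p : Exp) :
    (snd A B p).erase = Tm.snd A.erase B.erase p.erase := rfl

@[simp] theorem rename_empty (ρ : ℕ → ℕ) :
    rename empty ρ = empty := rfl

@[simp] theorem subst_empty (σ : ℕ → Exp) :
    subst empty σ = empty := rfl

@[simp] theorem erase_empty : erase empty = .empty := rfl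

@[simp] theorem rename_emptyInd (C e : Exp) (ρ : ℕ → ℕ) :
    (emptyInd C e).rename ρ = emptyInd (C.rename (upRen ρ)) (e.rename ρ) := rfl

@[simp] theorem subst_emptyInd (C e : Exp) (σ : ℕ → Exp) :
    (emptyInd C e).subst σ = emptyInd (C.subst (up σ)) (e.subst σ) := rfl

@[simp] theorem erase_emptyInd (C e : Exp) :
    (emptyInd C e).erase = .emptyInd C.erase e.erase := rfl

@[simp] theorem rename_nat (ρ : ℕ → ℕ) :
    rename nat ρ = nat := rfl

@[simp] theorem subst_nat (σ : ℕ → Exp) :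
    subst nat σ = nat := rfl

@[simp] theorem erase_nat : erase nat = .nat := rfl

@[simp] theorem rename_zero (ρ : ℕ → ℕ) :
    rename zero ρ = zero := rfl

@[simp] theorem subst_zero (σ : ℕ → Exp) :
    subst zero σ = zero := rfl

@[simp] theorem erase_zero : erase zero = .zero := rfl

@[simp] theorem rename_succ (n : Exp) (ρ : ℕ → ℕ) :
    (succ n).rename ρ = succ (n.rename ρ) := rfl

@[simp] theorem subst_succ (n : Exp) (σ : ℕ → Exp) :
    (succ n).subst σ = succ (n.subst σ) := rfl

@[simp] theorem erase_succ (n : Exp) :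
    (succ n).erase = .succ n.erase := rfl

@[simp] theorem rename_natInd (C z s n : Exp) (ρ : ℕ → ℕ) :
    (natInd C z s n).rename ρ =
      natInd (C.rename (upRen ρ)) (z.rename ρ) (s.rename (upRen (upRen ρ))) (n.rename ρ) := rfl

@[simp] theorem subst_natInd (C z s n : Exp) (σ : ℕ → Exp) :
    (natInd C z s n).subst σ =
      natInd (C.subst (up σ)) (z.subst σ) (s.subst (up (up σ))) (n.subst σ) := rfl

@[simp] theorem erase_natInd (C z s n : Exp) :
    (natInd C z s n).erase = .natInd C.erase z.erase s.erase n.erase := rfl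

@[simp] theorem rename_path (A a b : Exp) (ρ : ℕ → ℕ) :
    (path A a b).rename ρ = path (A.rename ρ) (a.rename ρ) (b.rename ρ) := rfl

@[simp] theorem subst_path (A a b : Exp) (σ : ℕ → Exp) :
    (path A a b).subst σ = path (A.subst σ) (a.subst σ) (b.subst σ) := rfl

@[simp] theorem erase_path (A a b : Exp) :
    (path A a b).erase = .path A.erase a.erase b.erase := rfl

@[simp] theorem rename_refl (A a : Exp) (ρ : ℕ → ℕ) :
    (refl A a).rename ρ = refl (A.rename ρ) (a.rename ρ) := rfl

@[simp] theorem subst_refl (A a : Exp) (σ : ℕ → Exp) :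
    (refl A a).subst σ = refl (A.subst σ) (a.subst σ) := rfl

@[simp] theorem erase_refl (A a : Exp) :
    (refl A a).erase = .refl a.erase := rfl

@[simp] theorem rename_pathInd (A C c a b p : Exp) (ρ : ℕ → ℕ) :
    (pathInd A C c a b p).rename ρ =
      pathInd (A.rename ρ) (C.rename (upRen (upRen (upRen ρ)))) (c.rename (upRen ρ)) (a.rename ρ)
        (b.rename ρ) (p.rename ρ) := rfl

@[simp] theorem subst_pathInd (A C c a b p : Exp) (σ : ℕ → Exp) :
    (pathInd A C c a b p).subst σ =
      pathInd (A.subst σ) (C.subst (up (up (up σ)))) (c.subst (up σ)) (a.subst σ) (b.subst σ)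
        (p.subst σ) := rfl

@[simp] theorem erase_pathInd (A C c a b p : Exp) :
    (pathInd A C c a b p).erase = .pathInd C.erase c.erase a.erase b.erase p.erase := rfl

theorem erase_rename (e : Exp) (ρ : ℕ → ℕ) : (e.rename ρ).erase = e.erase.rename ρ := by
  induction e generalizing ρ <;> simp_all [Tm.rename]
  case fst => simp [Tm.fst, Tm.rename, Tm.wk, Tm.rename_rename, upRen]
  case snd =>
    simp only [Tm.snd, Tm.rename_eq_subst, ← upSub_ren]
    simp [Tm.fst, Tm.subst]
    rfl

theorem erase_wk (e : Exp) : e.wk.erase = e.erase.wk := e.erase_rename _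

/-- The raw substitution under an annotated one. -/
noncomputable abbrev erases (σ : ℕ → Exp) (k : ℕ) : Tm := (σ k).erase

theorem erases_up (σ : ℕ → Exp) : erases (up σ) = upSub (erases σ) := by
  funext k; cases k <;> simp [erases, erase_wk]

theorem erases_cons (t : Exp) (σ : ℕ → Exp) : erases (cons t σ) = consSub t.erase (erases σ) := by
  funext k; cases k <;> simp [erases]

theorem erases_var : erases var = Tm.var := rfl

theorem erase_subst (e : Exp) (σ : ℕ → Exp) : (e.subst σ).erase = e.erase.subst (erases σ) := by
  induction e generalizing σ <;> simp_all [Tm.subst, erases_up]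
  case fst => simp [Tm.fst, Tm.subst]; rfl
  case snd => simp [Tm.snd, Tm.fst, Tm.subst]; rfl

theorem erase_inst (b a : Exp) : (b.inst a).erase = b.erase.inst a.erase := by
  simp [inst, Tm.inst, erase_subst, erases_cons, erases_var]

theorem erase_instUnder (m : ℕ) (C t : Exp) :
    (C.instUnder m t).erase = C.erase.instUnder m t.erase := by
  simp only [instUnder, Tm.instUnder, erase_subst, erases_cons]; rfl

theorem erase_inst₃ (C a b p : Exp) :
    (C.inst₃ a b p).erase = C.erase.inst₃ a.erase b.erase p.erase := by
  simp [inst₃, Tm.inst₃, erase_subst, erases_cons, erases_var]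

theorem erase_instRefl (C A : Exp) : (C.instRefl A).erase = C.erase.instRefl := by
  simp only [instRefl, Tm.instRefl, erase_subst, erases_cons]; rfl

theorem up_var : up var = var := by
  funext k; cases k <;> rfl

theorem subst_id (e : Exp) : e.subst var = e := by
  induction e <;> simp_all [up_var]

theorem up_ren (ρ : ℕ → ℕ) : (up fun k => var (ρ k)) = fun k => var (upRen ρ k) := by
  funext k; cases k <;> rfl

theorem rename_eq_subst (e : Exp) (ρ : ℕ → ℕ) : e.rename ρ = e.subst fun k => var (ρ k) := by
  induction e generalizing ρ <;> simp_all [up_ren]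

end Exp
end MLTT

namespace MLTT
open Judgment

@[simp] theorem Tm.wk_var (k : ℕ) : (var k).wk = var (k + 1) := rfl

@[simp] theorem Tm.wk_univ (i : ℕ) : (univ i).wk = univ i := rfl

/-! ### Typing of annotated terms -/

/-- Judgmental equality of types, or inclusion of universes. -/
inductive Sub (Γ : Ctx) : Tm → Tm → Prop
  | refl (A : Tm) : Sub Γ A A
  | eq {A B : Tm} {i : ℕ} : Derivable (defEq Γ A B (.univ i)) → Sub Γ A B
  | univ (i : ℕ) : Sub Γ (.univ i) (.univ (i + 1))
  | trans {A B C : Tm} : Sub Γ A B → Sub Γ B C → Sub Γ A C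

namespace Sub
variable {Γ Δ : Ctx} {A B : Tm}

theorem type (h : Sub Γ A B) {a : Tm} (ha : Derivable (hasType Γ a A)) :
    Derivable (hasType Γ a B) := by
  induction h with
  | refl => exact ha
  | eq h => exact .conv ha h
  | univ => exact .univ_cumul ha
  | trans _ _ ih₁ ih₂ => exact ih₂ (ih₁ ha)

theorem typeEq (h : Sub Γ A B) {a b : Tm} (ha : Derivable (defEq Γ a b A)) :
    Derivable (defEq Γ a b B) := by
  induction h with
  | refl => exact ha
  | eq h => exact .eq_conv ha h
  | univ => exact .univ_cumul_eq ha
  | trans _ _ ih₁ ih₂ => exact ih₂ (ih₁ ha)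

theorem substs (h : Sub Γ A B) {σ : ℕ → Tm} (hσ : IsSubst Δ σ Γ) (hΔ : Derivable (isCtx Δ)) :
    Sub Δ (A.subst σ) (B.subst σ) := by
  induction h with
  | refl => exact .refl _
  | eq h => exact .eq (h.substEq hσ hΔ)
  | univ => exact .univ _
  | trans _ _ ih₁ ih₂ => exact ih₁.trans ih₂

theorem univ_le {i j : ℕ} (hij : i ≤ j) : Sub Γ (.univ i) (.univ j) := by
  induction hij with
  | refl => exact .refl _
  | step _ ih => exact ih.trans (.univ _)

theorem symm_eq {i : ℕ} (h : Derivable (defEq Γ A B (.univ i))) : Sub Γ B A := .eq (.eq_symm h)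

end Sub

namespace Exp

/-- Typing of an annotated term, with typed annotations. -/
def Wt : Exp → Ctx → Tm → Prop
  | var k, Γ, T => ∃ S, Derivable (isCtx Γ) ∧ Lookup Γ k S ∧ Sub Γ S T
  | univ i, Γ, T => Derivable (isCtx Γ) ∧ Sub Γ (.univ (i + 1)) T
  | pi A B, Γ, T => ∃ i, A.Wt Γ (.univ i) ∧ B.Wt (A.erase :: Γ) (.univ i) ∧ Sub Γ (.univ i) T
  | lam A B b, Γ, T => ∃ i, A.Wt Γ (.univ i) ∧ B.Wt (A.erase :: Γ) (.univ i) ∧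
      b.Wt (A.erase :: Γ) B.erase ∧ Sub Γ (.pi A.erase B.erase) T
  | app A B f a, Γ, T => ∃ i, A.Wt Γ (.univ i) ∧ B.Wt (A.erase :: Γ) (.univ i) ∧
      f.Wt Γ (.pi A.erase B.erase) ∧ a.Wt Γ A.erase ∧ Sub Γ (B.erase.inst a.erase) T
  | sigma A B, Γ, T => ∃ i, A.Wt Γ (.univ i) ∧ B.Wt (A.erase :: Γ) (.univ i) ∧ Sub Γ (.univ i) T
  | pair A B a b, Γ, T => ∃ i, A.Wt Γ (.univ i) ∧ B.Wt (A.erase :: Γ) (.univ i) ∧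
      a.Wt Γ A.erase ∧ b.Wt Γ (B.erase.inst a.erase) ∧ Sub Γ (.sigma A.erase B.erase) T
  | sigmaInd A B C g p, Γ, T => ∃ i j, A.Wt Γ (.univ i) ∧ B.Wt (A.erase :: Γ) (.univ i) ∧
      C.Wt (.sigma A.erase B.erase :: Γ) (.univ j) ∧
      g.Wt (B.erase :: A.erase :: Γ) (C.erase.instUnder 2 (.pair (.var 1) (.var 0))) ∧
      p.Wt Γ (.sigma A.erase B.erase) ∧ Sub Γ (C.erase.inst p.erase) T
  | fst A B p, Γ, T => ∃ i, A.Wt Γ (.univ i) ∧ B.Wt (A.erase :: Γ) (.univ i) ∧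
      p.Wt Γ (.sigma A.erase B.erase) ∧ Sub Γ A.erase T
  | snd A B p, Γ, T => ∃ i, A.Wt Γ (.univ i) ∧ B.Wt (A.erase :: Γ) (.univ i) ∧
      p.Wt Γ (.sigma A.erase B.erase) ∧ Sub Γ (B.erase.inst (.fst A.erase p.erase)) T
  | empty, Γ, T => Derivable (isCtx Γ) ∧ Sub Γ (.univ 0) T
  | emptyInd C e, Γ, T => ∃ j, C.Wt (.empty :: Γ) (.univ j) ∧ e.Wt Γ .empty ∧
      Sub Γ (C.erase.inst e.erase) T
  | nat, Γ, T => Derivable (isCtx Γ) ∧ Sub Γ (.univ 0) T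
  | zero, Γ, T => Derivable (isCtx Γ) ∧ Sub Γ .nat T
  | succ n, Γ, T => n.Wt Γ .nat ∧ Sub Γ .nat T
  | natInd C z s n, Γ, T => ∃ j, C.Wt (.nat :: Γ) (.univ j) ∧ z.Wt Γ (C.erase.inst .zero) ∧
      s.Wt (C.erase :: .nat :: Γ) (C.erase.instUnder 2 (.succ (.var 1))) ∧ n.Wt Γ .nat ∧
      Sub Γ (C.erase.inst n.erase) T
  | path A a b, Γ, T => ∃ i, A.Wt Γ (.univ i) ∧ a.Wt Γ A.erase ∧ b.Wt Γ A.erase ∧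
      Sub Γ (.univ i) T
  | refl A a, Γ, T => ∃ i, A.Wt Γ (.univ i) ∧ a.Wt Γ A.erase ∧
      Sub Γ (.path A.erase a.erase a.erase) T
  | pathInd A C c a b p, Γ, T => ∃ i j, A.Wt Γ (.univ i) ∧
      C.Wt (.path A.erase.wk.wk (.var 1) (.var 0) :: A.erase.wk :: A.erase :: Γ) (.univ j) ∧
      c.Wt (A.erase :: Γ) C.erase.instRefl ∧ a.Wt Γ A.erase ∧ b.Wt Γ A.erase ∧
      p.Wt Γ (.path A.erase a.erase b.erase) ∧ Sub Γ (C.erase.inst₃ a.erase b.erase p.erase) T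

namespace Wt
variable {e : Exp} {Γ Δ : Ctx} {S T : Tm}

/-- Every clause of `Wt` ends with a `Sub`, so subsumption is built in; and since `Wt` is defined by
recursion on the term, inversion is unfolding. -/
theorem sub (h : e.Wt Γ S) (hST : Sub Γ S T) : e.Wt Γ T := by
  cases e <;> simp only [Wt] at h ⊢ <;> grind [Sub.trans]

theorem cumul {i j : ℕ} (h : e.Wt Γ (.univ i)) (hij : i ≤ j) : e.Wt Γ (.univ j) :=
  h.sub (.univ_le hij)

theorem derivable (h : e.Wt Γ T) : Derivable (hasType Γ e.erase T) := by
  induction e generalizing Γ T <;> simp only [Wt] at h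
  case var =>
    obtain ⟨S, hΓ, hk, hS⟩ := h
    exact hS.type (.var hΓ hk)
  case univ => exact h.2.type (.univ_intro _ h.1)
  case pi ihA ihB =>
    obtain ⟨i, hA, hB, hS⟩ := h
    exact hS.type (.pi_form (ihA hA) (ihB hB))
  case lam ihA _ ihb =>
    obtain ⟨i, hA, -, hb, hS⟩ := h
    exact hS.type (.pi_intro (ihA hA) (ihb hb))
  case app ihf iha =>
    obtain ⟨i, -, -, hf, ha, hS⟩ := h
    exact hS.type (.pi_elim (ihf hf) (iha ha))
  case sigma ihA ihB =>
    obtain ⟨i, hA, hB, hS⟩ := h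
    exact hS.type (.sigma_form (ihA hA) (ihB hB))
  case pair ihA ihB iha ihb =>
    obtain ⟨i, hA, hB, ha, hb, hS⟩ := h
    exact hS.type (.sigma_intro (ihA hA) (ihB hB) (iha ha) (ihb hb))
  case sigmaInd ihA ihB ihC ihg ihp =>
    obtain ⟨i, j, hA, hB, hC, hg, hp, hS⟩ := h
    exact hS.type (.sigma_elim (ihA hA) (ihB hB) (ihC hC) (ihg hg) (ihp hp))
  case fst ihA ihB ihp =>
    obtain ⟨i, hA, hB, hp, hS⟩ := h
    exact hS.type (.fst_type (ihA hA) (ihB hB) (ihp hp))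
  case snd ihA ihB ihp =>
    obtain ⟨i, hA, hB, hp, hS⟩ := h
    exact hS.type (.snd_type (ihA hA) (ihB hB) (ihp hp))
  case empty => exact h.2.type (.empty_form 0 h.1)
  case emptyInd ihC ihe =>
    obtain ⟨j, hC, he, hS⟩ := h
    exact hS.type (.empty_elim (ihC hC) (ihe he))
  case nat => exact h.2.type (.nat_form 0 h.1)
  case zero => exact h.2.type (.nat_intro₁ h.1)
  case succ ih => exact h.2.type (.nat_intro₂ (ih h.1))
  case natInd ihC ihz ihs ihn =>
    obtain ⟨j, hC, hz, hs, hn, hS⟩ := h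
    exact hS.type (.nat_elim (ihC hC) (ihz hz) (ihs hs) (ihn hn))
  case path ihA iha ihb =>
    obtain ⟨i, hA, ha, hb, hS⟩ := h
    exact hS.type (.path_form (ihA hA) (iha ha) (ihb hb))
  case refl ihA iha =>
    obtain ⟨i, hA, ha, hS⟩ := h
    exact hS.type (.path_intro (ihA hA) (iha ha))
  case pathInd ihA ihC ihc iha ihb ihp =>
    obtain ⟨i, j, hA, hC, hc, ha, hb, hp, hS⟩ := h
    exact hS.type (.path_elim (ihA hA) (ihC hC) (ihc hc) (iha ha) (ihb hb) (ihp hp))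

theorem ctx (h : e.Wt Γ T) : Derivable (isCtx Γ) := Derivable.ctx h.derivable

theorem ctx_cons {A : Exp} {i : ℕ} (h : A.Wt Γ (.univ i)) : Derivable (isCtx (A.erase :: Γ)) :=
  .ctx_cons h.ctx h.derivable

section
attribute [local simp] erase_subst erases_up Tm.subst

/-- The annotated counterpart of `Derivable.subst_of`. Weakening of raw derivations is available by
now, so `R` need not be closed under weakening. -/
theorem subst_of {R : Ctx → (ℕ → Exp) → Ctx → Prop}
    (var : ∀ {Δ σ Γ k A}, R Δ σ Γ → Derivable (isCtx Δ) → Lookup Γ k A →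
      (σ k).Wt Δ (A.subst (erases σ)))
    (up : ∀ {Δ σ Γ i} A, R Δ σ Γ → Derivable (hasType Δ (A.subst (erases σ)) (.univ i)) →
      R (A.subst (erases σ) :: Δ) (up σ) (A :: Γ))
    {σ : ℕ → Exp} (h : e.Wt Γ T) (hσ : R Δ σ Γ) (hΔ : Derivable (isCtx Δ)) :
    (e.subst σ).Wt Δ (T.subst (erases σ)) := by
  have sb {Δ σ Γ} (hσ : R Δ σ Γ) (hΔ : Derivable (isCtx Δ)) : IsSubst Δ (erases σ) Γ :=
    fun _ _ hk => (var hσ hΔ hk).derivable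
  have sub {Δ σ Γ S T} (hσ : R Δ σ Γ) (hΔ : Derivable (isCtx Δ)) (hS : Sub Γ S T) :
      Sub Δ (S.subst (erases σ)) (T.subst (erases σ)) := hS.substs (sb hσ hΔ) hΔ
  have up' {Δ σ Γ i} {A : Exp} (hσ : R Δ σ Γ) (hA : (A.subst σ).Wt Δ (.univ i)) :
      R ((A.subst σ).erase :: Δ) (Exp.up σ) (A.erase :: Γ) := by
    have := hA.derivable
    rw [erase_subst] at this ⊢
    exact up _ hσ this
  induction e generalizing Γ Δ T σ <;> simp only [Wt] at h <;>
    simp only [Wt, subst_var, subst_univ, subst_pi, subst_lam, subst_app, subst_sigma, subst_pair,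
      subst_sigmaInd, subst_fst, subst_snd, subst_empty, subst_emptyInd, subst_nat, subst_zero,
      subst_succ, subst_natInd, subst_path, subst_refl, subst_pathInd]
  case var =>
    obtain ⟨S, -, hk, hS⟩ := h
    exact (var hσ hΔ hk).sub (sub hσ hΔ hS)
  case univ => exact ⟨hΔ, sub hσ hΔ h.2⟩
  case pi ihA ihB =>
    obtain ⟨i, hA, hB, hS⟩ := h
    have A := ihA hA hσ hΔ
    exact ⟨i, A, ihB hB (up' hσ A) A.ctx_cons, sub hσ hΔ hS⟩
  case lam ihA ihB ihb =>
    obtain ⟨i, hA, hB, hb, hS⟩ := h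
    have A := ihA hA hσ hΔ
    exact ⟨i, A, ihB hB (up' hσ A) A.ctx_cons, by simpa using ihb hb (up' hσ A) A.ctx_cons,
      by simpa using sub hσ hΔ hS⟩
  case app ihA ihB ihf iha =>
    obtain ⟨i, hA, hB, hf, ha, hS⟩ := h
    have A := ihA hA hσ hΔ
    exact ⟨i, A, ihB hB (up' hσ A) A.ctx_cons, by simpa using ihf hf hσ hΔ,
      by simpa using iha ha hσ hΔ,
      by simpa using sub hσ hΔ hS⟩
  case sigma ihA ihB =>
    obtain ⟨i, hA, hB, hS⟩ := h
    have A := ihA hA hσ hΔ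
    exact ⟨i, A, ihB hB (up' hσ A) A.ctx_cons, sub hσ hΔ hS⟩
  case pair ihA ihB iha ihb =>
    obtain ⟨i, hA, hB, ha, hb, hS⟩ := h
    have A := ihA hA hσ hΔ
    exact ⟨i, A, ihB hB (up' hσ A) A.ctx_cons, by simpa using iha ha hσ hΔ,
      by simpa using ihb hb hσ hΔ,
      by simpa using sub hσ hΔ hS⟩
  case sigmaInd A B C g p ihA ihB ihC ihg ihp =>
    obtain ⟨i, j, hA, hB, hC, hg, hp, hS⟩ := h
    have hA := ihA hA hσ hΔ
    have hB := ihB hB (up' hσ hA) hA.ctx_cons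
    have hAB : ((Exp.sigma A B).subst σ).Wt Δ (.univ i) := ⟨i, hA, hB, .refl _⟩
    exact ⟨i, j, hA, hB, ihC hC (up' hσ hAB) hAB.ctx_cons,
      by simpa using ihg hg (up' (up' hσ hA) hB) hB.ctx_cons, by simpa using ihp hp hσ hΔ,
      by simpa using sub hσ hΔ hS⟩
  case fst ihA ihB ihp =>
    obtain ⟨i, hA, hB, hp, hS⟩ := h
    have A := ihA hA hσ hΔ
    exact ⟨i, A, ihB hB (up' hσ A) A.ctx_cons, by simpa using ihp hp hσ hΔ,
      by simpa using sub hσ hΔ hS⟩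
  case snd ihA ihB ihp =>
    obtain ⟨i, hA, hB, hp, hS⟩ := h
    have A := ihA hA hσ hΔ
    exact ⟨i, A, ihB hB (up' hσ A) A.ctx_cons, by simpa using ihp hp hσ hΔ,
      by simpa [Tm.fst] using sub hσ hΔ hS⟩
  case empty => exact ⟨hΔ, sub hσ hΔ h.2⟩
  case emptyInd ihC ihe =>
    obtain ⟨j, hC, he, hS⟩ := h
    have hE : (Exp.empty.subst σ).Wt Δ (.univ 0) := ⟨hΔ, .refl _⟩
    exact ⟨j, ihC hC (up' hσ hE) hE.ctx_cons, ihe he hσ hΔ, by simpa using sub hσ hΔ hS⟩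
  case nat => exact ⟨hΔ, sub hσ hΔ h.2⟩
  case zero => exact ⟨hΔ, sub hσ hΔ h.2⟩
  case succ ih => exact ⟨ih h.1 hσ hΔ, sub hσ hΔ h.2⟩
  case natInd ihC ihz ihs ihn =>
    obtain ⟨j, hC, hz, hs, hn, hS⟩ := h
    have hN : (Exp.nat.subst σ).Wt Δ (.univ 0) := ⟨hΔ, .refl _⟩
    have C := ihC hC (up' hσ hN) hN.ctx_cons
    exact ⟨j, C, by simpa using ihz hz hσ hΔ, by simpa using ihs hs (up' (up' hσ hN) C) C.ctx_cons,
      ihn hn hσ hΔ, by simpa using sub hσ hΔ hS⟩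
  case path ihA iha ihb =>
    obtain ⟨i, hA, ha, hb, hS⟩ := h
    exact ⟨i, ihA hA hσ hΔ, by simpa using iha ha hσ hΔ, by simpa using ihb hb hσ hΔ, sub hσ hΔ hS⟩
  case refl ihA iha =>
    obtain ⟨i, hA, ha, hS⟩ := h
    exact ⟨i, ihA hA hσ hΔ, by simpa using iha ha hσ hΔ, by simpa using sub hσ hΔ hS⟩
  case pathInd A C c a b p ihA ihC ihc iha ihb ihp =>
    obtain ⟨i, j, hA, hC, hc, ha, hb, hp, hS⟩ := h
    have hA := ihA hA hσ hΔ
    have hwk : Derivable (hasType ((A.subst σ).erase :: Δ)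
        (A.erase.wk.subst (erases (Exp.up σ))) (.univ i)) := by
      have := hA.derivable.wkType hA.derivable
      simpa using this
    have hP : Derivable (hasType (A.erase.wk.subst (erases (Exp.up σ)) :: (A.subst σ).erase :: Δ)
        ((Tm.path A.erase.wk.wk (.var 1) (.var 0)).subst (erases (Exp.up (Exp.up σ))))
        (.univ i)) := by
      refine .path_form ?_ (.var (.ctx_cons hwk.ctx hwk) ?_) (.var (.ctx_cons hwk.ctx hwk) ?_)
      · simpa [erases_up] using hwk.wkType hwk
      · simpa [erase_subst, erases_up] using Lookup.there _ (.here Δ (A.erase.subst (erases σ)))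
      · simpa [erase_subst, erases_up] using Lookup.here _ _
    have C := ihC hC (up _ (up _ (up' hσ hA) hwk) hP) (.ctx_cons (.ctx_cons hwk.ctx hwk) hP)
    have e : (Tm.path A.erase.wk.wk (.var 1) (.var 0)).subst (erases (Exp.up (Exp.up σ))) =
        .path (A.subst σ).erase.wk.wk (.var 1) (.var 0) := by
      simp
      exact ⟨rfl, rfl⟩
    rw [e, erases_up, Tm.wk_subst_upSub, ← erase_subst] at C
    exact ⟨i, j, hA, C, by simpa using ihc hc (up' hσ hA) hA.ctx_cons, by simpa using iha ha hσ hΔ,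
      by simpa using ihb hb hσ hΔ, by simpa using ihp hp hσ hΔ, by simpa using sub hσ hΔ hS⟩

end

theorem rename {ρ : ℕ → ℕ} (h : e.Wt Γ T) (hρ : IsRenaming Δ ρ Γ) (hΔ : Derivable (isCtx Δ)) :
    (e.rename ρ).Wt Δ (T.rename ρ) := by
  rw [rename_eq_subst, Tm.rename_eq_subst]
  refine h.subst_of (R := fun Δ σ Γ => ∃ ρ, σ = (fun k => .var (ρ k)) ∧ IsRenaming Δ ρ Γ)
    ?_ ?_ ⟨ρ, rfl, hρ⟩ hΔ
  · rintro Δ σ Γ k A ⟨ρ, rfl, hρ⟩ hΔ hk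
    refine ⟨_, hΔ, hρ hk, ?_⟩
    rw [Tm.rename_eq_subst]
    exact .refl _
  · rintro Δ σ Γ i A ⟨ρ, rfl, hρ⟩ -
    exact ⟨upRen ρ, up_ren ρ, Tm.rename_eq_subst A ρ ▸ hρ.up A⟩

theorem wk {A : Tm} {i : ℕ} (h : e.Wt Γ T) (hA : Derivable (hasType Γ A (.univ i))) :
    e.wk.Wt (A :: Γ) T.wk :=
  h.rename (.succ A Γ) (.ctx_cons hA.ctx hA)

/-- `σ` maps the variables of `Γ` to annotated terms in context `Δ`. -/
def _root_.MLTT.Exp.IsSubst (Δ : Ctx) (σ : ℕ → Exp) (Γ : Ctx) : Prop :=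
  ∀ ⦃k A⦄, Lookup Γ k A → (σ k).Wt Δ (A.subst (erases σ))

theorem subst {σ : ℕ → Exp} (h : e.Wt Γ T) (hσ : Exp.IsSubst Δ σ Γ) (hΔ : Derivable (isCtx Δ)) :
    (e.subst σ).Wt Δ (T.subst (erases σ)) := by
  refine h.subst_of (R := Exp.IsSubst) (fun hσ _ hk => hσ hk) (fun A hσ hA k B hk => ?_) hσ hΔ
  rw [erases_up]
  cases hk with
  | here => exact ⟨_, .ctx_cons hA.ctx hA, .here _ _, by simpa using .refl _⟩
  | there _ hk => simpa using (hσ hk).wk hA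

theorem var_self {k : ℕ} (hΓ : Derivable (isCtx Γ)) (hk : Lookup Γ k T) : (Exp.var k).Wt Γ T :=
  ⟨_, hΓ, hk, .refl _⟩

theorem isSubst_var (hΓ : Derivable (isCtx Γ)) : Exp.IsSubst Γ var Γ :=
  fun _ _ hk => by simpa [erases_var, Tm.subst_var] using var_self hΓ hk

theorem isSubst_cons {a : Exp} {A : Tm} {σ : ℕ → Exp} (hσ : Exp.IsSubst Δ σ Γ)
    (ha : a.Wt Δ (A.subst (erases σ))) : Exp.IsSubst Δ (cons a σ) (A :: Γ) := by
  intro k B hk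
  rw [erases_cons]
  cases hk with
  | here => simpa [Tm.wk_subst_consSub] using ha
  | there _ hk => simpa [Tm.wk_subst_consSub] using hσ hk

theorem inst {a : Exp} {A : Tm} (h : e.Wt (A :: Γ) T) (ha : a.Wt Γ A) :
    (e.inst a).Wt Γ (T.inst a.erase) := by
  have := h.subst (isSubst_cons (a := a) (isSubst_var ha.ctx)
    (by simpa [erases_var, Tm.subst_var] using ha)) ha.ctx
  rwa [erases_cons, erases_var] at this

/-- Conversion in a context. -/
theorem conv_ctx {A A' : Tm} {i : ℕ} (h : e.Wt (A :: Γ) T) (hA : Derivable (defEq Γ A A' (.univ i)))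
    (hA' : Derivable (hasType Γ A' (.univ i))) : e.Wt (A' :: Γ) T := by
  have hΓ : Derivable (isCtx (A' :: Γ)) := .ctx_cons hA'.ctx hA'
  have := h.subst (σ := .var) (fun k B hk => ?_) hΓ
  · simpa [erases_var, Tm.subst_var, subst_id] using this
  · rw [erases_var, Tm.subst_var]
    cases hk with
    | here => exact ⟨_, hΓ, .here _ _, .symm_eq (hA.wkEq hA')⟩
    | there _ hk => exact ⟨_, hΓ, .there _ hk, .refl _⟩

end Wt
end Exp
end MLTT

namespace MLTT
open Judgment

/-! ### The substitutions that produce the branch types of the eliminators are well typed. -/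

namespace Derivable
variable {Γ : Ctx} {A B C : Tm} {i j : ℕ}

theorem isSubst_shift (hB : Derivable (isCtx (B :: A :: Γ))) :
    IsSubst (B :: A :: Γ) (fun k => .var (k + 2)) Γ := by
  intro k C hk
  rw [← Tm.rename_eq_subst, rename_add_two]
  exact .var hB (.there _ (.there _ hk))

theorem isSubst_pair (hA : Derivable (hasType Γ A (.univ i)))
    (hB : Derivable (hasType (A :: Γ) B (.univ i))) :
    IsSubst (B :: A :: Γ) (consSub (.pair (.var 1) (.var 0)) fun k => .var (k + 2))
      (.sigma A B :: Γ) := by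
  have hΓ : Derivable (isCtx (B :: A :: Γ)) := .ctx_cons hB.ctx hB
  have σ := isSubst_shift hΓ
  have hA₂ := hA.substType σ hΓ
  have hB₂ := hB.substType (σ.up hA₂) (.ctx_cons hΓ hA₂)
  refine σ.consSub (.sigma_intro hA₂ hB₂ (.var hΓ ?_) (.var hΓ ?_))
  · rw [← Tm.rename_eq_subst, rename_add_two]
    exact .there _ (.here _ _)
  · have e : (B.subst (upSub fun k => .var (k + 2))).inst (.var 1) = B.wk := by
      rw [Tm.inst, Tm.subst_subst, Tm.wk, Tm.rename_eq_subst]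
      congr 1; funext k; cases k <;> simp [Tm.subst]
    rw [e]
    exact .here _ _

theorem isSubst_succ (hC : Derivable (isCtx (C :: .nat :: Γ))) :
    IsSubst (C :: .nat :: Γ) (consSub (.succ (.var 1)) fun k => .var (k + 2)) (.nat :: Γ) :=
  (isSubst_shift hC).consSub (.nat_intro₂ (.var hC (.there C (.here Γ .nat))))

theorem isSubst_refl (hA : Derivable (hasType Γ A (.univ i))) :
    IsSubst (A :: Γ) (consSub (.refl (.var 0)) (consSub (.var 0) (consSub (.var 0)
      fun k => .var (k + 1)))) (.path A.wk.wk (.var 1) (.var 0) :: A.wk :: A :: Γ) := by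
  have hΓ : Derivable (isCtx (A :: Γ)) := .ctx_cons hA.ctx hA
  have hv : Derivable (hasType (A :: Γ) (.var 0) (A.subst fun k => .var (k + 1))) := by
    rw [← Tm.rename_eq_subst]
    exact .var hΓ (.here _ _)
  have σ : IsSubst (A :: Γ) (fun k => .var (k + 1)) Γ := by
    intro k B hk
    rw [← Tm.rename_eq_subst]
    exact .var hΓ (.there _ hk)
  refine ((σ.consSub hv).consSub ?_).consSub ?_
  · rwa [Tm.wk_subst_consSub]
  · simp only [Tm.subst, Tm.wk_subst_consSub, consSub_zero, consSub_succ]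
    refine .path_intro (i := i) ?_ hv
    have := hA.substType σ hΓ
    exact this

end Derivable

theorem Tm.instUnder_pair_subst (C a b : Tm) :
    (C.instUnder 2 (.pair (.var 1) (.var 0))).subst (consSub b (consSub a var)) =
      C.inst (.pair a b) := by
  rw [instUnder, subst_subst, inst]
  congr 1; funext k; cases k <;> simp [subst]

theorem Tm.instUnder_succ_subst (C n r : Tm) :
    (C.instUnder 2 (.succ (.var 1))).subst (consSub r (consSub n var)) = C.inst (.succ n) := by
  rw [instUnder, subst_subst, inst]
  congr 1; funext k; cases k <;> simp [subst]

theorem Tm.instRefl_inst (C a : Tm) : C.instRefl.inst a = C.inst₃ a a (.refl a) := by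
  rw [instRefl, inst, subst_subst, inst₃]
  congr 1; funext k
  match k with
  | 0 | 1 | 2 => simp [subst]
  | k + 3 => simp [subst]

namespace Exp

/-! ### Soundness of normalization -/

theorem and_left {a b : Bool} (h : (a && b) = true) : a = true := by cases a <;> simp_all

theorem and_right {a b : Bool} (h : (a && b) = true) : b = true := by cases a <;> simp_all

theorem erase_eq_of_same {e e' : Exp} (h : e.same e' = true) : e.erase = e'.erase := by
  induction e generalizing e' <;> cases e' <;> first | exact (Bool.false_ne_true h).elim | skip
  case var => exact congrArg Tm.var (Nat.eq_of_beq_eq_true h)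
  case univ => exact congrArg Tm.univ (Nat.eq_of_beq_eq_true h)
  case pi ihA ihB _ _ => exact congrArg₂ Tm.pi (ihA (and_left h)) (ihB (and_right h))
  case lam ihA _ ihb _ _ _ => exact congrArg₂ Tm.lam (ihA (and_left h)) (ihb (and_right h))
  case app ihf iha _ _ _ _ => exact congrArg₂ Tm.app (ihf (and_left h)) (iha (and_right h))
  case sigma ihA ihB _ _ => exact congrArg₂ Tm.sigma (ihA (and_left h)) (ihB (and_right h))
  case pair iha ihb _ _ _ _ => exact congrArg₂ Tm.pair (iha (and_left h)) (ihb (and_right h))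
  case sigmaInd ihC ihg ihp _ _ _ _ _ =>
    rw [erase_sigmaInd, erase_sigmaInd, ihp (and_left h), ihg (and_left (and_right h)),
      ihC (and_right (and_right h))]
  case fst ihA _ ihp _ _ _ =>
    rw [erase_fst, erase_fst, ihp (and_left h), ihA (and_right h)]
  case snd ihA ihB ihp _ _ _ =>
    rw [erase_snd, erase_snd, ihp (and_left h), ihA (and_left (and_right h)),
      ihB (and_right (and_right h))]
  case empty => rfl
  case emptyInd ihC ihe _ _ =>
    rw [erase_emptyInd, erase_emptyInd, ihe (and_left h), ihC (and_right h)]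
  case nat => rfl
  case zero => rfl
  case succ ih _ => exact congrArg Tm.succ (ih h)
  case natInd ihC ihz ihs ihn _ _ _ _ =>
    rw [erase_natInd, erase_natInd, ihn (and_left h), ihz (and_left (and_right h)),
      ihs (and_left (and_right (and_right h))), ihC (and_right (and_right (and_right h)))]
  case path ihA iha ihb _ _ _ =>
    rw [erase_path, erase_path, iha (and_left h), ihb (and_left (and_right h)),
      ihA (and_right (and_right h))]
  case refl iha _ _ => exact congrArg Tm.refl (iha h)
  case pathInd ihC ihc iha ihb ihp _ _ _ _ _ _ =>
    rw [erase_pathInd, erase_pathInd, ihp (and_left h), iha (and_left (and_right h)),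
      ihb (and_left (and_right (and_right h))),
      ihc (and_left (and_right (and_right (and_right h)))),
      ihC (and_right (and_right (and_right (and_right h))))]

/-- Normalization preserves typing and is a judgmental equality. -/
def NfSound (nf : Exp → Exp) : Prop := ∀ ⦃e Γ T⦄, e.Wt Γ T →
  (nf e).Wt Γ T ∧ Derivable (defEq Γ e.erase (nf e).erase T)

namespace NfSound
variable {nf : Exp → Exp} (h : NfSound nf) {Γ : Ctx} {A B C a b f g p p' c z s n e : Exp} {T : Tm}
  {i j k : ℕ}
include h

theorem agree_eq (hab : agree nf a b = true) (ha : a.Wt Γ T) (hb : b.Wt Γ T) :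
    Derivable (defEq Γ a.erase b.erase T) := by
  rw [agree] at hab
  split at hab
  · next hs => exact erase_eq_of_same hs ▸ .eq_refl ha.derivable
  · have e := erase_eq_of_same hab
    exact .eq_trans (h ha).2 (e ▸ .eq_symm (h hb).2)

theorem agree_type (hAB : agree nf A B = true) (hA : A.Wt Γ (.univ i)) (hB : B.Wt Γ (.univ j)) :
    Derivable (defEq Γ A.erase B.erase (.univ (max i j))) :=
  h.agree_eq hAB (hA.cumul (le_max_left i j)) (hB.cumul (le_max_right i j))

/-- Agreement of the annotations of an eliminator and of a constructor. -/
theorem agree_family {A₁ B₁ : Exp} (hAB : (agree nf A A₁ && agree nf B B₁) = true)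
    (hA : A.Wt Γ (.univ i)) (hB : B.Wt (A.erase :: Γ) (.univ i)) (hA₁ : A₁.Wt Γ (.univ j))
    (hB₁ : B₁.Wt (A₁.erase :: Γ) (.univ j)) :
    Derivable (defEq Γ A₁.erase A.erase (.univ (max i j))) ∧
      Derivable (defEq (A.erase :: Γ) B₁.erase B.erase (.univ (max i j))) := by
  have eA := h.agree_type (and_left hAB) hA hA₁
  exact ⟨.eq_symm eA, .eq_symm (h.agree_type (and_right hAB) hB
    (hB₁.conv_ctx (.eq_symm eA) (hA.cumul (le_max_left i j)).derivable))⟩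

/-- If a λ with domain `A₁` has type `Π A B`, nothing relates `A₁` to `A`, since Π is not known to
be injective. The tested agreement of the annotations supplies the two equalities that the β-rule
needs. -/
theorem nfApp (hA : A.Wt Γ (.univ i)) (hB : B.Wt (A.erase :: Γ) (.univ i))
    (hf : f.Wt Γ (.pi A.erase B.erase)) (ha : a.Wt Γ A.erase) :
    (nfApp nf A B (nf f) a).Wt Γ (B.erase.inst a.erase) ∧
    Derivable (defEq Γ (Tm.app f.erase a.erase) (nfApp nf A B (nf f) a).erase
      (B.erase.inst a.erase)) := by
  obtain ⟨hf', ef⟩ := h hf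
  obtain ⟨ha', ea⟩ := h ha
  have stuck (f' : Exp) (hf' : f'.Wt Γ (.pi A.erase B.erase))
      (ef : Derivable (defEq Γ f.erase f'.erase (.pi A.erase B.erase))) :
      (app A B f' (nf a)).Wt Γ (B.erase.inst a.erase) ∧
      Derivable (defEq Γ (Tm.app f.erase a.erase) (app A B f' (nf a)).erase
        (B.erase.inst a.erase)) :=
    ⟨⟨i, hA, hB, hf', ha', .eq (.eq_symm (.inst_congr_type hA.derivable hB.derivable ha.derivable
      ha'.derivable ea))⟩, .pi_elim_eq ef ea⟩
  generalize nf f = f' at hf' ef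
  cases f' with
  | lam A₁ B₁ b =>
    simp only [Exp.nfApp]
    split
    · next hag =>
      obtain ⟨j, hA₁, hB₁, hb, -⟩ := hf'
      obtain ⟨eA, eB⟩ := h.agree_family hag hA hB hA₁ hB₁
      have ha₁ : a.Wt Γ A₁.erase := ha.sub (.symm_eq eA)
      have eT := eB.instEq ha.derivable
      have hb' := (hb.inst ha₁).sub (.eq eT)
      obtain ⟨hr, er⟩ := h hb'
      refine ⟨hr, .eq_trans (.pi_elim_eq ef (.eq_refl ha.derivable)) (.eq_trans ?_ er)⟩
      rw [erase_inst]
      exact .eq_conv (.pi_comp hA₁.derivable hb.derivable ha₁.derivable) eT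
    · exact stuck _ hf' ef
  | _ => exact stuck _ hf' ef

theorem nfSigmaInd (hA : A.Wt Γ (.univ i)) (hB : B.Wt (A.erase :: Γ) (.univ i))
    (hC : C.Wt (.sigma A.erase B.erase :: Γ) (.univ j))
    (hg : g.Wt (B.erase :: A.erase :: Γ) (C.erase.instUnder 2 (.pair (.var 1) (.var 0))))
    (hp : p.Wt Γ (.sigma A.erase B.erase)) :
    (nfSigmaInd nf A B C g (nf p)).Wt Γ (C.erase.inst p.erase) ∧
    Derivable (defEq Γ (Tm.sigmaInd C.erase g.erase p.erase) (nfSigmaInd nf A B C g (nf p)).erase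
      (C.erase.inst p.erase)) := by
  obtain ⟨hp', ep⟩ := h hp
  obtain ⟨hC', eC⟩ := h hC
  obtain ⟨hg', eg⟩ := h hg
  have dA := hA.derivable
  have dB := hB.derivable
  have dC := hC.derivable
  have eCp {p' : Exp} (hp' : p'.Wt Γ (.sigma A.erase B.erase))
      (ep : Derivable (defEq Γ p.erase p'.erase (.sigma A.erase B.erase))) :=
    Derivable.inst_congr_type (.sigma_form dA dB) dC hp.derivable hp'.derivable ep
  have stuck (p' : Exp) (hp' : p'.Wt Γ (.sigma A.erase B.erase))
      (ep : Derivable (defEq Γ p.erase p'.erase (.sigma A.erase B.erase))) :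
      (sigmaInd A B (nf C) (nf g) p').Wt Γ (C.erase.inst p.erase) ∧
      Derivable (defEq Γ (Tm.sigmaInd C.erase g.erase p.erase)
        (sigmaInd A B (nf C) (nf g) p').erase (C.erase.inst p.erase)) :=
    ⟨⟨i, j, hA, hB, hC',
      hg'.sub (.eq (eC.substEq (Derivable.isSubst_pair dA dB) hB.ctx_cons)), hp',
      .symm_eq (.eq_trans (eCp hp' ep) (eC.instEq hp'.derivable))⟩,
      .sigma_elim_eq dA dB eC eg ep⟩
  generalize nf p = p' at hp' ep
  cases p' with
  | pair A₁ B₁ a b =>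
    simp only [Exp.nfSigmaInd]
    split
    · next hag =>
      have ⟨k, hA₁, hB₁, ha, hb, _⟩ := hp'
      obtain ⟨eA, eB⟩ := h.agree_family hag hA hB hA₁ hB₁
      have ha := ha.sub (.eq eA)
      have hb := hb.sub (.eq (eB.instEq ha.derivable))
      have eT := eCp hp' ep
      have hr := (hg.subst (.isSubst_cons (.isSubst_cons (.isSubst_var ha.ctx)
        (by rwa [erases_var, Tm.subst_var])) (by rwa [erases_cons, erases_var])) ha.ctx)
      rw [erases_cons, erases_cons, erases_var, Tm.instUnder_pair_subst] at hr
      obtain ⟨hr, er⟩ := h (hr.sub (.symm_eq eT))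
      refine ⟨hr, .eq_trans (.sigma_elim_eq dA dB (.eq_refl dC) (.eq_refl hg.derivable) ep)
        (.eq_trans (.eq_conv ?_ (.eq_symm eT)) er)⟩
      rw [erase_subst, erases_cons, erases_cons, erases_var]
      exact .sigma_comp dA dB dC hg.derivable ha.derivable hb.derivable
    · exact stuck _ hp' ep
  | _ => exact stuck _ hp' ep

theorem nfFst (hA : A.Wt Γ (.univ i)) (hB : B.Wt (A.erase :: Γ) (.univ i))
    (hp : p.Wt Γ (.sigma A.erase B.erase)) :
    (nfFst nf A B (nf p)).Wt Γ A.erase ∧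
    Derivable (defEq Γ (Tm.fst A.erase p.erase) (nfFst nf A B (nf p)).erase A.erase) := by
  obtain ⟨hp', ep⟩ := h hp
  obtain ⟨hA', eA⟩ := h hA
  have dA := hA.derivable
  have dB := hB.derivable
  have stuck (p' : Exp) (hp' : p'.Wt Γ (.sigma A.erase B.erase))
      (ep : Derivable (defEq Γ p.erase p'.erase (.sigma A.erase B.erase))) :
      (fst (nf A) B p').Wt Γ A.erase ∧
      Derivable (defEq Γ (Tm.fst A.erase p.erase) (fst (nf A) B p').erase A.erase) :=
    ⟨⟨i, hA', hB.conv_ctx eA hA'.derivable, hp'.sub (.eq (.sigma_form_eq dA eA (.eq_refl dB))),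
      .symm_eq eA⟩, .fst_congr dA dB eA ep⟩
  generalize nf p = p' at hp' ep
  cases p' with
  | pair A₁ B₁ a b =>
    simp only [Exp.nfFst]
    split
    · next hag =>
      have ⟨k, hA₁, hB₁, ha, hb, _⟩ := hp'
      obtain ⟨eA, eB⟩ := h.agree_family hag hA hB hA₁ hB₁
      have ha := ha.sub (.eq eA)
      have hb := hb.sub (.eq (eB.instEq ha.derivable))
      exact ⟨ha, .eq_trans (.fst_congr dA dB (.eq_refl dA) ep)
        (.fst_pair dA dB ha.derivable hb.derivable)⟩
    · exact stuck _ hp' ep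
  | _ => exact stuck _ hp' ep

theorem nfSnd (hA : A.Wt Γ (.univ i)) (hB : B.Wt (A.erase :: Γ) (.univ i))
    (hp : p.Wt Γ (.sigma A.erase B.erase)) :
    (nfSnd nf A B (nf p)).Wt Γ (B.erase.inst (.fst A.erase p.erase)) ∧
    Derivable (defEq Γ (Tm.snd A.erase B.erase p.erase) (nfSnd nf A B (nf p)).erase
      (B.erase.inst (.fst A.erase p.erase))) := by
  obtain ⟨hp', ep⟩ := h hp
  obtain ⟨hA', eA⟩ := h hA
  obtain ⟨hB', eB⟩ := h hB
  have dA := hA.derivable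
  have dB := hB.derivable
  have dp := hp.derivable
  have stuck (p' : Exp) (hp' : p'.Wt Γ (.sigma A.erase B.erase))
      (ep : Derivable (defEq Γ p.erase p'.erase (.sigma A.erase B.erase))) :
      (snd (nf A) (nf B) p').Wt Γ (B.erase.inst (.fst A.erase p.erase)) ∧
      Derivable (defEq Γ (Tm.snd A.erase B.erase p.erase) (snd (nf A) (nf B) p').erase
        (B.erase.inst (.fst A.erase p.erase))) := by
    have hf := Derivable.fst_type_of_eq dA dB hA'.derivable eA hp'.derivable
    exact ⟨⟨i, hA', hB'.conv_ctx eA hA'.derivable, hp'.sub (.eq (.sigma_form_eq dA eA eB)),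
      .symm_eq (.eq_trans (.inst_congr_type dA dB (.fst_type dA dB dp) hf (.fst_congr dA dB eA ep))
        (eB.instEq hf))⟩, .snd_congr dA dB hA'.derivable hB'.derivable eA eB ep⟩
  generalize nf p = p' at hp' ep
  cases p' with
  | pair A₁ B₁ a b =>
    simp only [Exp.nfSnd]
    split
    · next hag =>
      have ⟨k, hA₁, hB₁, ha, hb, _⟩ := hp'
      obtain ⟨eA, eB⟩ := h.agree_family hag hA hB hA₁ hB₁
      have ha := ha.sub (.eq eA)
      have hb := hb.sub (.eq (eB.instEq ha.derivable))
      have hf := Derivable.fst_type dA dB dp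
      have ef := Derivable.fst_congr dA dB (.eq_refl dA) ep
      have ea := Derivable.fst_pair dA dB ha.derivable hb.derivable
      exact ⟨hb.sub (.symm_eq (.inst_congr_type dA dB hf ha.derivable (.eq_trans ef ea))),
        .eq_trans (.snd_congr dA dB dA dB (.eq_refl dA) (.eq_refl dB) ep)
        (.eq_conv (.snd_pair dA dB ha.derivable hb.derivable) (.eq_symm
          (.inst_congr_type dA dB hf (.fst_type dA dB hp'.derivable) ef)))⟩
    · exact stuck _ hp' ep
  | _ => exact stuck _ hp' ep

theorem nfNatInd (hC : C.Wt (.nat :: Γ) (.univ j)) (hz : z.Wt Γ (C.erase.inst .zero))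
    (hs : s.Wt (C.erase :: .nat :: Γ) (C.erase.instUnder 2 (.succ (.var 1))))
    (hn : n.Wt Γ .nat) :
    (nfNatInd nf C z s (nf n)).Wt Γ (C.erase.inst n.erase) ∧
    Derivable (defEq Γ (Tm.natInd C.erase z.erase s.erase n.erase)
      (nfNatInd nf C z s (nf n)).erase (C.erase.inst n.erase)) := by
  obtain ⟨hn', en⟩ := h hn
  obtain ⟨hC', eC⟩ := h hC
  obtain ⟨hz', ez⟩ := h hz
  obtain ⟨hs', es⟩ := h hs
  have dC := hC.derivable
  have dN := Derivable.nat_form 0 hn.ctx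
  have eCn {n' : Exp} (hn' : n'.Wt Γ .nat) (en : Derivable (defEq Γ n.erase n'.erase .nat)) :=
    Derivable.inst_congr_type dN dC hn.derivable hn'.derivable en
  have stuck (n' : Exp) (hn' : n'.Wt Γ .nat) (en : Derivable (defEq Γ n.erase n'.erase .nat)) :
      (natInd (nf C) (nf z) (nf s) n').Wt Γ (C.erase.inst n.erase) ∧
      Derivable (defEq Γ (Tm.natInd C.erase z.erase s.erase n.erase)
        (natInd (nf C) (nf z) (nf s) n').erase (C.erase.inst n.erase)) :=
    ⟨⟨j, hC', hz'.sub (.eq (eC.instEq (.nat_intro₁ hn.ctx))),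
      (hs'.sub (.eq (eC.substEq (Derivable.isSubst_succ hC.ctx_cons) hC.ctx_cons))).conv_ctx eC
        hC'.derivable, hn', .symm_eq (.eq_trans (eCn hn' en) (eC.instEq hn'.derivable))⟩,
      .nat_elim_eq dC eC ez es en⟩
  have congr {n' : Exp} (en : Derivable (defEq Γ n.erase n'.erase .nat)) :=
    Derivable.nat_elim_eq dC (.eq_refl dC) (.eq_refl hz.derivable) (.eq_refl hs.derivable) en
  generalize nf n = n' at hn' en
  cases n' with
  | zero =>
    have eT := eCn hn' en
    obtain ⟨hr, er⟩ := h (hz.sub (.symm_eq eT))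
    exact ⟨hr, .eq_trans (congr en) (.eq_trans (.eq_conv (.nat_comp₁ dC hz.derivable
      hs.derivable) (.eq_symm eT)) er)⟩
  | succ m =>
    have eT := eCn hn' en
    have hm := hn'.1
    have hr := hs.subst (.isSubst_cons (a := natInd C z s m) (.isSubst_cons (.isSubst_var hm.ctx)
      (a := m) (A := .nat) hm) (by
        rw [erases_cons, erases_var]
        exact ⟨j, hC, hz, hs, hm, .refl _⟩)) hm.ctx
    rw [erases_cons, erases_cons, erases_var, Tm.instUnder_succ_subst] at hr
    obtain ⟨hr, er⟩ := h (hr.sub (.symm_eq eT))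
    refine ⟨hr, .eq_trans (congr en) (.eq_trans (.eq_conv ?_ (.eq_symm eT)) er)⟩
    rw [erase_subst, erases_cons, erases_cons, erases_var]
    exact .nat_comp₂ dC hz.derivable hs.derivable hm.derivable
  | _ => exact stuck _ hn' en

theorem nfPathInd (hA : A.Wt Γ (.univ i))
    (hC : C.Wt (.path A.erase.wk.wk (.var 1) (.var 0) :: A.erase.wk :: A.erase :: Γ) (.univ j))
    (hc : c.Wt (A.erase :: Γ) C.erase.instRefl) (ha : a.Wt Γ A.erase) (hb : b.Wt Γ A.erase)
    (hp : p.Wt Γ (.path A.erase a.erase b.erase)) :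
    (nfPathInd nf A C c a b (nf p)).Wt Γ (C.erase.inst₃ a.erase b.erase p.erase) ∧
    Derivable (defEq Γ (Tm.pathInd C.erase c.erase a.erase b.erase p.erase)
      (nfPathInd nf A C c a b (nf p)).erase (C.erase.inst₃ a.erase b.erase p.erase)) := by
  obtain ⟨hp', ep⟩ := h hp
  obtain ⟨hC', eC⟩ := h hC
  obtain ⟨hc', ec⟩ := h hc
  obtain ⟨ha', ea⟩ := h ha
  obtain ⟨hb', eb⟩ := h hb
  have dA := hA.derivable
  have dC := hC.derivable
  have da := ha.derivable
  have db := hb.derivable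
  have dp := hp.derivable
  have stuck (p' : Exp) (hp' : p'.Wt Γ (.path A.erase a.erase b.erase))
      (ep : Derivable (defEq Γ p.erase p'.erase (.path A.erase a.erase b.erase))) :
      (pathInd A (nf C) (nf c) (nf a) (nf b) p').Wt Γ (C.erase.inst₃ a.erase b.erase p.erase) ∧
      Derivable (defEq Γ (Tm.pathInd C.erase c.erase a.erase b.erase p.erase)
        (pathInd A (nf C) (nf c) (nf a) (nf b) p').erase
        (C.erase.inst₃ a.erase b.erase p.erase)) := by
    have hp₁ := hp'.sub (.eq (.path_form_eq (.eq_refl dA) ea eb))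
    exact ⟨⟨i, j, hA, hC', hc'.sub (.eq (eC.substEq (Derivable.isSubst_refl dA) hA.ctx_cons)),
      ha', hb', hp₁, .symm_eq (.eq_trans (.inst₃_congr_type dA dC da ha'.derivable ea db
        hb'.derivable eb dp hp₁.derivable ep) (eC.substEq
          (Derivable.isSubst_path ha'.derivable hb'.derivable hp₁.derivable) ha.ctx))⟩,
      .path_elim_eq dA eC ec ea eb ep⟩
  generalize nf p = p' at hp' ep
  cases p' with
  | refl A₁ a₁ =>
    simp only [Exp.nfPathInd]
    split
    · next hag =>
      obtain ⟨k, hA₁, ha₁, -⟩ := hp'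
      have eA := h.agree_type (and_left hag) hA hA₁
      have ha₁ := ha₁.sub (.symm_eq eA)
      have eaa := h.agree_eq (and_left (and_right hag)) ha ha₁
      have eba := h.agree_eq (and_right (and_right hag)) hb ha₁
      have eab := Derivable.eq_trans eba (.eq_symm eaa)
      have hr := Derivable.path_intro dA da
      -- The proof has become `refl a₁`, whereas the computation rule wants `refl a` with `a` at
      -- both ends; the chain `a ≡ a₁ ≡ b` closes the gap.
      have er : Derivable (defEq Γ p.erase (.refl a.erase) (.path A.erase a.erase b.erase)) :=
        .eq_trans ep (.eq_conv (.eq_symm (.path_intro_eq dA eaa))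
          (.path_form_eq (.eq_refl dA) (.eq_refl da) (.eq_symm eab)))
      have eT := Derivable.inst₃_congr_type dA dC da da (.eq_refl da) db da eab dp hr er
      have hci := hc.inst ha
      rw [Tm.instRefl_inst] at hci
      obtain ⟨hres, eres⟩ := h (hci.sub (.symm_eq eT))
      refine ⟨hres, .eq_trans (.path_elim_eq dA (.eq_refl dC) (.eq_refl hc.derivable)
        (.eq_refl da) eab er) (.eq_trans (.eq_conv ?_ (.eq_symm eT)) eres)⟩
      rw [erase_inst]
      exact .path_comp dA dC hc.derivable da
    · exact stuck _ hp' ep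
  | _ => exact stuck _ hp' ep

theorem nfStep : NfSound (nfStep nf) := by
  intro e Γ T he
  have sub {e e' : Exp} {S T : Tm} (hS : Sub Γ S T)
      (he : e'.Wt Γ S ∧ Derivable (defEq Γ e.erase e'.erase S)) :
      e'.Wt Γ T ∧ Derivable (defEq Γ e.erase e'.erase T) := ⟨he.1.sub hS, hS.typeEq he.2⟩
  cases e with
  | var | univ | empty | nat | zero => exact ⟨he, .eq_refl he.derivable⟩
  | pi A B =>
    obtain ⟨i, hA, hB, hS⟩ := he
    obtain ⟨hA', eA⟩ := h hA
    obtain ⟨hB', eB⟩ := h hB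
    exact ⟨⟨i, hA', hB'.conv_ctx eA hA'.derivable, hS⟩,
      hS.typeEq (.pi_form_eq hA.derivable eA eB)⟩
  | lam A B b =>
    obtain ⟨i, hA, hB, hb, hS⟩ := he
    obtain ⟨hA', eA⟩ := h hA
    obtain ⟨hb', eb⟩ := h hb
    exact ⟨⟨i, hA', hB.conv_ctx eA hA'.derivable, hb'.conv_ctx eA hA'.derivable,
      .trans (.symm_eq (.pi_form_eq hA.derivable eA (.eq_refl hB.derivable))) hS⟩,
      hS.typeEq (.pi_intro_eq hA.derivable eA eb)⟩
  | app A B f a =>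
    obtain ⟨i, hA, hB, hf, ha, hS⟩ := he
    exact sub (e := app A B f a) hS (h.nfApp hA hB hf ha)
  | sigma A B =>
    obtain ⟨i, hA, hB, hS⟩ := he
    obtain ⟨hA', eA⟩ := h hA
    obtain ⟨hB', eB⟩ := h hB
    exact ⟨⟨i, hA', hB'.conv_ctx eA hA'.derivable, hS⟩,
      hS.typeEq (.sigma_form_eq hA.derivable eA eB)⟩
  | pair A B a b =>
    obtain ⟨i, hA, hB, ha, hb, hS⟩ := he
    obtain ⟨ha', ea⟩ := h ha
    obtain ⟨hb', eb⟩ := h hb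
    exact ⟨⟨i, hA, hB, ha', hb'.sub (.eq (.inst_congr_type hA.derivable hB.derivable ha.derivable
      ha'.derivable ea)), hS⟩, hS.typeEq (.sigma_intro_eq hA.derivable hB.derivable ea eb)⟩
  | sigmaInd A B C g p =>
    obtain ⟨i, j, hA, hB, hC, hg, hp, hS⟩ := he
    exact sub (e := sigmaInd A B C g p) hS (h.nfSigmaInd hA hB hC hg hp)
  | fst A B p =>
    obtain ⟨i, hA, hB, hp, hS⟩ := he
    exact sub (e := fst A B p) hS (h.nfFst hA hB hp)
  | snd A B p =>
    obtain ⟨i, hA, hB, hp, hS⟩ := he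
    exact sub (e := snd A B p) hS (h.nfSnd hA hB hp)
  | emptyInd C e =>
    obtain ⟨j, hC, he, hS⟩ := he
    obtain ⟨hC', eC⟩ := h hC
    obtain ⟨he', ee⟩ := h he
    exact ⟨⟨j, hC', he', .trans (.symm_eq (.eq_trans (.inst_congr_type (.empty_form 0 he.ctx)
      hC.derivable he.derivable he'.derivable ee) (eC.instEq he'.derivable))) hS⟩,
      hS.typeEq (.empty_elim_eq eC ee)⟩
  | succ n =>
    obtain ⟨hn, hS⟩ := he
    obtain ⟨hn', en⟩ := h hn
    exact ⟨⟨hn', hS⟩, hS.typeEq (.nat_intro₂_eq en)⟩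
  | natInd C z s n =>
    obtain ⟨j, hC, hz, hs, hn, hS⟩ := he
    exact sub (e := natInd C z s n) hS (h.nfNatInd hC hz hs hn)
  | path A a b =>
    obtain ⟨i, hA, ha, hb, hS⟩ := he
    obtain ⟨hA', eA⟩ := h hA
    obtain ⟨ha', ea⟩ := h ha
    obtain ⟨hb', eb⟩ := h hb
    exact ⟨⟨i, hA', ha'.sub (.eq eA), hb'.sub (.eq eA), hS⟩, hS.typeEq (.path_form_eq eA ea eb)⟩
  | refl A a =>
    obtain ⟨i, hA, ha, hS⟩ := he
    obtain ⟨ha', ea⟩ := h ha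
    exact ⟨⟨i, hA, ha', .trans (.symm_eq (.path_form_eq (.eq_refl hA.derivable) ea ea)) hS⟩,
      hS.typeEq (.path_intro_eq hA.derivable ea)⟩
  | pathInd A C c a b p =>
    obtain ⟨i, j, hA, hC, hc, ha, hb, hp, hS⟩ := he
    exact sub (e := pathInd A C c a b p) hS (h.nfPathInd hA hC hc ha hb hp)

end NfSound

theorem nfSound_nfFuel (m : ℕ) : NfSound (nfFuel m) := by
  induction m with
  | zero => exact fun e Γ T he => ⟨he, .eq_refl he.derivable⟩
  | succ m ih => exact ih.nfStep

theorem nfSound : NfSound nf := nfSound_nfFuel 1000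

end Exp
end MLTT

namespace MLTT
open Judgment

/-! ### Soundness of type checking -/

theorem Tm.rename_inst_var_one (B : Tm) : (B.rename (upRen (· + 2))).inst (.var 1) = B.wk := by
  rw [Tm.inst, Tm.rename_subst, Tm.wk, Tm.rename_eq_subst]
  congr 1; funext k; cases k <;> rfl

namespace Exp

/-- The raw context under an annotated one. -/
noncomputable abbrev eraseCtx (Γ : List Exp) : Ctx := Γ.map erase

/-- `T` is a well-typed type. -/
def IsTy (Γ : Ctx) (T : Exp) : Prop := ∃ i, T.Wt Γ (.univ i)

/-- The annotated context `Γ` is well-formed. -/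
def WfCtx : List Exp → Prop
  | [] => True
  | A :: Γ => WfCtx Γ ∧ IsTy (eraseCtx Γ) A

theorem WfCtx.derivable {Γ : List Exp} (h : WfCtx Γ) : Derivable (isCtx (eraseCtx Γ)) := by
  cases Γ with
  | nil => exact .ctx_nil
  | cons A Γ =>
    obtain ⟨-, i, hA⟩ := h
    exact hA.ctx_cons

theorem WfCtx.cons {Γ : List Exp} {A : Exp} {i : ℕ} (h : WfCtx Γ)
    (hA : A.Wt (eraseCtx Γ) (.univ i)) : WfCtx (A :: Γ) := ⟨h, i, hA⟩

theorem IsTy.inst {Γ : Ctx} {A : Tm} {B a : Exp} {i : ℕ} (hB : B.Wt (A :: Γ) (.univ i))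
    (ha : a.Wt Γ A) : IsTy Γ (B.inst a) := ⟨i, hB.inst ha⟩

theorem IsSubst.shift {Γ : Ctx} {A B : Tm} (h : Derivable (isCtx (B :: A :: Γ))) :
    Exp.IsSubst (B :: A :: Γ) (fun k => .var (k + 2)) Γ := by
  intro k C hk
  refine ⟨_, h, .there _ (.there _ hk), ?_⟩
  rw [← Derivable.rename_add_two]
  exact Tm.rename_eq_subst C _ ▸ .refl _

theorem IsSubst.pair {Γ : Ctx} {A B : Exp} {i : ℕ} (hA : A.Wt Γ (.univ i))
    (hB : B.Wt (A.erase :: Γ) (.univ i)) :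
    Exp.IsSubst (B.erase :: A.erase :: Γ) (cons (.pair (A.rename (· + 2))
      (B.rename (upRen (· + 2))) (.var 1) (.var 0)) fun k => .var (k + 2))
      (.sigma A.erase B.erase :: Γ) := by
  have h := hB.ctx_cons
  have hρ : IsRenaming (B.erase :: A.erase :: Γ) (· + 2) Γ := fun k C hk => by
    rw [Derivable.rename_add_two]
    exact .there _ (.there _ hk)
  have hA₂ := hA.rename hρ h
  have hΔ := hA₂.ctx_cons
  rw [erase_rename] at hΔ
  have hB₂ := hB.rename (hρ.up _) hΔ
  refine Wt.isSubst_cons (.shift h) ⟨i, hA₂, erase_rename A _ ▸ hB₂,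
    ⟨_, h, .there _ (.here _ _), ?_⟩,
    ⟨_, h, .here _ _, ?_⟩, ?_⟩
  · rw [erase_rename, Derivable.rename_add_two]
    exact .refl _
  · rw [erase_rename, erase_var, Tm.rename_inst_var_one]
    exact .refl _
  · rw [erase_rename, erase_rename, Tm.rename_eq_subst, Tm.rename_eq_subst, ← upSub_ren]
    exact .refl _

theorem IsSubst.succ {Γ : Ctx} {C : Exp} {i : ℕ} (hC : C.Wt (.nat :: Γ) (.univ i)) :
    Exp.IsSubst (C.erase :: .nat :: Γ) (cons (.succ (.var 1)) fun k => .var (k + 2))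
      (.nat :: Γ) :=
  Wt.isSubst_cons (.shift hC.ctx_cons) ⟨⟨_, hC.ctx_cons, .there _ (.here _ _), .refl _⟩, .refl _⟩

theorem IsSubst.refl {Γ : Ctx} {A : Exp} {i : ℕ} (hA : A.Wt Γ (.univ i)) :
    Exp.IsSubst (A.erase :: Γ) (cons (.refl A.wk (.var 0)) (cons (.var 0) (cons (.var 0)
      fun k => .var (k + 1)))) (.path A.erase.wk.wk (.var 1) (.var 0) :: A.erase.wk ::
      A.erase :: Γ) := by
  have h := hA.ctx_cons
  have e (B : Tm) : B.subst (erases fun k => .var (k + 1)) = B.wk := (B.rename_eq_subst _).symm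
  have σ : Exp.IsSubst (A.erase :: Γ) (fun k => .var (k + 1)) Γ := fun k B hk =>
    ⟨_, h, .there _ hk, e B ▸ .refl _⟩
  have hv : (Exp.var 0).Wt (A.erase :: Γ) A.erase.wk := ⟨_, h, .here _ _, .refl _⟩
  refine Wt.isSubst_cons (Wt.isSubst_cons (Wt.isSubst_cons σ ?_) ?_) ⟨i, hA.wk hA.derivable, ?_, ?_⟩
  · rwa [e]
  · rwa [erases_cons, Tm.wk_subst_consSub, e]
  · rwa [erase_wk]
  · simp only [Tm.subst, erases_cons, Tm.wk_subst_consSub, e, erase_wk]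
    exact .refl _

theorem IsSubst.path {Γ : Ctx} {A a b p : Exp} (ha : a.Wt Γ A.erase) (hb : b.Wt Γ A.erase)
    (hp : p.Wt Γ (.path A.erase a.erase b.erase)) :
    Exp.IsSubst Γ (cons p (cons b (cons a var)))
      (.path A.erase.wk.wk (.var 1) (.var 0) :: A.erase.wk :: A.erase :: Γ) := by
  refine Wt.isSubst_cons (Wt.isSubst_cons (Wt.isSubst_cons (Wt.isSubst_var ha.ctx) ?_) ?_) ?_
  · rwa [erases_var, Tm.subst_var]
  · rwa [erases_cons, Tm.wk_subst_consSub, erases_var, Tm.subst_var]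
  · simp only [Tm.subst, erases_cons, Tm.wk_subst_consSub, erases_var, Tm.subst_var]
    exact hp

/-- `Δ` is the tail of `Γ` in which the type of the variable was declared; it yields the typing of
the weakened type by renaming. -/
theorem WfCtx.lookup {Γ : List Exp} (h : WfCtx Γ) {k : ℕ} {S : Exp} (hk : lookup Γ k = some S) :
    Lookup (eraseCtx Γ) k (S.erase.rename (· + (k + 1))) ∧
      ∃ Δ i, S.Wt Δ (.univ i) ∧ IsRenaming (eraseCtx Γ) (· + (k + 1)) Δ := by
  induction Γ generalizing k with
  | nil => cases hk
  | cons A Γ ih =>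
    obtain ⟨hΓ, i, hA⟩ := h
    cases k with
    | zero =>
      obtain rfl : A = S := Option.some.inj hk
      exact ⟨.here _ _, _, i, hA, .succ _ _⟩
    | succ k =>
      obtain ⟨h₁, Δ, i, h₂, h₃⟩ := ih hΓ hk
      refine ⟨?_, Δ, i, h₂, fun l B hl => ?_⟩
      · simpa [Tm.wk, Tm.rename_rename, add_assoc] using Lookup.there A.erase h₁
      · simpa [Tm.wk, Tm.rename_rename, add_assoc] using Lookup.there A.erase (h₃ hl)

section
variable {Γ : Ctx} {A B S T a b : Exp} {i : ℕ}

theorem sub_sound (h : S.sub T = true) (hS : IsTy Γ S) (hT : IsTy Γ T) :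
    Sub Γ S.erase T.erase := by
  obtain ⟨i, hS⟩ := hS
  obtain ⟨j, hT⟩ := hT
  rw [Exp.sub] at h
  split at h
  · next hs => exact erase_eq_of_same hs ▸ .refl _
  · have key : Sub Γ (nf S).erase (nf T).erase := by
      revert h
      generalize nf S = S'
      generalize nf T = T'
      intro h
      cases S' with
      | univ =>
        cases T' with
        | univ => exact .univ_le (Nat.le_of_ble_eq_true h)
        | _ => exact (Bool.false_ne_true h).elim
      | _ => dsimp only [subNf] at h; exact erase_eq_of_same h ▸ .refl _
    exact .trans (.eq (nfSound hS).2) (key.trans (.symm_eq (nfSound hT).2))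

theorem asUniv_sound (h : asUniv T = some i) (hT : IsTy Γ T) : Sub Γ T.erase (.univ i) := by
  obtain ⟨j, hT⟩ := hT
  unfold asUniv at h
  split at h
  · cases h; exact .refl _
  · have e := (nfSound hT).2
    split at h
    · next hn =>
      cases h
      rw [hn] at e
      exact .eq e
    · cases h

/-- Both inclusions are recorded: inference of an application uses the first, checking of a λ the
second. -/
theorem asPi_sound (h : asPi T = some (A, B)) (hT : IsTy Γ T) :
    ∃ i, A.Wt Γ (.univ i) ∧ B.Wt (A.erase :: Γ) (.univ i) ∧ Sub Γ T.erase (.pi A.erase B.erase) ∧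
      Sub Γ (.pi A.erase B.erase) T.erase := by
  obtain ⟨j, hT⟩ := hT
  unfold asPi at h
  split at h
  · cases h
    obtain ⟨i, hA, hB, -⟩ := hT
    exact ⟨i, hA, hB, .refl _, .refl _⟩
  · obtain ⟨hn, e⟩ := nfSound hT
    split at h
    · next hT' =>
      cases h
      rw [hT'] at e hn
      obtain ⟨i, hA, hB, -⟩ := hn
      exact ⟨i, hA, hB, .eq e, .symm_eq e⟩
    · cases h

theorem asSigma_sound (h : asSigma T = some (A, B)) (hT : IsTy Γ T) :
    ∃ i, A.Wt Γ (.univ i) ∧ B.Wt (A.erase :: Γ) (.univ i) ∧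
      Sub Γ T.erase (.sigma A.erase B.erase) ∧ Sub Γ (.sigma A.erase B.erase) T.erase := by
  obtain ⟨j, hT⟩ := hT
  unfold asSigma at h
  split at h
  · cases h
    obtain ⟨i, hA, hB, -⟩ := hT
    exact ⟨i, hA, hB, .refl _, .refl _⟩
  · obtain ⟨hn, e⟩ := nfSound hT
    split at h
    · next hT' =>
      cases h
      rw [hT'] at e hn
      obtain ⟨i, hA, hB, -⟩ := hn
      exact ⟨i, hA, hB, .eq e, .symm_eq e⟩
    · cases h

theorem asPath_sound (h : asPath T = some (A, a, b)) (hT : IsTy Γ T) :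
    ∃ i, A.Wt Γ (.univ i) ∧ a.Wt Γ A.erase ∧ b.Wt Γ A.erase ∧
      Sub Γ T.erase (.path A.erase a.erase b.erase) ∧
      Sub Γ (.path A.erase a.erase b.erase) T.erase := by
  obtain ⟨j, hT⟩ := hT
  unfold asPath at h
  split at h
  · cases h
    obtain ⟨i, hA, ha, hb, -⟩ := hT
    exact ⟨i, hA, ha, hb, .refl _, .refl _⟩
  · obtain ⟨hn, e⟩ := nfSound hT
    split at h
    · next hT' =>
      cases h
      rw [hT'] at e hn
      obtain ⟨i, hA, ha, hb, -⟩ := hn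
      exact ⟨i, hA, ha, hb, .eq e, .symm_eq e⟩
    · cases h

end
end Exp
open Exp

namespace Checker

/-- The result `r` of checking against `m` is a well-typed term with its type. -/
def IsSound (Γ : List Exp) (m : Option Exp) (r : Exp × Exp) : Prop :=
  r.1.Wt (eraseCtx Γ) r.2.erase ∧ IsTy (eraseCtx Γ) r.2 ∧ ∀ S, m = some S → r.2 = S

/-- A checker that accepts only well-typed terms. -/
def Sound (c : Checker) : Prop := ∀ ⦃Γ m r⦄, WfCtx Γ → (∀ S, m = some S → IsTy (eraseCtx Γ) S) →
  c Γ m = some r → IsSound Γ m r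

section
variable {Γ : List Exp} {m : Option Exp} {r : Exp × Exp} {c : Checker}

theorem expect_sound {e S : Exp} (h : expect e S m = some r) (he : e.Wt (eraseCtx Γ) S.erase)
    (hS : IsTy (eraseCtx Γ) S) (hm : ∀ T, m = some T → IsTy (eraseCtx Γ) T) : IsSound Γ m r := by
  unfold expect at h
  split at h
  · cases h; exact ⟨he, hS, by simp⟩
  · split at h
    · next hs => cases h; exact ⟨he.sub (sub_sound hs hS (hm _ rfl)), hm _ rfl, by simp⟩
    · cases h

theorem Sound.infer (hc : Sound c) (hΓ : WfCtx Γ) {e T : Exp} (h : c Γ none = some (e, T)) :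
    e.Wt (eraseCtx Γ) T.erase ∧ IsTy (eraseCtx Γ) T :=
  have := hc hΓ (by simp) h
  ⟨this.1, this.2.1⟩

theorem Sound.type (hc : Sound c) (hΓ : WfCtx Γ) {k : Exp → ℕ → Option (Exp × Exp)}
    (h : c.type Γ k = some r) : ∃ A i, A.Wt (eraseCtx Γ) (.univ i) ∧ k A i = some r := by
  unfold Checker.type at h
  split at h
  · next hA =>
    obtain ⟨hA, hU⟩ := hc.infer hΓ hA
    split at h
    · next hi => exact ⟨_, _, hA.sub (asUniv_sound hi hU), h⟩
    · cases h
  · cases h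

theorem Sound.ofType (hc : Sound c) (hΓ : WfCtx Γ) {T : Exp} (hT : IsTy (eraseCtx Γ) T)
    {k : Exp → Option (Exp × Exp)} (h : c.ofType Γ T k = some r) :
    ∃ a, a.Wt (eraseCtx Γ) T.erase ∧ k a = some r := by
  unfold Checker.ofType at h
  split at h
  · next ha =>
    obtain ⟨ha, -, e⟩ := hc hΓ (by rintro _ ⟨⟩; exact hT) ha
    exact ⟨_, e _ rfl ▸ ha, h⟩
  · cases h

end

variable {A B C a b c e f g n p s z : Checker}

theorem Sound.pi (hA : Sound A) (hB : Sound B) : Sound (pi A B) := by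
  intro Γ m r hΓ hm h
  obtain ⟨A, i, hA, h⟩ := hA.type hΓ h
  obtain ⟨B, j, hB, h⟩ := hB.type (hΓ.cons hA) h
  exact expect_sound h ⟨_, hA.cumul (le_max_left i j), hB.cumul (le_max_right i j), .refl _⟩
    ⟨_, hΓ.derivable, .refl _⟩ hm

theorem Sound.sigma (hA : Sound A) (hB : Sound B) : Sound (sigma A B) := by
  intro Γ m r hΓ hm h
  obtain ⟨A, i, hA, h⟩ := hA.type hΓ h
  obtain ⟨B, j, hB, h⟩ := hB.type (hΓ.cons hA) h
  exact expect_sound h ⟨_, hA.cumul (le_max_left i j), hB.cumul (le_max_right i j), .refl _⟩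
    ⟨_, hΓ.derivable, .refl _⟩ hm

theorem Sound.lam (hA : Sound A) (hb : Sound b) : Sound (lam A b) := by
  intro Γ m r hΓ hm h
  unfold Checker.lam at h
  split at h
  · obtain ⟨A, i, hA, h⟩ := hA.type hΓ h
    split at h
    · next hb' =>
      obtain ⟨hb, j, hB⟩ := hb.infer (hΓ.cons hA) hb'
      cases h
      have hA := hA.cumul (le_max_left i j)
      have hB := hB.cumul (le_max_right i j)
      exact ⟨⟨_, hA, hB, hb, .refl _⟩, ⟨_, _, hA, hB, .refl _⟩, by simp⟩
    · cases h
  · split at h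
    · next hT =>
      obtain ⟨i, hA, hB, -, hs⟩ := asPi_sound hT (hm _ rfl)
      obtain ⟨b, hb, h⟩ := hb.ofType (hΓ.cons hA) ⟨i, hB⟩ h
      cases h
      exact ⟨⟨i, hA, hB, hb, hs⟩, hm _ rfl, by simp⟩
    · cases h

theorem Sound.app (hf : Sound f) (ha : Sound a) : Sound (app f a) := by
  intro Γ m r hΓ hm h
  unfold Checker.app at h
  split at h
  · next hf' =>
    obtain ⟨hf, hT⟩ := hf.infer hΓ hf'
    split at h
    · next hT' =>
      obtain ⟨i, hA, hB, hs, -⟩ := asPi_sound hT' hT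
      obtain ⟨a, ha, h⟩ := ha.ofType hΓ ⟨i, hA⟩ h
      exact expect_sound h ⟨i, hA, hB, hf.sub hs, ha, erase_inst _ _ ▸ .refl _⟩ (.inst hB ha) hm
    · cases h
  · cases h

theorem Sound.pair (ha : Sound a) (hb : Sound b) : Sound (pair a b) := by
  intro Γ m r hΓ hm h
  unfold Checker.pair at h
  split at h
  · cases h
  · split at h
    · next hT =>
      obtain ⟨i, hA, hB, -, hs⟩ := asSigma_sound hT (hm _ rfl)
      obtain ⟨a, ha, h⟩ := ha.ofType hΓ ⟨i, hA⟩ h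
      obtain ⟨b, hb, h⟩ := hb.ofType hΓ (.inst hB ha) h
      cases h
      exact ⟨⟨i, hA, hB, ha, erase_inst _ _ ▸ hb, hs⟩, hm _ rfl, by simp⟩
    · cases h

theorem Sound.sigmaInd (hC : Sound C) (hg : Sound g) (hp : Sound p) : Sound (sigmaInd C g p) := by
  intro Γ m r hΓ hm h
  unfold Checker.sigmaInd at h
  split at h
  · next hp' =>
    obtain ⟨hp, hT⟩ := hp.infer hΓ hp'
    split at h
    · next A B hT' =>
      obtain ⟨i, hA, hB, hs, -⟩ := asSigma_sound hT' hT
      have hAB : (Exp.sigma A B).Wt (eraseCtx Γ) (.univ i) := ⟨i, hA, hB, .refl _⟩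
      obtain ⟨C, j, hC, h⟩ := hC.type (hΓ.cons hAB) h
      obtain ⟨g, hg, h⟩ := hg.ofType (T := C.instUnder 2 _) ((hΓ.cons hA).cons hB)
        ⟨j, hC.subst (.pair hA hB) hB.ctx_cons⟩ h
      rw [erase_instUnder] at hg
      exact expect_sound h ⟨i, j, hA, hB, hC, hg, hp.sub hs, erase_inst _ _ ▸ .refl _⟩
        (.inst hC (hp.sub hs)) hm
    · cases h
  · cases h

theorem Sound.fst (hp : Sound p) : Sound (fst p) := by
  intro Γ m r hΓ hm h
  unfold Checker.fst at h
  split at h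
  · next hp' =>
    obtain ⟨hp, hT⟩ := hp.infer hΓ hp'
    split at h
    · next hT' =>
      obtain ⟨i, hA, hB, hs, -⟩ := asSigma_sound hT' hT
      exact expect_sound h ⟨i, hA, hB, hp.sub hs, .refl _⟩ ⟨i, hA⟩ hm
    · cases h
  · cases h

theorem Sound.snd (hp : Sound p) : Sound (snd p) := by
  intro Γ m r hΓ hm h
  unfold Checker.snd at h
  split at h
  · next hp' =>
    obtain ⟨hp, hT⟩ := hp.infer hΓ hp'
    split at h
    · next A B hT' =>
      obtain ⟨i, hA, hB, hs, -⟩ := asSigma_sound hT' hT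
      have hf : (Exp.fst A B _).Wt (eraseCtx Γ) A.erase := ⟨i, hA, hB, hp.sub hs, .refl _⟩
      exact expect_sound h ⟨i, hA, hB, hp.sub hs, erase_inst _ _ ▸ .refl _⟩ (.inst hB hf) hm
    · cases h
  · cases h

theorem Sound.emptyInd (hC : Sound C) (he : Sound e) : Sound (emptyInd C e) := by
  intro Γ m r hΓ hm h
  have hE : Exp.empty.Wt (eraseCtx Γ) (.univ 0) := ⟨hΓ.derivable, .refl _⟩
  obtain ⟨C, j, hC, h⟩ := hC.type (hΓ.cons hE) h
  obtain ⟨e, he, h⟩ := he.ofType hΓ ⟨0, hE⟩ h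
  exact expect_sound h ⟨j, hC, he, erase_inst _ _ ▸ .refl _⟩ (.inst hC he) hm

theorem Sound.succ (hn : Sound n) : Sound (succ n) := by
  intro Γ m r hΓ hm h
  have hN : Exp.nat.Wt (eraseCtx Γ) (.univ 0) := ⟨hΓ.derivable, .refl _⟩
  obtain ⟨n, hn, h⟩ := hn.ofType hΓ ⟨0, hN⟩ h
  exact expect_sound h ⟨hn, .refl _⟩ ⟨0, hN⟩ hm

theorem Sound.natInd (hC : Sound C) (hz : Sound z) (hs : Sound s) (hn : Sound n) :
    Sound (natInd C z s n) := by
  intro Γ m r hΓ hm h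
  have hN : Exp.nat.Wt (eraseCtx Γ) (.univ 0) := ⟨hΓ.derivable, .refl _⟩
  have h0 : Exp.zero.Wt (eraseCtx Γ) .nat := ⟨hΓ.derivable, .refl _⟩
  obtain ⟨C, j, hC, h⟩ := hC.type (hΓ.cons hN) h
  obtain ⟨z, hz, h⟩ := hz.ofType hΓ (.inst hC h0) h
  obtain ⟨s, hs, h⟩ := hs.ofType (T := C.instUnder 2 _) ((hΓ.cons hN).cons hC)
    ⟨j, hC.subst (.succ hC) hC.ctx_cons⟩ h
  obtain ⟨n, hn, h⟩ := hn.ofType hΓ ⟨0, hN⟩ h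
  rw [erase_instUnder] at hs
  rw [erase_inst] at hz
  exact expect_sound h ⟨j, hC, hz, hs, hn, erase_inst _ _ ▸ .refl _⟩ (.inst hC hn) hm

theorem Sound.path (hA : Sound A) (ha : Sound a) (hb : Sound b) : Sound (path A a b) := by
  intro Γ m r hΓ hm h
  obtain ⟨A, i, hA, h⟩ := hA.type hΓ h
  obtain ⟨a, ha, h⟩ := ha.ofType hΓ ⟨i, hA⟩ h
  obtain ⟨b, hb, h⟩ := hb.ofType hΓ ⟨i, hA⟩ h
  exact expect_sound h ⟨i, hA, ha, hb, .refl _⟩ ⟨_, hΓ.derivable, .refl _⟩ hm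

theorem Sound.refl (ha : Sound a) : Sound (refl a) := by
  intro Γ m r hΓ hm h
  unfold Checker.refl at h
  split at h
  · split at h
    · next ha' =>
      obtain ⟨ha, i, hA⟩ := ha.infer hΓ ha'
      cases h
      exact ⟨⟨i, hA, ha, .refl _⟩, ⟨i, i, hA, ha, ha, .refl _⟩, by simp⟩
    · cases h
  · split at h
    · next hT =>
      obtain ⟨i, hA, hx, hy, -, hs⟩ := asPath_sound hT (hm _ rfl)
      obtain ⟨a, ha, h⟩ := ha.ofType hΓ ⟨i, hA⟩ h
      split at h
      · next hxy =>
        cases h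
        have ex := nfSound.agree_eq (and_left hxy) ha hx
        have ey := nfSound.agree_eq (and_right hxy) ha hy
        exact ⟨⟨i, hA, ha, .trans (.eq (.path_form_eq (.eq_refl hA.derivable) ex ey)) hs⟩,
          hm _ rfl, by simp⟩
      · cases h
    · cases h

theorem Sound.pathInd (hC : Sound C) (hc : Sound c) (ha : Sound a) (hb : Sound b) (hp : Sound p) :
    Sound (pathInd C c a b p) := by
  intro Γ m r hΓ hm h
  unfold Checker.pathInd at h
  split at h
  · next hp' =>
    obtain ⟨hp, hT⟩ := hp.infer hΓ hp'
    split at h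
    · next A x y hT' =>
      obtain ⟨i, hA, hx, hy, hs, -⟩ := asPath_sound hT' hT
      have hA₁ : A.wk.Wt (A.erase :: eraseCtx Γ) (.univ i) := hA.wk hA.derivable
      have hP : (Exp.path A.wk.wk (.var 1) (.var 0)).Wt
          (A.wk.erase :: A.erase :: eraseCtx Γ) (.univ i) := by
        have hΔ := hA₁.ctx_cons
        refine ⟨i, hA₁.wk hA₁.derivable, ⟨_, hΔ, .there _ (.here _ _), ?_⟩,
          ⟨_, hΔ, .here _ _, ?_⟩, .refl _⟩ <;>
          simp only [erase_wk] <;> exact .refl _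
      obtain ⟨C, j, hC, h⟩ := hC.type (((hΓ.cons hA).cons hA₁).cons hP) h
      have hC : C.Wt (.path A.erase.wk.wk (.var 1) (.var 0) :: A.erase.wk :: A.erase ::
          eraseCtx Γ) (.univ j) := by
        simpa [erase_wk] using hC
      obtain ⟨c, hc, h⟩ := hc.ofType (T := C.instRefl A) (hΓ.cons hA)
        ⟨j, hC.subst (.refl hA) hA.ctx_cons⟩ h
      obtain ⟨a, ha, h⟩ := ha.ofType hΓ ⟨i, hA⟩ h
      obtain ⟨b, hb, h⟩ := hb.ofType hΓ ⟨i, hA⟩ h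
      rw [erase_instRefl] at hc
      split at h
      · next hxy =>
        have ex := nfSound.agree_eq (and_left hxy) ha hx
        have ey := nfSound.agree_eq (and_right hxy) hb hy
        have hp := (hp.sub hs).sub (.symm_eq (.path_form_eq (.eq_refl hA.derivable) ex ey))
        exact expect_sound h ⟨i, j, hA, hC, hc, ha, hb, hp, erase_inst₃ _ _ _ _ ▸ .refl _⟩
          ⟨j, hC.subst (.path ha hb hp) hΓ.derivable⟩ hm
      · cases h
    · cases h
  · cases h

theorem sound_fail : Sound fail := fun _ _ _ _ _ h => by cases h

theorem sound_check (t : Tm) : Sound t.check := by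
  induction t with
  | var k =>
    intro Γ m r hΓ hm h
    change (match Exp.lookup Γ k with
      | some S => expect (.var k) (S.rename (· + (k + 1))) m
      | none => none) = some r at h
    split at h
    · next hk =>
      obtain ⟨h₁, Δ, i, h₂, h₃⟩ := hΓ.lookup hk
      exact expect_sound h ⟨_, hΓ.derivable, h₁, erase_rename _ _ ▸ .refl _⟩
        ⟨i, h₂.rename h₃ hΓ.derivable⟩ hm
    · cases h
  | univ i =>
    exact fun Γ m r hΓ hm h => expect_sound h ⟨hΓ.derivable, .refl _⟩
      ⟨_, hΓ.derivable, .refl _⟩ hm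
  | pi _ _ hA hB => exact hA.pi hB
  | lam _ _ hA hb => exact hA.lam hb
  | app _ _ hf ha => exact hf.app ha
  | sigma _ _ hA hB => exact hA.sigma hB
  | pair _ _ ha hb => exact ha.pair hb
  | sigmaInd C g p hC hg hp =>
    unfold Tm.check
    dsimp only
    split
    · exact hp.snd
    · exact hp.fst
    · exact hC.sigmaInd hg hp
  | sum | inl | inr | sumInd | unit | star | unitInd | univalence => exact sound_fail
  | empty =>
    exact fun Γ m r hΓ hm h => expect_sound h ⟨hΓ.derivable, .refl _⟩
      ⟨_, hΓ.derivable, .refl _⟩ hm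
  | emptyInd _ _ hC he => exact hC.emptyInd he
  | nat =>
    exact fun Γ m r hΓ hm h => expect_sound h ⟨hΓ.derivable, .refl _⟩
      ⟨_, hΓ.derivable, .refl _⟩ hm
  | zero =>
    exact fun Γ m r hΓ hm h => expect_sound h ⟨hΓ.derivable, .refl _⟩
      ⟨_, hΓ.derivable, .refl _⟩ hm
  | succ _ hn => exact hn.succ
  | natInd _ _ _ _ hC hz hs hn => exact hC.natInd hz hs hn
  | path _ _ _ hA ha hb => exact hA.path ha hb
  | refl _ ha => exact ha.refl
  | pathInd _ _ _ _ _ hC hc ha hb hp => exact hC.pathInd hc ha hb hp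

end Checker
end MLTT

namespace MLTT
open Judgment

/-! ### Raising universe levels -/

/-- Raise all universe levels by `n`. -/
def Tm.shift (n : ℕ) : Tm → Tm
  | var k => var k
  | univ i => univ (n + i)
  | pi A B => pi (A.shift n) (B.shift n)
  | lam A b => lam (A.shift n) (b.shift n)
  | app f a => app (f.shift n) (a.shift n)
  | sigma A B => sigma (A.shift n) (B.shift n)
  | pair a b => pair (a.shift n) (b.shift n)
  | sigmaInd C g p => sigmaInd (C.shift n) (g.shift n) (p.shift n)
  | sum A B => sum (A.shift n) (B.shift n)
  | inl a => inl (a.shift n)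
  | inr b => inr (b.shift n)
  | sumInd C g h e => sumInd (C.shift n) (g.shift n) (h.shift n) (e.shift n)
  | empty => empty
  | emptyInd C e => emptyInd (C.shift n) (e.shift n)
  | unit => unit
  | star => star
  | unitInd C c e => unitInd (C.shift n) (c.shift n) (e.shift n)
  | nat => nat
  | zero => zero
  | succ m => succ (m.shift n)
  | natInd C z s m => natInd (C.shift n) (z.shift n) (s.shift n) (m.shift n)
  | path A a b => path (A.shift n) (a.shift n) (b.shift n)
  | refl a => refl (a.shift n)
  | pathInd C c a b p => pathInd (C.shift n) (c.shift n) (a.shift n) (b.shift n) (p.shift n)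
  | univalence i A B => univalence (n + i) (A.shift n) (B.shift n)

namespace Tm
variable (n : ℕ)

theorem shift_rename (t : Tm) (ρ : ℕ → ℕ) : (t.rename ρ).shift n = (t.shift n).rename ρ := by
  induction t generalizing ρ <;> simp_all [shift, rename]

@[simp] theorem shift_wk (t : Tm) : t.wk.shift n = (t.shift n).wk := t.shift_rename n _

theorem shift_upSub (σ : ℕ → Tm) :
    (fun k => (upSub σ k).shift n) = upSub fun k => (σ k).shift n := by
  funext k; cases k <;> simp [shift]

theorem shift_subst (t : Tm) (σ : ℕ → Tm) :
    (t.subst σ).shift n = (t.shift n).subst fun k => (σ k).shift n := by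
  induction t generalizing σ <;> simp_all [shift, subst, shift_upSub]

theorem shift_consSub (t : Tm) (σ : ℕ → Tm) :
    (fun k => (consSub t σ k).shift n) = consSub (t.shift n) fun k => (σ k).shift n := by
  funext k; cases k <;> rfl

@[simp] theorem shift_inst (b a : Tm) : (b.inst a).shift n = (b.shift n).inst (a.shift n) := by
  simp [inst, shift_subst, shift_consSub, shift]

@[simp] theorem shift_instUnder (m : ℕ) (C t : Tm) :
    (C.instUnder m t).shift n = (C.shift n).instUnder m (t.shift n) := by
  simp [instUnder, shift_subst, shift_consSub, shift]

@[simp] theorem shift_inst₃ (C a b p : Tm) :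
    (C.inst₃ a b p).shift n = (C.shift n).inst₃ (a.shift n) (b.shift n) (p.shift n) := by
  simp [inst₃, shift_subst, shift_consSub, shift]

@[simp] theorem shift_instRefl (C : Tm) : C.instRefl.shift n = (C.shift n).instRefl := by
  simp [instRefl, shift_subst, shift_consSub, shift]

@[simp] theorem shift_subst_cons₂ (g a b : Tm) :
    (g.subst (consSub b (consSub a var))).shift n =
      (g.shift n).subst (consSub (b.shift n) (consSub (a.shift n) var)) := by
  simp [shift_subst, shift_consSub, shift]

@[simp] theorem shift_equiv (A B : Tm) : (equiv A B).shift n = equiv (A.shift n) (B.shift n) := by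
  simp [equiv, isEquiv, arrow, prod, shift]

@[simp] theorem shift_isEquiv (A B f : Tm) :
    (isEquiv A B f).shift n = isEquiv (A.shift n) (B.shift n) (f.shift n) := by
  simp [isEquiv, arrow, prod, shift]

@[simp] theorem shift_idToEquiv (i : ℕ) (A B : Tm) :
    (idToEquiv i A B).shift n = idToEquiv (n + i) (A.shift n) (B.shift n) := by
  simp [idToEquiv, idEquiv, idFun, shift]

end Tm

theorem Lookup.shift {Γ : Ctx} {k : ℕ} {A : Tm} (n : ℕ) (h : Lookup Γ k A) :
    Lookup (Γ.map (Tm.shift n)) k (A.shift n) := by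
  induction h with
  | here => simpa using .here _ _
  | there _ _ ih => simpa using .there _ ih

def Judgment.shift (n : ℕ) : Judgment → Judgment
  | isCtx Γ => isCtx (Γ.map (Tm.shift n))
  | hasType Γ a A => hasType (Γ.map (Tm.shift n)) (a.shift n) (A.shift n)
  | defEq Γ a b A => defEq (Γ.map (Tm.shift n)) (a.shift n) (b.shift n) (A.shift n)

-- No rule refers to an absolute universe level: levels occur only as `i` and `i + 1`, and `0`, `1`,
-- `ℕ` are formed at every level. Hence a development at the levels 0, 1, 2 can be moved to any
-- level.
attribute [local simp] Tm.shift Judgment.shift in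
theorem Derivable.shift {J : Judgment} (n : ℕ) (h : Derivable J) : Derivable (J.shift n) := by
  induction h with
  | ctx_nil => exact .ctx_nil
  | ctx_cons _ _ ih₁ ih₂ => exact .ctx_cons ih₁ ih₂
  | var _ hk ih => exact .var ih (hk.shift n)
  | eq_refl _ ih₁ => exact .eq_refl ih₁
  | eq_symm _ ih₁ => exact .eq_symm ih₁
  | eq_trans _ _ ih₁ ih₂ => exact .eq_trans ih₁ ih₂
  | conv _ _ ih₁ ih₂ => exact .conv ih₁ ih₂
  | eq_conv _ _ ih₁ ih₂ => exact .eq_conv ih₁ ih₂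
  | univ_intro _ _ ih₁ => exact .univ_intro _ ih₁
  | univ_cumul _ ih₁ => exact .univ_cumul ih₁
  | univ_cumul_eq _ ih₁ => exact .univ_cumul_eq ih₁
  | pi_form _ _ ih₁ ih₂ => exact .pi_form ih₁ ih₂
  | pi_form_eq _ _ _ ih₁ ih₂ ih₃ => exact .pi_form_eq ih₁ ih₂ ih₃
  | pi_intro _ _ ih₁ ih₂ => exact .pi_intro ih₁ ih₂
  | pi_intro_eq _ _ _ ih₁ ih₂ ih₃ => exact .pi_intro_eq ih₁ ih₂ ih₃
  | pi_elim _ _ ih₁ ih₂ =>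
    simp at ih₁ ih₂ ⊢
    exact .pi_elim ih₁ ih₂
  | pi_elim_eq _ _ ih₁ ih₂ =>
    simp at ih₁ ih₂ ⊢
    exact .pi_elim_eq ih₁ ih₂
  | pi_comp _ _ _ ih₁ ih₂ ih₃ =>
    simp at ih₁ ih₂ ih₃ ⊢
    exact .pi_comp ih₁ ih₂ ih₃
  | pi_uniq _ ih₁ =>
    simp at ih₁ ⊢
    exact .pi_uniq ih₁
  | sigma_form _ _ ih₁ ih₂ => exact .sigma_form ih₁ ih₂
  | sigma_form_eq _ _ _ ih₁ ih₂ ih₃ => exact .sigma_form_eq ih₁ ih₂ ih₃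
  | sigma_intro _ _ _ _ ih₁ ih₂ ih₃ ih₄ =>
    simp at ih₁ ih₂ ih₃ ih₄ ⊢
    exact .sigma_intro ih₁ ih₂ ih₃ ih₄
  | sigma_intro_eq _ _ _ _ ih₁ ih₂ ih₃ ih₄ =>
    simp at ih₁ ih₂ ih₃ ih₄ ⊢
    exact .sigma_intro_eq ih₁ ih₂ ih₃ ih₄
  | sigma_elim _ _ _ _ _ ih₁ ih₂ ih₃ ih₄ ih₅ =>
    simp at ih₁ ih₂ ih₃ ih₄ ih₅ ⊢
    exact .sigma_elim ih₁ ih₂ ih₃ ih₄ ih₅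
  | sigma_elim_eq _ _ _ _ _ ih₁ ih₂ ih₃ ih₄ ih₅ =>
    simp at ih₁ ih₂ ih₃ ih₄ ih₅ ⊢
    exact .sigma_elim_eq ih₁ ih₂ ih₃ ih₄ ih₅
  | sigma_comp _ _ _ _ _ _ ih₁ ih₂ ih₃ ih₄ ih₅ ih₆ =>
    simp at ih₁ ih₂ ih₃ ih₄ ih₅ ih₆ ⊢
    exact .sigma_comp ih₁ ih₂ ih₃ ih₄ ih₅ ih₆
  | sum_form _ _ ih₁ ih₂ => exact .sum_form ih₁ ih₂
  | sum_form_eq _ _ ih₁ ih₂ => exact .sum_form_eq ih₁ ih₂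
  | sum_intro₁ _ _ _ ih₁ ih₂ ih₃ => exact .sum_intro₁ ih₁ ih₂ ih₃
  | sum_intro₁_eq _ _ _ ih₁ ih₂ ih₃ => exact .sum_intro₁_eq ih₁ ih₂ ih₃
  | sum_intro₂ _ _ _ ih₁ ih₂ ih₃ => exact .sum_intro₂ ih₁ ih₂ ih₃
  | sum_intro₂_eq _ _ _ ih₁ ih₂ ih₃ => exact .sum_intro₂_eq ih₁ ih₂ ih₃
  | sum_elim _ _ _ _ _ _ ih₁ ih₂ ih₃ ih₄ ih₅ ih₆ =>
    simp at ih₁ ih₂ ih₃ ih₄ ih₅ ih₆ ⊢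
    exact .sum_elim ih₁ ih₂ ih₃ ih₄ ih₅ ih₆
  | sum_elim_eq _ _ _ _ _ _ ih₁ ih₂ ih₃ ih₄ ih₅ ih₆ =>
    simp at ih₁ ih₂ ih₃ ih₄ ih₅ ih₆ ⊢
    exact .sum_elim_eq ih₁ ih₂ ih₃ ih₄ ih₅ ih₆
  | sum_comp₁ _ _ _ _ _ _ ih₁ ih₂ ih₃ ih₄ ih₅ ih₆ =>
    simp at ih₁ ih₂ ih₃ ih₄ ih₅ ih₆ ⊢
    exact .sum_comp₁ ih₁ ih₂ ih₃ ih₄ ih₅ ih₆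
  | sum_comp₂ _ _ _ _ _ _ ih₁ ih₂ ih₃ ih₄ ih₅ ih₆ =>
    simp at ih₁ ih₂ ih₃ ih₄ ih₅ ih₆ ⊢
    exact .sum_comp₂ ih₁ ih₂ ih₃ ih₄ ih₅ ih₆
  | empty_form _ _ ih₁ => exact .empty_form _ ih₁
  | empty_elim _ _ ih₁ ih₂ =>
    simp at ih₁ ih₂ ⊢
    exact .empty_elim ih₁ ih₂
  | empty_elim_eq _ _ ih₁ ih₂ =>
    simp at ih₁ ih₂ ⊢
    exact .empty_elim_eq ih₁ ih₂
  | unit_form _ _ ih₁ => exact .unit_form _ ih₁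
  | unit_intro _ ih₁ => exact .unit_intro ih₁
  | unit_elim _ _ _ ih₁ ih₂ ih₃ =>
    simp at ih₁ ih₂ ih₃ ⊢
    exact .unit_elim ih₁ ih₂ ih₃
  | unit_elim_eq _ _ _ ih₁ ih₂ ih₃ =>
    simp at ih₁ ih₂ ih₃ ⊢
    exact .unit_elim_eq ih₁ ih₂ ih₃
  | unit_comp _ _ ih₁ ih₂ =>
    simp at ih₁ ih₂ ⊢
    exact .unit_comp ih₁ ih₂
  | nat_form _ _ ih₁ => exact .nat_form _ ih₁
  | nat_intro₁ _ ih₁ => exact .nat_intro₁ ih₁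
  | nat_intro₂ _ ih₁ => exact .nat_intro₂ ih₁
  | nat_intro₂_eq _ ih₁ => exact .nat_intro₂_eq ih₁
  | nat_elim _ _ _ _ ih₁ ih₂ ih₃ ih₄ =>
    simp at ih₁ ih₂ ih₃ ih₄ ⊢
    exact .nat_elim ih₁ ih₂ ih₃ ih₄
  | nat_elim_eq _ _ _ _ _ ih₁ ih₂ ih₃ ih₄ ih₅ =>
    simp at ih₁ ih₂ ih₃ ih₄ ih₅ ⊢
    exact .nat_elim_eq ih₁ ih₂ ih₃ ih₄ ih₅
  | nat_comp₁ _ _ _ ih₁ ih₂ ih₃ =>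
    simp at ih₁ ih₂ ih₃ ⊢
    exact .nat_comp₁ ih₁ ih₂ ih₃
  | nat_comp₂ _ _ _ _ ih₁ ih₂ ih₃ ih₄ =>
    simp at ih₁ ih₂ ih₃ ih₄ ⊢
    exact .nat_comp₂ ih₁ ih₂ ih₃ ih₄
  | path_form _ _ _ ih₁ ih₂ ih₃ => exact .path_form ih₁ ih₂ ih₃
  | path_form_eq _ _ _ ih₁ ih₂ ih₃ => exact .path_form_eq ih₁ ih₂ ih₃
  | path_intro _ _ ih₁ ih₂ => exact .path_intro ih₁ ih₂
  | path_intro_eq _ _ ih₁ ih₂ => exact .path_intro_eq ih₁ ih₂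
  | path_elim _ _ _ _ _ _ ih₁ ih₂ ih₃ ih₄ ih₅ ih₆ =>
    simp at ih₁ ih₂ ih₃ ih₄ ih₅ ih₆ ⊢
    exact .path_elim ih₁ ih₂ ih₃ ih₄ ih₅ ih₆
  | path_elim_eq _ _ _ _ _ _ ih₁ ih₂ ih₃ ih₄ ih₅ ih₆ =>
    simp at ih₁ ih₂ ih₃ ih₄ ih₅ ih₆ ⊢
    exact .path_elim_eq ih₁ ih₂ ih₃ ih₄ ih₅ ih₆
  | path_comp _ _ _ _ ih₁ ih₂ ih₃ ih₄ =>
    simp at ih₁ ih₂ ih₃ ih₄ ⊢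
    exact .path_comp ih₁ ih₂ ih₃ ih₄
  | univalence _ _ ih₁ ih₂ =>
    simp at ih₁ ih₂ ⊢
    exact .univalence ih₁ ih₂
  | univalence_eq _ _ _ _ ih₁ ih₂ ih₃ ih₄ =>
    simp at ih₁ ih₂ ih₃ ih₄ ⊢
    exact .univalence_eq ih₁ ih₂ ih₃ ih₄

theorem IsInhabited.shift {A : Tm} (n : ℕ) (h : IsInhabited A) : IsInhabited (A.shift n) :=
  have ⟨_, ht⟩ := h
  ⟨_, ht.shift n⟩

end MLTT

/-! ### Proofs inside the object theory. -/

set_option linter.unusedVariables false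

namespace MLTT

/-! ### A typed notation for raw terms -/

/-- A term that can be placed under any number of binders: the argument is that number. -/
structure Scoped where
  run : ℕ → Tm

/-- A term with its intended type. The type guides elaboration only; it is the type checker that
decides. -/
structure El (A : Scoped) where
  tm : Scoped

/-- Change of the intended type, to a judgmentally equal one. -/
def El.cast {A B : Scoped} (a : El A) : El B := ⟨a.tm⟩

/-- The variable bound under `d` binders. -/
def bound (A : Scoped) (d : ℕ) : El A := ⟨⟨fun d' => .var (d' - (d + 1))⟩⟩

namespace Scoped

-- Irreducibility, here and below, keeps the elaborator from unfolding types to raw syntax during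
-- unification. The kernel, which runs the checker, unfolds them all the same.
@[irreducible] def Univ (i : ℕ) : Scoped := ⟨fun _ => .univ i⟩

@[irreducible] def Pi (A : Scoped) (B : El A → Scoped) : Scoped :=
  ⟨fun d => .pi (A.run d) ((B (bound A d)).run (d + 1))⟩

@[irreducible] def Sig (A : Scoped) (B : El A → Scoped) : Scoped :=
  ⟨fun d => .sigma (A.run d) ((B (bound A d)).run (d + 1))⟩

@[irreducible] def Empty : Scoped := ⟨fun _ => .empty⟩

@[irreducible] def Nat : Scoped := ⟨fun _ => .nat⟩

@[irreducible] def Id (A : Scoped) (a b : El A) : Scoped :=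
  ⟨fun d => .path (A.run d) (a.tm.run d) (b.tm.run d)⟩

abbrev Arrow (A B : Scoped) : Scoped := Pi A fun _ => B

abbrev Prod (A B : Scoped) : Scoped := Sig A fun _ => B

/-- Quantification over the types of a universe. -/
abbrev All (j : ℕ) (B : Scoped → Scoped) : Scoped := Pi (Univ j) fun A => B A.tm

/-- Quantification over type families. -/
abbrev AllF (A : Scoped) (j : ℕ) (B : (El A → Scoped) → Scoped) : Scoped :=
  Pi (Arrow A (Univ j)) fun P => B fun x => ⟨fun d => .app (P.tm.run d) (x.tm.run d)⟩

end Scoped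
open Scoped

infixr:25 " ⇒ " => Scoped.Arrow

@[irreducible] def lam {A : Scoped} {B : El A → Scoped} (b : (x : El A) → El (B x)) : El (Pi A B) :=
  ⟨⟨fun d => .lam (A.run d) ((b (bound A d)).tm.run (d + 1))⟩⟩

@[irreducible] def app {A : Scoped} {B : El A → Scoped} (f : El (Pi A B)) (a : El A) : El (B a) :=
  ⟨⟨fun d => .app (f.tm.run d) (a.tm.run d)⟩⟩

infixl:90 " ⬝ " => app

@[irreducible] def lamT {j : ℕ} {B : Scoped → Scoped} (b : (A : Scoped) → El (B A)) :
    El (All j B) :=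
  ⟨⟨fun d => .lam (.univ j) ((b (bound (Univ j) d).tm).tm.run (d + 1))⟩⟩

@[irreducible] def appT {j : ℕ} {B : Scoped → Scoped} (f : El (All j B)) (A : Scoped) : El (B A) :=
  ⟨⟨fun d => .app (f.tm.run d) (A.run d)⟩⟩

infixl:90 " ⬝ₜ " => appT

-- A bound family is presented as a Lean function, by applying the variable; `appF` conversely
-- abstracts a Lean function to a λ. The β-redexes that arise are left to the checker.
@[irreducible] def lamF {A : Scoped} {j : ℕ} {B : (El A → Scoped) → Scoped}
    (b : (P : El A → Scoped) → El (B P)) : El (AllF A j B) :=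
  ⟨⟨fun d => .lam (Arrow A (Univ j) |>.run d)
    ((b fun x => ⟨fun d' => .app (.var (d' - (d + 1))) (x.tm.run d')⟩).tm.run (d + 1))⟩⟩

@[irreducible] def appF {A : Scoped} {j : ℕ} {B : (El A → Scoped) → Scoped} (f : El (AllF A j B))
    (P : El A → Scoped) : El (B P) :=
  ⟨⟨fun d => .app (f.tm.run d) (.lam (A.run d) ((P (bound A d)).run (d + 1)))⟩⟩

infixl:90 " ⬝ᶠ " => appF

@[irreducible] def pair {A : Scoped} {B : El A → Scoped} (a : El A) (b : El (B a)) :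
    El (Sig A B) :=
  ⟨⟨fun d => .pair (a.tm.run d) (b.tm.run d)⟩⟩

-- The motive `.empty` is a dummy: the checker recognizes the branch and rebuilds the motive.
@[irreducible] def fst {A : Scoped} {B : El A → Scoped} (p : El (Sig A B)) : El A :=
  ⟨⟨fun d => .sigmaInd .empty (.var 1) (p.tm.run d)⟩⟩

@[irreducible] def snd {A : Scoped} {B : El A → Scoped} (p : El (Sig A B)) : El (B (fst p)) :=
  ⟨⟨fun d => .sigmaInd .empty (.var 0) (p.tm.run d)⟩⟩

@[irreducible] def sigInd {A : Scoped} {B : El A → Scoped} (C : El (Sig A B) → Scoped)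
    (g : (a : El A) → (b : El (B a)) → El (C (pair a b))) (p : El (Sig A B)) : El (C p) :=
  ⟨⟨fun d => .sigmaInd ((C (bound _ d)).run (d + 1))
    ((g (bound _ d) (bound _ (d + 1))).tm.run (d + 2)) (p.tm.run d)⟩⟩

@[irreducible] def refl {A : Scoped} (a : El A) : El (Id A a a) := ⟨⟨fun d => .refl (a.tm.run d)⟩⟩

@[irreducible] def J {A : Scoped} (C : (x y : El A) → El (Id A x y) → Scoped)
    (c : (x : El A) → El (C x x (refl x))) {a b : El A} (p : El (Id A a b)) : El (C a b p) :=
  ⟨⟨fun d => .pathInd ((C (bound _ d) (bound _ (d + 1)) (bound _ (d + 2))).run (d + 3))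
    ((c (bound _ d)).tm.run (d + 1)) (a.tm.run d) (b.tm.run d) (p.tm.run d)⟩⟩

@[irreducible] def emptyInd (C : El Empty → Scoped) (e : El Empty) : El (C e) :=
  ⟨⟨fun d => .emptyInd ((C (bound _ d)).run (d + 1)) (e.tm.run d)⟩⟩

@[irreducible] def zero : El Nat := ⟨⟨fun _ => .zero⟩⟩

@[irreducible] def succ (n : El Nat) : El Nat := ⟨⟨fun d => .succ (n.tm.run d)⟩⟩

@[irreducible] def natInd (C : El Nat → Scoped) (z : El (C zero))
    (s : (n : El Nat) → El (C n) → El (C (succ n))) (n : El Nat) : El (C n) :=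
  ⟨⟨fun d => .natInd ((C (bound _ d)).run (d + 1)) (z.tm.run d)
    ((s (bound _ d) (bound _ (d + 1))).tm.run (d + 2)) (n.tm.run d)⟩⟩

/-- Annotation of a term that is checked but whose type cannot be inferred. -/
@[irreducible] def ascribe {A : Scoped} (a : El A) : El A :=
  ⟨⟨fun d => .app (.lam (A.run d) (.var 0)) (a.tm.run d)⟩⟩

/-! ### Paths and equivalences -/

section Paths

variable {A B : Scoped}

def ap (f : El A → El B) {a b : El A} (p : El (Id A a b)) : El (Id B (f a) (f b)) :=
  J (fun x y _ => Id B (f x) (f y)) (fun x => refl (f x)) p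

def transport (P : El A → Scoped) {a b : El A} (p : El (Id A a b)) (u : El (P a)) : El (P b) :=
  J (fun x y _ => P x ⇒ P y) (fun _ => lam fun u => u) p ⬝ u

def sym {a b : El A} (p : El (Id A a b)) : El (Id A b a) :=
  J (fun x y _ => Id A y x) (fun x => refl x) p

/-- Defined by transport along the second path, so a reflexivity on the right disappears by
computation; on the left it needs `transUnit`. -/
def trans {a b c : El A} (p : El (Id A a b)) (q : El (Id A b c)) : El (Id A a c) :=
  transport (fun x => Id A a x) q p

/-- Path induction with a fixed endpoint. -/
def basedJ {a : El A} (C : (x : El A) → El (Id A a x) → Scoped) (c : El (C a (refl a))) {b : El A}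
    (p : El (Id A a b)) : El (C b p) :=
  -- Ordinary path induction connects `(a, refl)` to `(b, p)` in the type of paths from `a`, and `C`
  -- is transported along that path.
  (transport (A := Sig A fun x => Id A a x) (a := pair a (refl a)) (b := pair b p)
    (fun z => C (fst z) (snd z))
    (J (fun x y p => Id (Sig A fun z => Id A x z) (pair x (refl x)) (pair y p))
      (fun x => refl (pair x (refl x))) p) c.cast).cast

abbrev IsContr (A : Scoped) : Scoped := Sig A fun a => Pi A fun x => Id A a x

abbrev IsEquiv (A B : Scoped) (f : El (A ⇒ B)) : Scoped :=
  Prod (Sig (B ⇒ A) fun g => Pi B fun b => Id B (f ⬝ (g ⬝ b)) b)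
    (Sig (B ⇒ A) fun g => Pi A fun a => Id A (g ⬝ (f ⬝ a)) a)

abbrev Equiv (A B : Scoped) : Scoped := Sig (A ⇒ B) fun f => IsEquiv A B f

def isEquivOf {f : El (A ⇒ B)} (g : El (B ⇒ A)) (s : El (Pi B fun b => Id B (f ⬝ (g ⬝ b)) b))
    (r : El (Pi A fun a => Id A (g ⬝ (f ⬝ a)) a)) : El (IsEquiv A B f) :=
  pair (pair g s) (pair g r)

def idIsEquiv (A : Scoped) : El (IsEquiv A A (lam fun x => x)) :=
  isEquivOf (lam fun x => x) (lam fun x => (refl x).cast) (lam fun x => (refl x).cast)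

def idEquiv (A : Scoped) : El (Equiv A A) := pair (lam fun x => x) (idIsEquiv A)

def idToEquiv {i : ℕ} {A B : Scoped} (p : El (Id (Univ i) ⟨A⟩ ⟨B⟩)) : El (Equiv A B) :=
  J (fun X Y _ => Equiv X.tm Y.tm) (fun X => idEquiv X.tm) p

end Paths
end MLTT

namespace MLTT
open Scoped

/-! ### Univalence, equivalence induction, function extensionality -/

abbrev Univalence (j : ℕ) : Scoped := All j fun A => All j fun B =>
  IsEquiv (Id (Univ j) ⟨A⟩ ⟨B⟩) (Equiv A B) (lam fun p => idToEquiv p)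

/-- The conversion test of the checker has no η, so η is used propositionally, as a hypothesis. -/
abbrev Eta (j : ℕ) : Scoped := All j fun A => AllF A j fun B => Pi (Pi A B) fun f =>
  Id (Pi A B) f (lam fun x => f ⬝ x)

/-- Induction on equivalences with a fixed codomain. -/
abbrev EquivInduction (j : ℕ) : Scoped := All j fun Z =>
  Pi (Pi (Univ j) fun X => Equiv X.tm Z ⇒ Univ (j + 1)) fun C =>
  (C ⬝ ⟨Z⟩ ⬝ (idEquiv Z)).tm ⇒ All j fun X => Pi (Equiv X Z) fun e => (C ⬝ ⟨X⟩ ⬝ e).tm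

/-- Univalence replaces `e` by `idToEquiv p` for some path `p`, where path induction applies; the
result is transported back along `idToEquiv p = e`. Only the right inverse from univalence is used.
As the endpoint varies in the path induction, `C` is quantified inside its motive. -/
def equivInduction (j : ℕ) : El (Univalence j ⇒ EquivInduction j) :=
  lam fun ua => lamT fun Z => lam fun C => lam fun c => lamT fun X => lam fun e =>
  transport (fun e => (C ⬝ ⟨X⟩ ⬝ e).tm) (snd (fst (ua ⬝ₜ X ⬝ₜ Z)) ⬝ e)
    ((J (fun X Z p => Pi (Pi (Univ j) fun X => Equiv X.tm Z.tm ⇒ Univ (j + 1)) fun C =>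
        (C ⬝ Z ⬝ (idEquiv Z.tm)).tm ⇒ (C ⬝ X ⬝ (idToEquiv p)).tm)
      (fun _ => lam fun _ => lam fun c => c.cast) (fst (fst (ua ⬝ₜ X ⬝ₜ Z)) ⬝ e)) ⬝ C ⬝ c).cast

def El.equivInd {j : ℕ} (ei : El (EquivInduction j)) {Z : Scoped}
    (C : (X : Scoped) → El (Equiv X Z) → Scoped) (c : El (C Z (idEquiv Z))) {X : Scoped}
    (e : El (Equiv X Z)) : El (C X e) :=
  (ei ⬝ₜ Z ⬝ (lam fun X => lam fun e => ⟨C X.tm e⟩) ⬝ c.cast ⬝ₜ X ⬝ e).cast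

def symTrans {A : Scoped} {a b : El A} (p : El (Id A a b)) :
    El (Id (Id A b b) (trans (sym p) p) (refl b)) :=
  J (fun _ y p => Id (Id A y y) (trans (sym p) p) (refl y)) (fun x => (refl (refl x)).cast) p

/-- A fibrewise map out of an identity type, into a family with contractible total space, is an
equivalence. -/
abbrev FundamentalThm (j : ℕ) : Scoped := All j fun A => Pi A fun a => AllF A j fun P =>
  Pi (Pi A fun x => Id A a x ⇒ P x) fun φ => IsContr (Sig A P) ⇒
  Pi A fun x => IsEquiv (Id A a x) (P x) (φ ⬝ x)

/-- The inverse sends `y : P x` to the projection to `A` of a path from `(a, φ refl)` to `(x, y)` in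
the contractible total space. Both homotopies follow by induction on paths from a fixed endpoint. -/
def fundamentalThm (j : ℕ) : El (FundamentalThm j) :=
  lamT fun A => lam fun a => lamF fun P => lam fun φ => lam fun h =>
  let ctr : El (Sig A P) := ascribe (pair a (φ ⬝ a ⬝ refl a))
  -- The correction by the inverse path makes `c` trivial at `ctr`, by `symTrans`; this settles the
  -- reflexivity case of the last homotopy.
  let c (z : El (Sig A P)) : El (Id (Sig A P) ctr z) := trans (sym (snd h ⬝ ctr)) (snd h ⬝ z)
  let back (z : El (Sig A P)) (q : El (Id (Sig A P) ctr z)) : El (Id A a (fst z)) :=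
    transport (fun z => Id A a (fst z)) q (refl a).cast
  lam fun x => isEquivOf (lam fun y => (back (pair x y) (c (pair x y))).cast)
    (lam fun y => (basedJ (fun z q => Id (P (fst z)) (φ ⬝ fst z ⬝ back z q) (snd z))
      (refl (φ ⬝ a ⬝ refl a)).cast (c (pair x y))).cast)
    (lam fun p => (basedJ (fun x p => Id (Id A a x)
      (back (pair x (φ ⬝ x ⬝ p)) (c (pair x (φ ⬝ x ⬝ p)))).cast p)
      (ap (fun q => back ctr q) (symTrans (snd h ⬝ ctr))).cast p).cast)

def El.fundamental {j : ℕ} (ft : El (FundamentalThm j)) {A : Scoped} (a : El A) (P : El A → Scoped)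
    (φ : (x : El A) → El (Id A a x) → El (P x)) (c : El (IsContr (Sig A P))) (x : El A) :
    El (IsEquiv (Id A a x) (P x) (lam fun p => φ x p)) :=
  (ft ⬝ₜ A ⬝ a ⬝ᶠ P ⬝ (lam fun x => lam fun p => φ x p) ⬝ c ⬝ x).cast

abbrev FibersContr (j : ℕ) : Scoped := All j fun X => All j fun Z => Pi (Equiv X Z) fun e =>
  Pi Z fun z => IsContr (Sig X fun x => Id Z (fst e ⬝ x) z)

/-- The space of points with a path to a given one is contractible. -/
def singletonContr {A : Scoped} (a : El A) : El (IsContr (Sig A fun x => Id A x a)) :=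
  pair (pair a (refl a)) (lam fun w =>
    sigInd (fun w => Id (Sig A fun x => Id A x a) (pair a (refl a)) w) (fun _ p =>
      J (fun x a p => Id (Sig A fun x => Id A x a) (pair a (refl a)) (pair x p))
        (fun x => (refl (pair x (refl x))).cast) p) w)

/-- The space of points with a path from a given one is contractible. -/
def singletonContr' {A : Scoped} (a : El A) : El (IsContr (Sig A fun x => Id A a x)) :=
  pair (pair a (refl a)) (lam fun w =>
    sigInd (fun w => Id (Sig A fun x => Id A a x) (pair a (refl a)) w) (fun _ p =>
      J (fun a x p => Id (Sig A fun x => Id A a x) (pair a (refl a)) (pair x p))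
        (fun x => (refl (pair x (refl x))).cast) p) w)

/-- For the identity equivalence the fibre over `z` is the space of points with a path to `z`. -/
def fibersContr (j : ℕ) : El (EquivInduction j ⇒ FibersContr j) :=
  lam fun ei => lamT fun X => lamT fun Z => lam fun e =>
  ei.equivInd (fun X e => Pi Z fun z => IsContr (Sig X fun x => Id Z (fst e ⬝ x) z))
    (lam fun z => (singletonContr z).cast) e

abbrev PostComp (j : ℕ) : Scoped := All j fun X => All j fun Z => Pi (Equiv X Z) fun e =>
  All j fun A => IsEquiv (A ⇒ X) (A ⇒ Z) (lam fun g => lam fun x => fst e ⬝ (g ⬝ x))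

/-- By equivalence induction the equivalence may be taken to be the identity. Postcomposition with
it is η-expansion, which `Eta` identifies with the identity. -/
def postComp (j : ℕ) : El (Eta j ⇒ EquivInduction j ⇒ PostComp j) :=
  lam fun eta => lam fun ei => lamT fun X => lamT fun Z => lam fun e => lamT fun A =>
  ei.equivInd (fun X e => IsEquiv (A ⇒ X) (A ⇒ Z) (lam fun g => lam fun x => fst e ⬝ (g ⬝ x)))
    (isEquivOf (lam fun g => g) (lam fun g => (sym (eta ⬝ₜ A ⬝ᶠ (fun _ => Z) ⬝ g.cast)).cast)
      (lam fun g => (sym (eta ⬝ₜ A ⬝ᶠ (fun _ => Z) ⬝ g.cast)).cast)) e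

abbrev ProjEquiv (j : ℕ) : Scoped := All j fun A => AllF A j fun P =>
  (Pi A fun x => IsContr (P x)) ⇒ IsEquiv (Sig A P) A (lam fun z => fst z)

def projEquiv (j : ℕ) : El (ProjEquiv j) :=
  lamT fun A => lamF fun P => lam fun c =>
  isEquivOf (lam fun a => pair a (fst (c ⬝ a))) (lam fun a => (refl a).cast)
    (lam fun z => sigInd (fun z => Id (Sig A P) (pair (fst z) (fst (c ⬝ fst z))) z)
      (fun a u => (ap (fun u => pair a u) (snd (c ⬝ a) ⬝ u)).cast) z).cast

/-- The sections of the first projection of `Σ A P`. -/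
abbrev Sections (A : Scoped) (P : El A → Scoped) : Scoped :=
  Sig (A ⇒ Sig A P) fun g => Id (A ⇒ A) (lam fun x => fst (g ⬝ x)) (lam fun x => x)

abbrev SectionsRetract (j : ℕ) : Scoped := All j fun A => AllF A j fun P =>
  IsContr (Sections A P) ⇒ IsContr (Pi A P)

/-- `Π A P` is a retract of the type of sections up to a path: `graph` includes it, `back`
transports the values along the path, and `back (graph f)` is the η-expansion of `f`. -/
def sectionsRetract (j : ℕ) : El (Eta j ⇒ SectionsRetract j) :=
  lam fun eta => lamT fun A => lamF fun P => lam fun c =>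
  let back (z : El (Sections A P)) : El (Pi A P) :=
    lam fun x => transport P (ap (fun h => h ⬝ x) (snd z)).cast (snd (fst z ⬝ x))
  let graph (f : El (Pi A P)) : El (Sections A P) :=
    ascribe (pair (lam fun x => pair x (f ⬝ x)) (refl (A := A ⇒ A) (lam fun x => x)).cast)
  let unexpand (f : El (Pi A P)) : El (Id (Pi A P) (back (graph f)) f) :=
    (sym (eta ⬝ₜ A ⬝ᶠ P ⬝ f)).cast
  pair (back (fst c)) (lam fun f => trans (ap back (snd c ⬝ graph f)) (unexpand f))

abbrev WeakFunext (j : ℕ) : Scoped := All j fun A => AllF A j fun P =>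
  (Pi A fun x => IsContr (P x)) ⇒ IsContr (Pi A P)

/-- Voevodsky's argument. If all `P x` are contractible, the projection `Σ A P → A` is an
equivalence, hence so is postcomposition with it. Its fibre over the identity of `A` is `Sections A
P`, which is therefore contractible and has `Π A P` as a retract. -/
def weakFunext (j : ℕ) :
    El (FibersContr j ⇒ PostComp j ⇒ ProjEquiv j ⇒ SectionsRetract j ⇒ WeakFunext j) :=
  lam fun fc => lam fun pc => lam fun pe => lam fun sr => lamT fun A => lamF fun P => lam fun c =>
  sr ⬝ₜ A ⬝ᶠ P ⬝ (fc ⬝ₜ (A ⇒ Sig A P) ⬝ₜ (A ⇒ A) ⬝ (pair (lam fun g => lam fun x => fst (g ⬝ x))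
      (pc ⬝ₜ (Sig A P) ⬝ₜ A ⬝ (pair (lam fun z => fst z) (pe ⬝ₜ A ⬝ᶠ P ⬝ c)) ⬝ₜ A).cast) ⬝
    (lam fun x => x)).cast

/-- A type-theoretic choice principle: if every fibre of `R` is contractible then so is the type of
functions that satisfy `R` pointwise. -/
abbrev ChoiceContr (j : ℕ) : Scoped := All j fun A => AllF A j fun B =>
  Pi (Pi A fun x => B x ⇒ Univ j) fun R =>
  IsContr (Pi A fun x => Sig (B x) fun u => (R ⬝ x ⬝ u).tm) ⇒
  IsContr (Sig (Pi A B) fun g => Pi A fun x => (R ⬝ x ⬝ (g ⬝ x)).tm)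

/-- The type of pairs `(g, h)` is a retract of the type of functions into the pointwise pairs, up to
η for `g` and for `h`. The type of `h` depends on `g`, so η for `g` is applied by transport, in
`unexpand`. -/
def choiceContr (j : ℕ) : El (Eta j ⇒ ChoiceContr j) :=
  lam fun eta => lamT fun A => lamF fun B => lam fun R => lam fun k =>
  let T : Scoped := Sig (Pi A B) fun g => Pi A fun x => (R ⬝ x ⬝ (g ⬝ x)).tm
  let K : Scoped := Pi A fun x => Sig (B x) fun u => (R ⬝ x ⬝ u).tm
  let back (k : El K) : El T := pair (lam fun x => fst (k ⬝ x)) (lam fun x => (snd (k ⬝ x)).cast)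
  let expand (g : El (Pi A B)) : El (Id (Pi A B) (lam fun x => g ⬝ x) g) := sym (eta ⬝ₜ A ⬝ᶠ B ⬝ g)
  let expand' (g : El (Pi A B)) (h : El (Pi A fun x => (R ⬝ x ⬝ (g ⬝ x)).tm)) :
      El (Id (Pi A fun x => (R ⬝ x ⬝ (g ⬝ x)).tm) (lam fun x => h ⬝ x) h) :=
    sym (eta ⬝ₜ A ⬝ᶠ (fun x => (R ⬝ x ⬝ (g ⬝ x)).tm) ⬝ h)
  let unexpand (g : El (Pi A B)) : El (Pi (Pi A fun x => (R ⬝ x ⬝ (g ⬝ x)).tm) fun h =>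
      Id T (pair (lam fun x => g ⬝ x) (lam fun x => (h ⬝ x).cast)) (pair g h)) :=
    transport (fun g => Pi (Pi A fun x => (R ⬝ x ⬝ (g ⬝ x)).tm) fun h =>
        Id T (pair (lam fun x => g ⬝ x) (lam fun x => (h ⬝ x).cast)) (pair g h)) (expand g)
      (lam fun h => (ap (B := T) (fun h => pair (lam fun x => g ⬝ x) h.cast)
        (expand' g h.cast)).cast)
  let zip (g : El (Pi A B)) (h : El (Pi A fun x => (R ⬝ x ⬝ (g ⬝ x)).tm)) : El K :=
    ascribe (lam fun x => pair (g ⬝ x) (h ⬝ x))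
  pair (back (fst k)) (lam fun w => sigInd (fun w => Id T (back (fst k)) w) (fun g h =>
    trans (ap back (snd k ⬝ zip g h)) (unexpand g ⬝ h).cast) w)

def El.choice {j : ℕ} (cc : El (ChoiceContr j)) (wf : El (WeakFunext j)) {A : Scoped}
    {B : El A → Scoped}
    (R : (x : El A) → El (B x) → Scoped) (c : (x : El A) → El (IsContr (Sig (B x) (R x)))) :
    El (IsContr (Sig (Pi A B) fun g => Pi A fun x => R x (g ⬝ x))) :=
  (cc ⬝ₜ A ⬝ᶠ B ⬝ (lam fun x => lam fun u => ⟨R x u⟩) ⬝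
    (wf ⬝ₜ A ⬝ᶠ (fun x => Sig (B x) (R x)) ⬝ (lam fun x => c x)).cast).cast

abbrev Funext (j : ℕ) : Scoped := All j fun A => AllF A j fun B => Pi (Pi A B) fun f =>
  Pi (Pi A B) fun g => IsEquiv (Id (Pi A B) f g) (Pi A fun x => Id (B x) (f ⬝ x) (g ⬝ x))
    (lam fun p => lam fun x => ap (fun h => h ⬝ x) p)

/-- By the fundamental theorem it is enough that the functions with a homotopy from `f` form a
contractible type, and by choice this reduces to singletons at each point. -/
def funext (j : ℕ) : El (FundamentalThm j ⇒ WeakFunext j ⇒ ChoiceContr j ⇒ Funext j) :=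
  lam fun ft => lam fun wf => lam fun cc => lamT fun A => lamF fun B => lam fun f => lam fun g =>
  ft.fundamental f (fun g => Pi A fun x => Id (B x) (f ⬝ x) (g ⬝ x))
    (fun g p => lam fun x => ap (fun h => h ⬝ x) p)
    (cc.choice wf (fun x u => Id (B x) (f ⬝ x) u) (fun x => singletonContr' (f ⬝ x))) g

end MLTT

namespace MLTT
open Scoped

/-! ### Homotopy levels -/

/-- The internal version of `Tm.hasHLevel`, for types in `U_j`. -/
@[irreducible] def HLevel (j : ℕ) (n : El Nat) (A : Scoped) : Scoped :=
  (natInd (fun _ => Univ j ⇒ Univ j) (lam fun A => ⟨IsContr A.tm⟩)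
    (fun _ H => lam fun A => ⟨Pi A.tm fun x => Pi A.tm fun y => (H ⬝ ⟨Id A.tm x y⟩).tm⟩) n ⬝
      ⟨A⟩).tm

section
variable {j : ℕ} {n : El Nat} {A : Scoped}

def El.contr (h : El (HLevel j zero A)) : El (IsContr A) := h.cast

def El.ofContr (h : El (IsContr A)) : El (HLevel j zero A) := h.cast

def paths (h : El (HLevel j (succ n) A)) (x y : El A) : El (HLevel j n (Id A x y)) :=
  app (A := A) (B := fun y => HLevel j n (Id A x y))
    (app (A := A) (B := fun x => Pi A fun y => HLevel j n (Id A x y)) h.cast x) y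

def ofPaths (h : (x y : El A) → El (HLevel j n (Id A x y))) : El (HLevel j (succ n) A) :=
  (lam fun x => lam fun y => h x y).cast

end

abbrev HLevelTransfer (j : ℕ) : Scoped := Pi Nat fun n => All j fun X => All j fun Z =>
  Equiv X Z ⇒ HLevel j n Z ⇒ HLevel j n X

def hLevelTransfer (j : ℕ) : El (EquivInduction j ⇒ HLevelTransfer j) :=
  lam fun ei => lam fun n => lamT fun X => lamT fun Z => lam fun e =>
  ei.equivInd (fun X _ => HLevel j n Z ⇒ HLevel j n X) (lam fun h => h) e

abbrev HLevelPath (j : ℕ) : Scoped := Pi Nat fun n => All j fun A => HLevel j n A ⇒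
  Pi A fun x => Pi A fun y => HLevel j n (Id A x y)

def hLevelPath (j : ℕ) : El (HLevelPath j) :=
  lam fun n => natInd (fun n => All j fun A => HLevel j n A ⇒
      Pi A fun x => Pi A fun y => HLevel j n (Id A x y))
    (lamT fun A => lam fun h => lam fun x => lam fun y =>
      let c (x : El A) : El (Id A (fst h.contr) x) := snd h.contr ⬝ x
      El.ofContr (pair (trans (sym (c x)) (c y)) (lam fun p =>
        J (fun x y p => Id (Id A x y) (trans (sym (c x)) (c y)) p) (fun x => symTrans (c x)) p)))
    (fun n ih => lamT fun A => lam fun h => lam fun x => lam fun y => ofPaths fun p q =>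
      ih ⬝ₜ (Id A x y) ⬝ (paths h x y) ⬝ p ⬝ q) n

/-- The pairs `(v, p, t)` of a point `v` of `Σ A B` and of the components of a path from `(a, b)`
to `v`. -/
abbrev PathPairs {A : Scoped} (B : El A → Scoped) (a : El A) (b : El (B a)) : Scoped :=
  Sig (Sig A B) fun v => Sig (Id A a (fst v)) fun p => Id (B (fst v)) (transport B p b) (snd v)

abbrev PathPairsContr (j : ℕ) : Scoped := All j fun A => AllF A j fun B => Pi A fun a =>
  Pi (B a) fun b => IsContr (PathPairs B a b)

/-- Both paths have a free endpoint, so induction on `p` and then on `t` contracts everything to the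
centre. The rest unpacks nested pairs. -/
def pathPairsContr (j : ℕ) : El (PathPairsContr j) :=
  lamT fun A => lamF fun B =>
  let mk (a : El A) (b : El (B a)) (a' : El A) (b' : El (B a')) (p : El (Id A a a'))
      (t : El (Id (B a') (transport B p b) b')) : El (PathPairs B a b) :=
    pair (pair a' b') (pair p.cast t.cast)
  let center (a : El A) (b : El (B a)) : El (PathPairs B a b) := mk a b a b (refl a) (refl b).cast
  let contract (a : El A) (a' : El A) (p : El (Id A a a')) : El (Pi (B a) fun b =>
      Pi (B a') fun b' => Pi (Id (B a') (transport B p b) b') fun t =>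
      Id (PathPairs B a b) (center a b) (mk a b a' b' p t)) :=
    J (fun a a' p => Pi (B a) fun b => Pi (B a') fun b' =>
        Pi (Id (B a') (transport B p b) b') fun t =>
        Id (PathPairs B a b) (center a b) (mk a b a' b' p t))
      (fun a => lam fun b => lam fun b' => lam fun t =>
        (J (fun b b' t => Id (PathPairs B a b) (center a b) (mk a b a b' (refl a) t.cast))
          (fun b => refl (center a b)) (a := b) (b := b') t.cast).cast) p
  lam fun a => lam fun b => pair (center a b) (lam fun w =>
    sigInd (fun w => Id (PathPairs B a b) (center a b) w) (fun v z =>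
      sigInd (fun v => Pi (Sig (Id A a (fst v)) fun p => Id (B (fst v)) (transport B p b) (snd v))
          fun z => Id (PathPairs B a b) (center a b) (pair v z))
        (fun a' b' => lam fun z =>
          (sigInd (A := Id A a a') (B := fun p => Id (B a') (transport B p b) b')
            (fun z => Id (PathPairs B a b) (center a b) (pair (pair a' b') z.cast))
            (fun p t => (contract a a' p ⬝ b ⬝ b' ⬝ t).cast) z.cast).cast) v ⬝ z) w)

/-- The components of a path in `Σ A B`. -/
def pathPair {A : Scoped} {B : El A → Scoped} {u v : El (Sig A B)} (r : El (Id (Sig A B) u v)) :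
    El (Sig (Id A (fst u) (fst v)) fun p => Id (B (fst v)) (transport B p (snd u)) (snd v)) :=
  ascribe (pair (ap (fun w => fst w) r)
    (J (fun u v r => Id (B (fst v)) (transport B (ap (fun w => fst w) r) (snd u)) (snd v))
      (fun u => (refl (snd u)).cast) r))

abbrev PathSigma (j : ℕ) : Scoped := All j fun A => AllF A j fun B => Pi (Sig A B) fun u =>
  Pi (Sig A B) fun v => IsEquiv (Id (Sig A B) u v)
    (Sig (Id A (fst u) (fst v)) fun p => Id (B (fst v)) (transport B p (snd u)) (snd v))
    (lam fun r => pathPair r)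

def pathSigma (j : ℕ) : El (FundamentalThm j ⇒ PathPairsContr j ⇒ PathSigma j) :=
  lam fun ft => lam fun pp => lamT fun A => lamF fun B => lam fun u => lam fun v =>
  ft.fundamental u
    (fun v => Sig (Id A (fst u) (fst v)) fun p => Id (B (fst v)) (transport B p (snd u)) (snd v))
    (fun v r => pathPair r) (pp ⬝ₜ A ⬝ᶠ B ⬝ fst u ⬝ snd u) v

abbrev HLevelSigma (j : ℕ) : Scoped := Pi Nat fun n => All j fun A => AllF A j fun B =>
  HLevel j n A ⇒ (Pi A fun x => HLevel j n (B x)) ⇒ HLevel j n (Sig A B)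

/-- A path in `Σ A B` is a pair of paths, and the induction hypothesis applies to the type of such
pairs. -/
def hLevelSigma (j : ℕ) : El (HLevelTransfer j ⇒ PathSigma j ⇒ HLevelSigma j) :=
  lam fun tr => lam fun ps => lam fun n => natInd (fun n => All j fun A => AllF A j fun B =>
      HLevel j n A ⇒ (Pi A fun x => HLevel j n (B x)) ⇒ HLevel j n (Sig A B))
    (lamT fun A => lamF fun B => lam fun hA => lam fun hB =>
      let a := fst hA.contr
      let b := fst (hB ⬝ a).contr
      El.ofContr (pair (pair a b) (lam fun w =>
        sigInd (fun w => Id (Sig A B) (pair a b) w) (fun a' b' =>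
          basedJ (fun x _ => Pi (B x) fun y => Id (Sig A B) (pair a b) (pair x y))
            (lam fun y => ap (fun y => pair a y) (snd (hB ⬝ a).contr ⬝ y))
            (snd hA.contr ⬝ a') ⬝ b') w)))
    (fun n ih => lamT fun A => lamF fun B => lam fun hA => lam fun hB => ofPaths fun u v =>
      tr ⬝ n ⬝ₜ (Id (Sig A B) u v) ⬝ₜ
        (Sig (Id A (fst u) (fst v)) fun p => Id (B (fst v)) (transport B p (snd u)) (snd v)) ⬝
        (pair (lam fun r => pathPair r) (ps ⬝ₜ A ⬝ᶠ B ⬝ u ⬝ v)) ⬝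
        (ih ⬝ₜ (Id A (fst u) (fst v)) ⬝ᶠ
          (fun p => Id (B (fst v)) (transport B p (snd u)) (snd v)) ⬝
          (paths hA (fst u) (fst v)) ⬝
          (lam fun p => paths (hB ⬝ fst v) (transport B p (snd u)) (snd v)))) n

abbrev HLevelPi (j : ℕ) : Scoped := Pi Nat fun n => All j fun A => AllF A j fun B =>
  (Pi A fun x => HLevel j n (B x)) ⇒ HLevel j n (Pi A B)

def hLevelPi (j : ℕ) : El (HLevelTransfer j ⇒ WeakFunext j ⇒ Funext j ⇒ HLevelPi j) :=
  lam fun tr => lam fun wf => lam fun fe => lam fun n =>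
  natInd (fun n => All j fun A => AllF A j fun B =>
      (Pi A fun x => HLevel j n (B x)) ⇒ HLevel j n (Pi A B))
    (lamT fun A => lamF fun B => lam fun h => (wf ⬝ₜ A ⬝ᶠ B ⬝ h.cast).ofContr)
    (fun n ih => lamT fun A => lamF fun B => lam fun h => ofPaths fun f g =>
      tr ⬝ n ⬝ₜ (Id (Pi A B) f g) ⬝ₜ (Pi A fun x => Id (B x) (f ⬝ x) (g ⬝ x)) ⬝
        (pair (lam fun p => lam fun x => ap (fun h => h ⬝ x) p) (fe ⬝ₜ A ⬝ᶠ B ⬝ f ⬝ g)) ⬝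
        (ih ⬝ₜ A ⬝ᶠ (fun x => Id (B x) (f ⬝ x) (g ⬝ x)) ⬝
          (lam fun x => paths (h ⬝ x) (f ⬝ x) (g ⬝ x)))) n

abbrev HLevelOfProp (j : ℕ) : Scoped := Pi Nat fun n => All j fun A =>
  HLevel j (succ zero) A ⇒ HLevel j (succ n) A

def hLevelOfProp (j : ℕ) : El (HLevelPath j ⇒ HLevelOfProp j) :=
  lam fun hp => lam fun n =>
  natInd (fun n => All j fun A => HLevel j (succ zero) A ⇒ HLevel j (succ n) A)
    (lamT fun A => lam fun h => h)
    (fun n ih => lamT fun A => lam fun h => (hp ⬝ succ n ⬝ₜ A ⬝ (ih ⬝ₜ A ⬝ h)).cast) n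

abbrev HLevelIsProp (j : ℕ) : Scoped := Pi Nat fun n => All j fun A =>
  HLevel j (succ zero) (HLevel j n A)

/-- To compare two proofs of contractibility one may use the first: once `A` is contractible,
`IsContr A` is built by Σ and Π from contractible types. Successor levels are products of
propositions. -/
def hLevelIsProp (j : ℕ) :
    El (HLevelPath j ⇒ HLevelSigma j ⇒ HLevelPi j ⇒ HLevelIsProp j) :=
  lam fun hp => lam fun hs => lam fun hpi => lam fun n =>
  natInd (fun n => All j fun A => HLevel j (succ zero) (HLevel j n A))
    (lamT fun A => (ofPaths (A := IsContr A) (n := zero) fun c d =>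
      hp ⬝ zero ⬝ₜ (IsContr A) ⬝
        (hs ⬝ zero ⬝ₜ A ⬝ᶠ (fun a => Pi A fun x => Id A a x) ⬝ c.ofContr ⬝ (lam fun a =>
          hpi ⬝ zero ⬝ₜ A ⬝ᶠ (fun x => Id A a x) ⬝ (lam fun x =>
            hp ⬝ zero ⬝ₜ A ⬝ c.ofContr ⬝ a ⬝ x))) ⬝ c ⬝ d).cast)
    (fun n ih => lamT fun A =>
      (hpi ⬝ succ zero ⬝ₜ A ⬝ᶠ (fun x => Pi A fun y => HLevel j n (Id A x y)) ⬝ (lam fun x =>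
        hpi ⬝ succ zero ⬝ₜ A ⬝ᶠ (fun y => HLevel j n (Id A x y)) ⬝ (lam fun y =>
          ih ⬝ₜ (Id A x y)))).cast) n

abbrev HLevelEquiv (j : ℕ) : Scoped := Pi Nat fun n => All j fun A => All j fun B =>
  HLevel j n A ⇒ HLevel j n B ⇒ HLevel j n (Equiv A B)

/-- An equivalence with its two inverses is an iterated Σ of Π-types and paths, so closure under Σ,
Π and paths suffices; it is not needed that being an equivalence is a proposition. -/
def hLevelEquiv (j : ℕ) : El (HLevelPath j ⇒ HLevelSigma j ⇒ HLevelPi j ⇒ HLevelEquiv j) :=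
  lam fun hp => lam fun hs => lam fun hpi => lam fun n => lamT fun A => lamT fun B =>
  lam fun hA => lam fun hB =>
  hs ⬝ n ⬝ₜ (A ⇒ B) ⬝ᶠ (fun f => IsEquiv A B f) ⬝ (hpi ⬝ n ⬝ₜ A ⬝ᶠ (fun _ => B) ⬝ lam fun _ => hB) ⬝
    (lam fun f => hs ⬝ n ⬝ₜ (Sig (B ⇒ A) fun g => Pi B fun b => Id B (f ⬝ (g ⬝ b)) b) ⬝ᶠ
      (fun _ => Sig (B ⇒ A) fun g => Pi A fun a => Id A (g ⬝ (f ⬝ a)) a) ⬝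
      (hs ⬝ n ⬝ₜ (B ⇒ A) ⬝ᶠ (fun g => Pi B fun b => Id B (f ⬝ (g ⬝ b)) b) ⬝
        (hpi ⬝ n ⬝ₜ B ⬝ᶠ (fun _ => A) ⬝ lam fun _ => hA) ⬝
        (lam fun g => hpi ⬝ n ⬝ₜ B ⬝ᶠ (fun b => Id B (f ⬝ (g ⬝ b)) b) ⬝
          lam fun b => hp ⬝ n ⬝ₜ B ⬝ hB ⬝ (f ⬝ (g ⬝ b)) ⬝ b)) ⬝
      (lam fun _ => hs ⬝ n ⬝ₜ (B ⇒ A) ⬝ᶠ (fun g => Pi A fun a => Id A (g ⬝ (f ⬝ a)) a) ⬝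
        (hpi ⬝ n ⬝ₜ B ⬝ᶠ (fun _ => A) ⬝ lam fun _ => hA) ⬝
        (lam fun g => hpi ⬝ n ⬝ₜ A ⬝ᶠ (fun a => Id A (g ⬝ (f ⬝ a)) a) ⬝
          lam fun a => hp ⬝ n ⬝ₜ A ⬝ hA ⬝ (g ⬝ (f ⬝ a)) ⬝ a)))

abbrev HLevelLift (j : ℕ) : Scoped := Pi Nat fun n => All j fun A =>
  HLevel j n A ⇒ HLevel (j + 1) n A

/-- For a variable `n` the recursions at the levels `j` and `j + 1` are different terms that do not
compute, so passing between them takes an induction. -/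
def hLevelLift (j : ℕ) : El (HLevelLift j) :=
  lam fun n => natInd (fun n => All j fun A => HLevel j n A ⇒ HLevel (j + 1) n A)
    (lamT fun A => lam fun h => h.cast)
    (fun n ih => lamT fun A => lam fun h => ofPaths fun x y => ih ⬝ₜ (Id A x y) ⬝ (paths h x y)) n

abbrev HLevelUniv (j : ℕ) : Scoped := Pi Nat fun n => All j fun A => All j fun B =>
  HLevel (j + 1) n A ⇒ HLevel (j + 1) n B ⇒ HLevel (j + 1) n (Id (Univ j) ⟨A⟩ ⟨B⟩)

/-- By univalence the path type is the type of equivalences. It lives one universe higher than `A`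
and `B`, hence the level `j + 1` throughout. -/
def hLevelUniv (j : ℕ) :
    El (Univalence j ⇒ HLevelTransfer (j + 1) ⇒ HLevelEquiv (j + 1) ⇒ HLevelUniv j) :=
  lam fun ua => lam fun tr => lam fun he => lam fun n => lamT fun A => lamT fun B =>
  lam fun hA => lam fun hB =>
  tr ⬝ n ⬝ₜ (Id (Univ j) ⟨A⟩ ⟨B⟩) ⬝ₜ (Equiv A B) ⬝
    (pair (lam fun p => idToEquiv p) (ua ⬝ₜ A ⬝ₜ B)) ⬝ (he ⬝ n ⬝ₜ A ⬝ₜ B ⬝ hA ⬝ hB)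

end MLTT

namespace MLTT
open Scoped

/-! ### Iterated loop spaces -/

/-- The `n`-fold loop space of `X` at `x`, for `X` in `U_j`. -/
@[irreducible] def Loop (j : ℕ) (n : El Nat) (X : Scoped) (x : El X) : Scoped :=
  (app (A := X) (B := fun _ => Univ j)
    (natInd (fun _ => All j fun X => X ⇒ Univ j) (lamT fun X => lam fun _ => ⟨X⟩)
      (fun _ H => lamT fun X => lam fun x => H ⬝ₜ (Id X x x) ⬝ refl x) n ⬝ₜ X) x).tm

/-- The base point of `Loop j n X x`. -/
@[irreducible] def base (j : ℕ) (n : El Nat) {X : Scoped} (x : El X) : El (Loop j n X x) :=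
  app (A := X) (B := fun x => Loop j n X x)
    (natInd (fun n => All j fun X => Pi X fun x => Loop j n X x)
      (lamT fun X => lam fun x => x.cast)
      (fun _ H => lamT fun X => lam fun x => (H ⬝ₜ (Id X x x) ⬝ refl x).cast) n ⬝ₜ X) x

/-- The action of a function on iterated loop spaces. -/
@[irreducible] def loopMap (i j : ℕ) (n : El Nat) {X Y : Scoped} (f : El X → El Y) (x : El X)
    (w : El (Loop i n X x)) : El (Loop j n Y (f x)) :=
  ((natInd (fun n => All i fun X => All j fun Y => Pi (X ⇒ Y) fun f => Pi X fun x =>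
      Loop i n X x ⇒ Loop j n Y (f ⬝ x))
    (lamT fun X => lamT fun Y => lam fun f => lam fun x => lam fun w => (f ⬝ w.cast).cast)
    (fun _ H => lamT fun X => lamT fun Y => lam fun f => lam fun x => lam fun w =>
      (H ⬝ₜ (Id X x x) ⬝ₜ (Id Y (f ⬝ x) (f ⬝ x)) ⬝ (lam fun p => ap (fun x => f ⬝ x) p) ⬝ refl x ⬝
        w.cast).cast) n ⬝ₜ X ⬝ₜ Y ⬝ (lam f)) ⬝ x ⬝ w).cast

abbrev LoopMapBase (i j : ℕ) : Scoped := Pi Nat fun n => All i fun X => All j fun Y =>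
  Pi (X ⇒ Y) fun f => Pi X fun x =>
  Id (Loop j n Y (f ⬝ x)) (loopMap i j n (fun x => f ⬝ x) x (base i n x)) (base j n (f ⬝ x))

/-- `Loop (n + 1) X x` computes to `Loop n (x = x) refl`, and `ap` computes on reflexivity, so the
induction hypothesis for `x = x` is already the claim. The inductions below peel off loops in the
same way. -/
def loopMapBase (i j : ℕ) : El (LoopMapBase i j) :=
  lam fun n => natInd (fun n => All i fun X => All j fun Y => Pi (X ⇒ Y) fun f => Pi X fun x =>
      Id (Loop j n Y (f ⬝ x)) (loopMap i j n (fun x => f ⬝ x) x (base i n x)) (base j n (f ⬝ x)))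
    (lamT fun X => lamT fun Y => lam fun f => lam fun x => (refl (f ⬝ x)).cast)
    (fun n ih => lamT fun X => lamT fun Y => lam fun f => lam fun x =>
      (ih ⬝ₜ (Id X x x) ⬝ₜ (Id Y (f ⬝ x) (f ⬝ x)) ⬝ (lam fun p => ap (fun x => f ⬝ x) p) ⬝
        refl x).cast) n

/-- Successors of `n`. -/
def succs : ℕ → El Nat → El Nat
  | 0, n => n
  | m + 1, n => succ (succs m n)

/-- The `n`-fold loop spaces of a type of h-level `n + m` have h-level `m`. -/
abbrev HLevelLoop (m j : ℕ) : Scoped := Pi Nat fun n => All j fun X =>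
  HLevel j (succs m n) X ⇒ Pi X fun x => HLevel j (succs m zero) (Loop j n X x)

def hLevelLoop (m j : ℕ) : El (HLevelLoop m j) :=
  lam fun n => natInd (fun n => All j fun X =>
      HLevel j (succs m n) X ⇒ Pi X fun x => HLevel j (succs m zero) (Loop j n X x))
    (lamT fun X => lam fun h => lam fun x => h.cast)
    (fun n ih => lamT fun X => lam fun h => lam fun x =>
      (ih ⬝ₜ (Id X x x) ⬝ (paths (n := succs m n) h.cast x x) ⬝ refl x).cast) n

/-! An equivalence `F : X ≃ Π i, Y i` induces equivalences `x = x' ≃ Π i, F x i = F x' i`, and is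
therefore surjective on loop spaces. -/

abbrev ApEquiv (j : ℕ) : Scoped := All j fun X => All j fun Y => Pi (Equiv X Y) fun e =>
  Pi X fun x => Pi X fun x' =>
  IsEquiv (Id X x x') (Id Y (fst e ⬝ x) (fst e ⬝ x')) (lam fun p => ap (fun x => fst e ⬝ x) p)

def apEquiv (j : ℕ) : El (EquivInduction j ⇒ FundamentalThm j ⇒ ApEquiv j) :=
  lam fun ei => lam fun ft => lamT fun X => lamT fun Y => lam fun e =>
  ei.equivInd (fun X e => Pi X fun x => Pi X fun x' =>
    IsEquiv (Id X x x') (Id Y (fst e ⬝ x) (fst e ⬝ x')) (lam fun p => ap (fun x => fst e ⬝ x) p))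
    (lam fun x => lam fun x' => (ft.fundamental x (fun x' => Id Y x x')
      (fun x' p => (ap (fun x : El Y => x) p).cast) (singletonContr' x) x').cast) e

abbrev ApEquivPi (j : ℕ) : Scoped := All j fun X => All j fun I => AllF I j fun Y =>
  Pi (Equiv X (Pi I Y)) fun e => Pi X fun x => Pi X fun x' =>
  IsEquiv (Id X x x') (Pi I fun i => Id (Y i) (fst e ⬝ x ⬝ i) (fst e ⬝ x' ⬝ i))
    (lam fun p => lam fun i => ap (fun x => fst e ⬝ x ⬝ i) p)

/-- For the identity of `Π I Y` this is function extensionality. The target is again a product over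
`I`, so the statement can be iterated. -/
def apEquivPi (j : ℕ) : El (EquivInduction j ⇒ FundamentalThm j ⇒ WeakFunext j ⇒ ChoiceContr j ⇒
    ApEquivPi j) :=
  lam fun ei => lam fun ft => lam fun wf => lam fun cc => lamT fun X => lamT fun I => lamF fun Y =>
  lam fun e =>
  ei.equivInd (fun X e => Pi X fun x => Pi X fun x' =>
    IsEquiv (Id X x x') (Pi I fun i => Id (Y i) (fst e ⬝ x ⬝ i) (fst e ⬝ x' ⬝ i))
      (lam fun p => lam fun i => ap (fun x => fst e ⬝ x ⬝ i) p))
    (lam fun x => lam fun x' => (ft.fundamental x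
        (fun x' => Pi I fun i => Id (Y i) (x ⬝ i) (x' ⬝ i))
      (fun x' p => lam fun i => (ap (B := Y i) (fun h : El (Pi I Y) => h ⬝ i) p).cast)
      (cc.choice wf (fun i u => Id (Y i) (x ⬝ i) u) (fun i => singletonContr' (x ⬝ i))) x').cast) e

abbrev LoopLift (j : ℕ) : Scoped := Pi Nat fun n => All j fun X => All j fun Y =>
  Pi (Equiv X Y) fun e => Pi X fun x => Pi (Loop j n Y (fst e ⬝ x)) fun s =>
  Sig (Loop j n X x) fun w => Id (Loop j n Y (fst e ⬝ x)) (loopMap j j n (fun x => fst e ⬝ x) x w) s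

def loopLift (j : ℕ) : El (ApEquiv j ⇒ LoopLift j) :=
  lam fun ae => lam fun n => natInd (fun n => All j fun X => All j fun Y =>
      Pi (Equiv X Y) fun e => Pi X fun x => Pi (Loop j n Y (fst e ⬝ x)) fun s =>
      Sig (Loop j n X x) fun w =>
        Id (Loop j n Y (fst e ⬝ x)) (loopMap j j n (fun x => fst e ⬝ x) x w) s)
    (lamT fun X => lamT fun Y => lam fun e => lam fun x => lam fun s =>
      let g := fst (snd e)
      pair (fst g ⬝ s.cast).cast (snd g ⬝ s.cast).cast)
    (fun n ih => lamT fun X => lamT fun Y => lam fun e => lam fun x => lam fun s =>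
      (ih ⬝ₜ (Id X x x) ⬝ₜ (Id Y (fst e ⬝ x) (fst e ⬝ x)) ⬝
        ascribe (pair (lam fun p => ap (fun x => fst e ⬝ x) p) (ae ⬝ₜ X ⬝ₜ Y ⬝ e ⬝ x ⬝ x)) ⬝
        refl x ⬝ s.cast).cast) n

abbrev LoopLiftPi (j : ℕ) : Scoped := Pi Nat fun n => All (j + 1) fun X => All j fun I =>
  AllF I j fun Y => Pi (Equiv X (Pi I Y)) fun e => Pi X fun x =>
  Pi (Pi I fun i => Loop j n (Y i) (fst e ⬝ x ⬝ i)) fun s =>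
  Sig (Loop (j + 1) n X x) fun w => Pi I fun i => Id (Loop j n (Y i) (fst e ⬝ x ⬝ i))
    (loopMap (j + 1) j n (fun x => fst e ⬝ x ⬝ i) x w) (s ⬝ i)

/-- A family of loops in the `Y i` is assembled to a single loop of `X`: at stage zero by the right
inverse of the equivalence, afterwards by the induction hypothesis for the equivalence that
`ApEquivPi` provides on `x = x`. -/
def loopLiftPi (j : ℕ) : El (ApEquivPi (j + 1) ⇒ LoopLiftPi j) :=
  lam fun ae => lam fun n => natInd (fun n => All (j + 1) fun X => All j fun I =>
      AllF I j fun Y => Pi (Equiv X (Pi I Y)) fun e => Pi X fun x =>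
      Pi (Pi I fun i => Loop j n (Y i) (fst e ⬝ x ⬝ i)) fun s =>
      Sig (Loop (j + 1) n X x) fun w => Pi I fun i => Id (Loop j n (Y i) (fst e ⬝ x ⬝ i))
        (loopMap (j + 1) j n (fun x => fst e ⬝ x ⬝ i) x w) (s ⬝ i))
    (lamT fun X => lamT fun I => lamF fun Y => lam fun e => lam fun x => lam fun s =>
      let g := fst (snd e)
      pair (fst g ⬝ s.cast).cast
        (lam fun i => (ap (B := Y i) (fun h => h ⬝ i) (snd g ⬝ s.cast)).cast))
    (fun n ih => lamT fun X => lamT fun I => lamF fun Y => lam fun e => lam fun x => lam fun s =>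
      (ih ⬝ₜ (Id X x x) ⬝ₜ I ⬝ᶠ (fun i => Id (Y i) (fst e ⬝ x ⬝ i) (fst e ⬝ x ⬝ i)) ⬝
        ascribe (pair (lam fun p => lam fun i => ap (fun x => fst e ⬝ x ⬝ i) p)
          (ae ⬝ₜ X ⬝ₜ I ⬝ᶠ Y ⬝ e ⬝ x ⬝ x)) ⬝ refl x ⬝ s.cast).cast) n

end MLTT

namespace MLTT
open Scoped

/-! ### Loops of a universe at a type, as families of paths in that type -/

abbrev ContrTransfer (j : ℕ) : Scoped := All j fun X => All j fun Z => Pi (Equiv X Z) fun e =>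
  AllF Z j fun Q => IsContr (Sig Z Q) ⇒ IsContr (Sig X fun x => Q (fst e ⬝ x))

def contrTransfer (j : ℕ) : El (EquivInduction j ⇒ ContrTransfer j) :=
  lam fun ei => lamT fun X => lamT fun Z => lam fun e =>
  ei.equivInd (fun X e => AllF Z j fun Q => IsContr (Sig Z Q) ⇒
      IsContr (Sig X fun x => Q (fst e ⬝ x)))
    (lamF fun Q => lam fun c => c.cast) e

abbrev IsEquivIdContr (j : ℕ) : Scoped := All j fun A => IsContr (IsEquiv A A (lam fun x => x))

/-- For the identity, the right and the left inverses both form the type of functions homotopic to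
the identity, contractible by choice. -/
def isEquivIdContr (j : ℕ) :
    El (WeakFunext j ⇒ ChoiceContr j ⇒ HLevelSigma j ⇒ IsEquivIdContr j) :=
  lam fun wf => lam fun cc => lam fun hs => lamT fun A =>
  let h : El (IsContr (Sig (A ⇒ A) fun g => Pi A fun b => Id A (g ⬝ b) b)) :=
    cc.choice wf (fun b u => Id A u b) fun b => singletonContr b
  (hs ⬝ zero ⬝ₜ (Sig (A ⇒ A) fun g => Pi A fun b => Id A (g ⬝ b) b) ⬝ᶠ
    (fun _ => Sig (A ⇒ A) fun g => Pi A fun b => Id A (g ⬝ b) b) ⬝ h.ofContr ⬝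
    (lam fun _ => h.ofContr)).cast

/-- Autoequivalences homotopic to the identity. -/
abbrev EquivHtpy (A : Scoped) : Scoped := Sig (Equiv A A) fun e => Pi A fun x => Id A x (fst e ⬝ x)

abbrev EquivHtpyContr (j : ℕ) : Scoped := All j fun A => IsContr (EquivHtpy A)

def equivHtpyContr (j : ℕ) :
    El (WeakFunext j ⇒ ChoiceContr j ⇒ IsEquivIdContr j ⇒ EquivHtpyContr j) :=
  lam fun wf => lam fun cc => lam fun ic => lamT fun A =>
  let S : Scoped := Sig (A ⇒ A) fun f => Pi A fun x => Id A x (f ⬝ x)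
  let mk (f : El (A ⇒ A)) (h : El (Pi A fun x => Id A x (f ⬝ x))) (w : El (IsEquiv A A f)) :
    El (EquivHtpy A) := pair (pair f w) h.cast
  let center : El (EquivHtpy A) :=
    mk (lam fun x => x) (lam fun x => (refl x).cast) (fst (ic ⬝ₜ A))
  let D (z : El S) : Scoped := Pi (IsEquiv A A (fst z)) fun w =>
    Id (EquivHtpy A) center (mk (fst z) (snd z) w)
  app (A := IsContr S) (B := fun _ => IsContr (EquivHtpy A))
    (lam fun c =>
      let o : El S := ascribe (pair (lam fun x => x) (lam fun x => (refl x).cast))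
      ascribe <| pair center (lam fun w => sigInd (fun w => Id (EquivHtpy A) center w) (fun e h =>
        (sigInd (fun e => Pi (Pi A fun x => Id A x (fst e ⬝ x)) fun h =>
            Id (EquivHtpy A) center (pair e h))
          (fun f w => lam fun h =>
            let z : El S := ascribe (pair f h.cast)
            (transport D (trans (sym (snd c ⬝ o)) (snd c ⬝ z))
              (lam fun w => (ap (B := EquivHtpy A)
                (fun w => mk (lam fun x => x) (lam fun x => (refl x).cast) w)
                (snd (ic ⬝ₜ A) ⬝ w.cast)).cast) ⬝ w.cast).cast) e) ⬝ h) w))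
    (cc.choice wf (fun x u => Id A x u) fun x => singletonContr' x)

def coe {i : ℕ} {A : Scoped} (p : El (Id (Univ i) ⟨A⟩ ⟨A⟩)) (x : El A) : El A :=
  fst (idToEquiv p) ⬝ x

/-- The double loops of `U_i` at `A`. -/
abbrev Loops₂ (i : ℕ) (A : Scoped) : Scoped :=
  Id (Id (Univ i) ⟨A⟩ ⟨A⟩) (refl ⟨A⟩) (refl ⟨A⟩)

def happly {i : ℕ} {A : Scoped} (r : El (Loops₂ i A)) (x : El A) : El (Id A x x) :=
  (ap (fun p => coe p x) r).cast

abbrev CoeEquiv (i : ℕ) : Scoped := All i fun A =>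
  IsEquiv (Loops₂ i A) (Pi A fun x => Id A x x) (lam fun r => lam fun x => happly r x)

/-- The fundamental theorem for the family of homotopies from the identity to `coe q`, over `q : A =
A`. By univalence its total space is that of autoequivalences homotopic to the identity, which is
contractible; the claim is the case `q = refl`. -/
def coeEquiv (i : ℕ) : El (Univalence i ⇒ FundamentalThm (i + 1) ⇒ ContrTransfer (i + 1) ⇒
    EquivHtpyContr i ⇒ CoeEquiv i) :=
  lam fun ua => lam fun ft => lam fun ct => lam fun eh => lamT fun A =>
  (ft.fundamental (refl (A := Univ i) ⟨A⟩) (fun q => Pi A fun x => Id A x (fst (idToEquiv q) ⬝ x))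
    (fun q r => lam fun x => (ap (fun p => coe p x) r).cast)
    (ct ⬝ₜ (Id (Univ i) ⟨A⟩ ⟨A⟩) ⬝ₜ (Equiv A A) ⬝
      (pair (lam fun p => idToEquiv p) (ua ⬝ₜ A ⬝ₜ A)) ⬝ᶠ
      (fun e => Pi A fun x => Id A x (fst e ⬝ x)) ⬝ (eh ⬝ₜ A)).cast (refl ⟨A⟩)).cast

/-- All `(k + 1)`-fold loops of `U_i` at types of h-level `k + 2` are trivial. -/
abbrev TrivialLoops (i : ℕ) (k : El Nat) : Scoped := All i fun A =>
  HLevel (i + 1) (succs 2 k) A ⇒ Pi (Loop (i + 1) (succ k) (Univ i) ⟨A⟩) fun q =>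
  Id (Loop (i + 1) (succ k) (Univ i) ⟨A⟩) q (base (i + 1) (succ k) ⟨A⟩)

abbrev TrivialSections (i : ℕ) : Scoped := Pi Nat fun k => TrivialLoops i (succ k) ⇒
  All i fun L => HLevel (i + 1) (succs 3 k) L ⇒
  Pi (Pi L fun x => Loop i (succ k) L x) fun s => Pi L fun x =>
  Id (Loop i (succ k) L x) (s ⬝ x) (base i (succ k) x)

/-- By `coeEquiv` and `LoopLiftPi`, the section `s` is the image of one (k+2)-fold loop of `U_i` at
`L`. That loop is trivial by hypothesis, and the induced maps preserve base points. -/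
def trivialSections (i : ℕ) :
    El (CoeEquiv i ⇒ LoopLiftPi i ⇒ LoopMapBase (i + 1) i ⇒ TrivialSections i) :=
  lam fun ce => lam fun ll => lam fun mb => lam fun k => lam fun t => lamT fun L => lam fun h =>
  lam fun s => lam fun x =>
  -- The lift is abstracted to a variable `z`; a Lean `let` would copy the whole term at each use.
  app (A := Sig (Loop (i + 1) k (Loops₂ i L) (refl (refl ⟨L⟩))) fun w => Pi L fun x =>
      Id (Loop i k (Id L x x) (refl x))
        (loopMap (i + 1) i k (fun r => happly r x) (refl (refl ⟨L⟩)) w).cast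
        (s ⬝ x).cast)
    (B := fun _ => Id (Loop i (succ k) L x) (s ⬝ x) (base i (succ k) x))
    (lam fun z =>
      let φ (w : El (Loop (i + 1) k (Loops₂ i L) (refl (refl ⟨L⟩)))) :
          El (Loop i k (Id L x x) (refl x)) :=
        (loopMap (i + 1) i k (fun r => happly r x) (refl (refl ⟨L⟩)) w).cast
      let e : El (Id (Loop i k (Id L x x) (refl x)) (s ⬝ x).cast (base i k (refl x))) :=
        trans (sym (snd z ⬝ x).cast) (trans (b := φ (base (i + 1) k (refl (refl ⟨L⟩))))
          (ap (a := fst z) φ (t ⬝ₜ L ⬝ h ⬝ (fst z).cast).cast)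
          (mb ⬝ k ⬝ₜ (Loops₂ i L) ⬝ₜ (Id L x x) ⬝ (lam fun r => happly r x) ⬝ refl (refl ⟨L⟩)).cast)
      e.cast)
    (ll ⬝ k ⬝ₜ (Loops₂ i L) ⬝ₜ L ⬝ᶠ (fun x => Id L x x) ⬝
      ascribe (pair (lam fun r => lam fun x => happly r x) (ce ⬝ₜ L)) ⬝ refl (refl ⟨L⟩) ⬝
      s.cast).cast

end MLTT

namespace MLTT
open Scoped

/-! ### Lifting loops along the first projection -/

abbrev FstLoopsEquiv (j : ℕ) : Scoped := All j fun B => AllF B j fun F =>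
  (Pi B fun b => HLevel j (succs 2 zero) (F b)) ⇒ Pi (Sig B F) fun z =>
  IsEquiv (Id (Id (Sig B F) z z) (refl z) (refl z))
    (Id (Id B (fst z) (fst z)) (refl (fst z)) (refl (fst z)))
    (lam fun r => (ap (fun s => ap (fun w => fst w) s) r).cast)

/-- The fundamental theorem at `refl z`. After splitting a loop of `Σ B F` into its components, the
first is contracted to reflexivity; the second is then a loop in a set, and hence trivial. -/
def fstLoopsEquiv (j : ℕ) :
    El (FundamentalThm j ⇒ PathSigma j ⇒ ContrTransfer j ⇒ FstLoopsEquiv j) :=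
  lam fun ft => lam fun ps => lam fun ct => lamT fun B => lamF fun F => lam fun h => lam fun z =>
  let P : Scoped := Sig (Id B (fst z) (fst z)) fun p =>
    Id (F (fst z)) (transport F p (snd z)) (snd z)
  let T : Scoped := Sig P fun w => Id (Id B (fst z) (fst z)) (refl (fst z)) (fst w)
  let mk (p : El (Id B (fst z) (fst z))) (t : El (Id (F (fst z)) (transport F p (snd z)) (snd z)))
    (r : El (Id (Id B (fst z) (fst z)) (refl (fst z)) p)) : El T := pair (pair p t) r.cast
  let center : El T := mk (refl (fst z)) (refl (snd z)).cast (refl (refl (fst z)))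
  let c : El (IsContr T) := pair center (lam fun w => sigInd (fun w => Id T center w) (fun w r =>
    (sigInd (fun w => Pi (Id (Id B (fst z) (fst z)) (refl (fst z)) (fst w)) fun r =>
        Id T center (pair w r))
      (fun p t => lam fun r =>
        (basedJ (fun p r => Pi (Id (F (fst z)) (transport F p (snd z)) (snd z)) fun t =>
            Id T center (mk p t r))
          (lam fun t => (ap (fun t => mk (refl (fst z)) t.cast (refl (refl (fst z))))
            (fst (paths (paths (h ⬝ fst z) (snd z) (snd z)) (refl (snd z)) t.cast).contr)).cast)
          r.cast ⬝ t).cast) w) ⬝ r) w)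
  (ft.fundamental (refl z)
    (fun s => Id (Id B (fst z) (fst z)) (refl (fst z)) (ap (fun w => fst w) s))
    (fun s r => (ap (fun s => ap (fun w => fst w) s) r).cast)
    (ct ⬝ₜ (Id (Sig B F) z z) ⬝ₜ P ⬝ (pair (lam fun s => pathPair s) (ps ⬝ₜ B ⬝ᶠ F ⬝ z ⬝ z)) ⬝ᶠ
      (fun w => Id (Id B (fst z) (fst z)) (refl (fst z)) (fst w)) ⬝ c).cast (refl z)).cast

abbrev FstLoopLift (j : ℕ) : Scoped := Pi Nat fun k => All j fun B => AllF B j fun F =>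
  (Pi B fun b => HLevel j (succs 2 zero) (F b)) ⇒ Pi (Sig B F) fun z =>
  Pi (Loop j (succs 2 k) B (fst z)) fun q => Sig (Loop j (succs 2 k) (Sig B F) z) fun s =>
  Id (Loop j (succs 2 k) B (fst z)) (loopMap j j (succs 2 k) (fun w => fst w) z s) q

def fstLoopLift (j : ℕ) : El (FstLoopsEquiv j ⇒ LoopLift j ⇒ FstLoopLift j) :=
  lam fun fe => lam fun ll => lam fun k => lamT fun B => lamF fun F => lam fun h => lam fun z =>
  lam fun q =>
  (ll ⬝ k ⬝ₜ (Id (Id (Sig B F) z z) (refl z) (refl z)) ⬝ₜ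
    (Id (Id B (fst z) (fst z)) (refl (fst z)) (refl (fst z))) ⬝
    ascribe (pair (lam fun r => (ap (fun s => ap (fun w => fst w) s) r).cast)
      (fe ⬝ₜ B ⬝ᶠ F ⬝ h ⬝ z)) ⬝
    refl (refl z) ⬝ q.cast).cast

/-! ### Types of `U_0` with a loop -/

/-- The fibre of `LoopedTypes k` over `A`. -/
abbrev LoopAt (k : El Nat) (A : Scoped) : Scoped :=
  Prod (HLevel 1 (succs 2 k) A) (Loop 1 (succ k) (Univ 0) ⟨A⟩)

/-- The types in `U_0` of h-level `k + 2` with a `(k + 1)`-fold loop of `U_0`. -/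
abbrev LoopedTypes (k : El Nat) : Scoped := Sig (Univ 0) fun A => LoopAt k A.tm

abbrev LoopAtIsSet : Scoped := Pi Nat fun k => All 0 fun A => HLevel 1 (succs 2 zero) (LoopAt k A)

def loopAtIsSet : El (HLevelUniv 0 ⇒ HLevelOfProp 1 ⇒ HLevelIsProp 1 ⇒ HLevelSigma 1 ⇒
    HLevelLoop 2 1 ⇒ LoopAtIsSet) :=
  lam fun hu => lam fun op => lam fun ip => lam fun hs => lam fun hl => lam fun k => lamT fun A =>
  -- That the loop space is a set depends on the h-level of `A`, which is known only from a point of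
  -- the type. Hence two points are taken first, and `fst u` supplies the bound.
  (ofPaths (n := succ zero) fun u v => paths (n := succ zero)
    (hs ⬝ succs 2 zero ⬝ₜ (HLevel 1 (succs 2 k) A) ⬝ᶠ (fun _ => Loop 1 (succ k) (Univ 0) ⟨A⟩) ⬝
      (op ⬝ succ zero ⬝ₜ (HLevel 1 (succs 2 k) A) ⬝ (ip ⬝ succs 2 k ⬝ₜ A)) ⬝
      (lam fun _ => (hl ⬝ k ⬝ₜ (Id (Univ 0) ⟨A⟩ ⟨A⟩) ⬝
        (hu ⬝ succs 2 k ⬝ₜ A ⬝ₜ A ⬝ fst u ⬝ fst u) ⬝ refl ⟨A⟩).cast)).cast u v)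

abbrev LoopedTypesHLevel : Scoped := Pi Nat fun k => HLevel 2 (succs 3 k) (LoopedTypes k)

/-- A path in `LoopedTypes k` is a path between types of h-level `k + 2`, which has h-level `k + 2`,
together with a path in a set, which is a proposition. -/
def loopedTypesHLevel : El (HLevelUniv 0 ⇒ HLevelOfProp 1 ⇒ LoopAtIsSet ⇒ HLevelSigma 1 ⇒
    HLevelTransfer 1 ⇒ PathSigma 1 ⇒ HLevelLift 1 ⇒ LoopedTypesHLevel) :=
  lam fun hu => lam fun op => lam fun ls => lam fun hs => lam fun tr => lam fun ps => lam fun li =>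
  lam fun k =>
  let F (A : El (Univ 0)) : Scoped := LoopAt k A.tm
  li ⬝ succs 3 k ⬝ₜ (LoopedTypes k) ⬝ ofPaths (n := succs 2 k) fun u v =>
    let P (p : El (Id (Univ 0) (fst u) (fst v))) : Scoped :=
      Id (F (fst v)) (transport F p (snd u)) (snd v)
    tr ⬝ succs 2 k ⬝ₜ (Id (LoopedTypes k) u v) ⬝ₜ (Sig (Id (Univ 0) (fst u) (fst v)) P) ⬝
      (pair (lam fun r => pathPair r) (ps ⬝ₜ (Univ 0) ⬝ᶠ F ⬝ u ⬝ v)) ⬝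
      (hs ⬝ succs 2 k ⬝ₜ (Id (Univ 0) (fst u) (fst v)) ⬝ᶠ P ⬝
        (hu ⬝ succs 2 k ⬝ₜ (fst u).tm ⬝ₜ (fst v).tm ⬝ (fst (snd u)).cast ⬝
          (fst (snd v)).cast).cast ⬝
        (lam fun p => op ⬝ succ k ⬝ₜ P p ⬝
          paths (n := succ zero) (ls ⬝ k ⬝ₜ (fst v).tm).cast (transport F p (snd u)) (snd v)))

/-- Transport of a loop along a path that commutes with it. -/
abbrev TransportLoop : Scoped := Pi (Univ 0) fun A => Pi (Univ 0) fun A' =>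
  Pi (Id (Univ 0) A A') fun p => Pi (LoopAt zero A.tm) fun u => Pi (LoopAt zero A'.tm) fun v =>
  Id (Id (Univ 0) A A') (trans (snd u).cast p) (trans p (snd v).cast) ⇒
  Id (LoopAt zero A'.tm) (transport (fun A => LoopAt zero A.tm) p u) v

def transUnit {A : Scoped} {a b : El A} (p : El (Id A a b)) :
    El (Id (Id A a b) (trans (refl a) p) p) :=
  J (fun x y p => Id (Id A x y) (trans (refl x) p) p) (fun x => (refl (refl x)).cast) p

/-- When `p` is reflexivity the hypothesis says that the two loops are equal, and the h-level
components agree because they prove a proposition. -/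
def transportLoop : El (HLevelIsProp 1 ⇒ TransportLoop) :=
  lam fun ip => lam fun A => lam fun A' => lam fun p =>
  J (fun A A' p => Pi (LoopAt zero A.tm) fun u => Pi (LoopAt zero A'.tm) fun v =>
      Id (Id (Univ 0) A A') (trans (snd u).cast p) (trans p (snd v).cast) ⇒
      Id (LoopAt zero A'.tm) (transport (fun A => LoopAt zero A.tm) p u) v)
    (fun A => lam fun u => lam fun v =>
      (sigInd (fun u => Pi (LoopAt zero A.tm) fun v =>
          Id (Id (Univ 0) A A) (snd u).cast (trans (refl A) (snd v).cast) ⇒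
          Id (LoopAt zero A.tm) u v)
        (fun h q => (lam fun v => sigInd (fun v =>
            Id (Id (Univ 0) A A) q.cast (trans (refl A) (snd v).cast) ⇒
            Id (LoopAt zero A.tm) (pair h q) v)
          (fun h' q' => lam fun e => trans (b := pair h' q)
            (ap (fun h => pair h q) (fst (paths (ip ⬝ succs 2 zero ⬝ₜ A.tm) h h').contr))
            (ap (B := LoopAt zero A.tm) (a := q.cast) (b := q'.cast) (fun q => pair h' q.cast)
              (trans (A := Id (Univ 0) A A) e.cast (transUnit q'.cast))).cast) v).cast) u ⬝ v).cast)
    p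

abbrev LoopedTypesLift : Scoped := Pi Nat fun k => Pi (LoopedTypes k) fun z =>
  Sig (Loop 1 (succ k) (LoopedTypes k) z) fun s =>
  Id (Loop 1 (succ k) (Univ 0) (fst z)) (loopMap 1 1 (succ k) (fun w => fst w) z s)
    (snd (snd z)).cast

/-- A case distinction on `k`. For single loops, a lift of `q` must show that transport along `q`
fixes `q`, and `q` commutes with itself by `refl (trans q q)`. For higher loops the fibres are sets,
and `FstLoopLift` applies. -/
def loopedTypesLift :
    El (TransportLoop ⇒ PathSigma 1 ⇒ FstLoopLift 1 ⇒ LoopAtIsSet ⇒ LoopedTypesLift) :=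
  lam fun tl => lam fun ps => lam fun fl => lam fun ls => lam fun k =>
  natInd (fun k => Pi (LoopedTypes k) fun z => Sig (Loop 1 (succ k) (LoopedTypes k) z) fun s =>
      Id (Loop 1 (succ k) (Univ 0) (fst z)) (loopMap 1 1 (succ k) (fun w => fst w) z s)
        (snd (snd z)).cast)
    (lam fun z =>
      let F (A : El (Univ 0)) : Scoped := LoopAt zero A.tm
      let q : El (Id (Univ 0) (fst z) (fst z)) := (snd (snd z)).cast
      let e := fst (ps ⬝ₜ (Univ 0) ⬝ᶠ F ⬝ z ⬝ z)
      let y : El (Sig (Id (Univ 0) (fst z) (fst z)) fun p =>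
          Id (F (fst z)) (transport F p (snd z)) (snd z)) :=
        ascribe (pair q (tl ⬝ fst z ⬝ fst z ⬝ q ⬝ (snd z).cast ⬝ (snd z).cast ⬝
          refl (trans q q)).cast)
      pair (fst e ⬝ y).cast (ap (fun y => fst y) (snd e ⬝ y)).cast)
    (fun k _ => lam fun z => (fl ⬝ k ⬝ₜ (Univ 0) ⬝ᶠ (fun A => LoopAt (succ k) A.tm) ⬝
      (lam fun A => ls ⬝ succ k ⬝ₜ A.tm) ⬝ z ⬝ (snd (snd z)).cast).cast) k

abbrev Descent : Scoped := Pi Nat fun k => TrivialLoops 1 (succ k) ⇒ TrivialLoops 0 k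

/-- The section lifts at each point the loop that is part of that point. It is trivial at `z = (A,
h, q)`, and its projection there is `q`. -/
def descent :
    El (TrivialSections 1 ⇒ LoopedTypesHLevel ⇒ LoopedTypesLift ⇒ LoopMapBase 1 1 ⇒ Descent) :=
  lam fun ts => lam fun lh => lam fun ll => lam fun mb => lam fun k => lam fun t => lamT fun A =>
  lam fun h => lam fun q =>
  let z : El (LoopedTypes k) := ascribe (pair ⟨A⟩ (El.cast (A := LoopAt k A) (pair h q)))
  let e := ts ⬝ k ⬝ t ⬝ₜ (LoopedTypes k) ⬝ (lh ⬝ k) ⬝ (lam fun x => fst (ll ⬝ k ⬝ x)) ⬝ z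
  (trans (sym (snd (ll ⬝ k ⬝ z)))
    (trans (c := base 1 (succ k) (fst z)) (ap (b := base 1 (succ k) z)
        (fun s => loopMap 1 1 (succ k) (fun w => fst w) z s) e.cast)
      (mb ⬝ succ k ⬝ₜ (LoopedTypes k) ⬝ₜ (Univ 0) ⬝ (lam fun w => fst w) ⬝ z).cast)).cast

/-! ### A nontrivial loop of `U_0` -/

/-- A contractible type. -/
abbrev Point : Scoped := Sig Nat fun n => Id Nat n zero

/-- Equality of natural numbers, by recursion. -/
abbrev Code (m n : El Nat) : Scoped :=
  (natInd (fun _ => Nat ⇒ Univ 0)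
    (lam fun n => natInd (fun _ => Univ 0) ⟨Point⟩ (fun _ _ => ⟨Empty⟩) n)
    (fun _ c => lam fun n => natInd (fun _ => Univ 0) ⟨Empty⟩ (fun n _ => c ⬝ n) n) m ⬝ n).tm

abbrev CodeContr : Scoped := Pi Nat fun m => IsContr (Sig Nat fun n => Code m n)

def codeRefl (m : El Nat) : El (Code m m) :=
  natInd (fun m => Code m m) (El.cast (A := Point) (pair zero (refl zero))) (fun _ c => c.cast) m

def codeContr : El CodeContr :=
  lam fun m => natInd (fun m => IsContr (Sig Nat fun n => Code m n))
    (pair (pair zero (codeRefl zero)) (lam fun w =>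
      sigInd (fun w => Id (Sig Nat fun n => Code zero n) (pair zero (codeRefl zero)) w) (fun n c =>
        natInd (fun n => Pi (Code zero n) fun c =>
            Id (Sig Nat fun n => Code zero n) (pair zero (codeRefl zero)) (pair n c))
          (lam fun c => (ap (B := Sig Nat fun n => Code zero n) (fun c => pair zero c.cast)
            (snd (ascribe (singletonContr zero)) ⬝ c.cast)).cast)
          (fun n _ => lam fun c => emptyInd
            (fun _ => Id (Sig Nat fun n => Code zero n) (pair zero (codeRefl zero))
              (pair (succ n) c))
            c.cast) n ⬝ c) w))
    (fun m ih =>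
      let up (w : El (Sig Nat fun n => Code m n)) : El (Sig Nat fun n => Code (succ m) n) :=
        pair (succ (fst w)) (snd w).cast
      pair (up (fst ih)) (lam fun w =>
        sigInd (fun w => Id (Sig Nat fun n => Code (succ m) n) (up (fst ih)) w) (fun n c =>
          natInd (fun n => Pi (Code (succ m) n) fun c =>
              Id (Sig Nat fun n => Code (succ m) n) (up (fst ih)) (pair n c))
            (lam fun c => emptyInd
              (fun _ => Id (Sig Nat fun n => Code (succ m) n) (up (fst ih)) (pair zero c)) c.cast)
            (fun n _ => lam fun c =>
              (ap up (snd ih ⬝ ascribe (pair n c.cast))).cast) n ⬝ c) w)) m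

abbrev CodeIsProp : Scoped := Pi Nat fun m => Pi Nat fun n => HLevel 1 (succ zero) (Code m n)

def codeIsProp : El (HLevelPath 1 ⇒ CodeIsProp) :=
  lam fun hp => lam fun m => natInd (fun m => Pi Nat fun n => HLevel 1 (succ zero) (Code m n))
    (lam fun n => natInd (fun n => HLevel 1 (succ zero) (Code zero n))
      (hp ⬝ zero ⬝ₜ Point ⬝ (singletonContr zero).ofContr).cast
      (fun _ _ => (lam fun c =>
        emptyInd (fun c => Pi Empty fun d => HLevel 1 zero (Id Empty c d)) c).cast) n)
    (fun m ih => lam fun n => natInd (fun n => HLevel 1 (succ zero) (Code (succ m) n))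
      (lam fun c => emptyInd (fun c => Pi Empty fun d => HLevel 1 zero (Id Empty c d)) c).cast
      (fun n _ => (ih ⬝ n).cast) n) m

abbrev NatIsSet : Scoped := HLevel 1 (succs 2 zero) Nat

/-- The encode-decode method: `m = n` is equivalent to the proposition `Code m n`, because `Σ n,
Code m n` is contractible. -/
def natIsSet : El (FundamentalThm 1 ⇒ HLevelTransfer 1 ⇒ CodeContr ⇒ CodeIsProp ⇒ NatIsSet) :=
  lam fun ft => lam fun tr => lam fun cc => lam fun cp => ofPaths (n := succ zero) fun m n =>
  let φ (n : El Nat) (p : El (Id Nat m n)) : El (Code m n) :=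
    transport (fun n => Code m n) p (codeRefl m)
  tr ⬝ succ zero ⬝ₜ (Id Nat m n) ⬝ₜ (Code m n) ⬝
    (pair (lam fun p => φ n p) (ft.fundamental m (fun n => Code m n) φ (cc ⬝ m) n)) ⬝ (cp ⬝ m ⬝ n)

/-- The transposition of `0` and `1`. -/
def swap (n : El Nat) : El Nat :=
  natInd (fun _ => Nat) (succ zero)
    (fun n _ => natInd (fun _ => Nat) zero (fun n _ => succ (succ n)) n) n

def swapSwap : El (Pi Nat fun n => Id Nat (swap (swap n)) n) :=
  lam fun n => natInd (fun n => Id Nat (swap (swap n)) n) (refl zero).cast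
    (fun n _ => natInd (fun n => Id Nat (swap (swap (succ n))) (succ n)) (refl (succ zero)).cast
      (fun n _ => (refl (succ (succ n))).cast) n) n

abbrev NontrivialLoop : Scoped := TrivialLoops 0 zero ⇒ Empty

def nontrivialLoop : El (Univalence 0 ⇒ NatIsSet ⇒ NontrivialLoop) :=
  lam fun ua => lam fun ns => lam fun t =>
  let e : El (Equiv Nat Nat) := ascribe (pair (lam fun n => swap n)
    (isEquivOf (lam fun n => swap n) swapSwap.cast swapSwap.cast))
  let s := fst (ua ⬝ₜ Nat ⬝ₜ Nat)
  let q : El (Id (Univ 0) ⟨Nat⟩ ⟨Nat⟩) := fst s ⬝ e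
  let p : El (Scoped.Id (Id (Univ 0) ⟨Nat⟩ ⟨Nat⟩) q (refl (A := Univ 0) ⟨Nat⟩)) :=
    (t ⬝ₜ Nat ⬝ ns ⬝ q.cast).cast
  -- Coercion along `q` sends 0 to 1, because `q` comes from the transposition, and to 0, because
  -- `q` is reflexivity. The family below is `ℕ` at successors and empty at 0, so transport along `1
  -- = 0` is absurd.
  let c : El (Id Nat (succ zero) zero) :=
    trans (b := coe q zero) (sym (ap (fun e => fst e ⬝ zero) (snd s ⬝ e))).cast
      (ap (fun p => coe p zero) p).cast
  (transport (fun n => (natInd (fun _ => Univ 0) ⟨Empty⟩ (fun _ _ => ⟨Nat⟩) n).tm) c zero.cast).cast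

abbrev TrivialOfHLevel : Scoped := Pi Nat fun k => HLevel 1 (succs 2 k) (Univ 0) ⇒ TrivialLoops 0 k

def trivialOfHLevel : El (HLevelLoop 1 1 ⇒ TrivialOfHLevel) :=
  lam fun hl => lam fun k => lam fun h => lamT fun A => lam fun _ => lam fun q =>
  fst (paths (hl ⬝ succ k ⬝ₜ Univ 0 ⬝ h ⬝ ⟨A⟩) q (base 1 (succ k) ⟨A⟩)).contr

end MLTT

/-! ### From accepted terms to inhabited types. -/

namespace MLTT
open Judgment Exp

/-! ### Theorems of the object theory -/

deriving instance DecidableEq for Tm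

namespace Scoped

/-- The annotated form of a closed type. -/
noncomputable def annotate (A : Scoped) : Option Exp := match (A.run 0).check [] none with
  | some (A', U) => match asUniv U with
    | some _ => some A'
    | none => none
  | none => none

/-- The annotated form of the type of functions from `hs` to `B`. -/
noncomputable def annotateArrows (hs : List Scoped) (B : Scoped) : Option Exp :=
  List.rec (motive := fun _ => Option Exp) B.annotate
    (fun A _ T => match A.annotate with
      | some A => match T with
        | some T => some (.pi A T.wk)
        | none => none
      | none => none) hs

end Scoped

/-- The type checker accepts `A` as a closed type, whose annotated form is inhabited. -/
def IsTheorem (A : Scoped) : Prop := ∃ A', A.annotate = some A' ∧ IsInhabited A'.erase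

/-- Is `t` accepted as a proof of `B` from the hypotheses `hs`? -/
noncomputable def verify (hs : List Scoped) (B t : Scoped) : Bool :=
  match Scoped.annotateArrows hs B with
  | some T => ((t.run 0).check [] (some T)).isSome
  | none => false

theorem Scoped.isTy_of_annotate {A : Scoped} {A' : Exp} (h : A.annotate = some A') :
    IsTy [] A' := by
  unfold annotate at h
  split at h
  · next hc =>
    split at h
    · next hU =>
      cases h
      obtain ⟨hA, hU'⟩ := (Checker.sound_check _).infer (Γ := []) trivial hc
      exact ⟨_, hA.sub (asUniv_sound hU hU')⟩
    · cases h
  · cases h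

/-- The cut rule: a proof of the implications is applied to closed proofs of the hypotheses, one at
a time. -/
theorem IsTheorem.of_arrows {hs : List Scoped} {B : Scoped} {T : Exp}
    (hT : Scoped.annotateArrows hs B = some T) :
    IsTy [] T ∧ (hs.Forall IsTheorem → IsInhabited T.erase → IsTheorem B) := by
  induction hs generalizing T with
  | nil => exact ⟨Scoped.isTy_of_annotate hT, fun _ h => ⟨T, hT, h⟩⟩
  | cons A hs ih =>
    change (match A.annotate with
      | some A => match Scoped.annotateArrows hs B with
        | some T => some (Exp.pi A T.wk)
        | none => none
      | none => none) = some T at hT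
    split at hT
    · next A' hA =>
      split at hT
      · next S hS =>
        cases hT
        obtain ⟨i, hA'⟩ := Scoped.isTy_of_annotate hA
        obtain ⟨⟨j, hS'⟩, h⟩ := ih hS
        have hA' := hA'.cumul (le_max_left i j)
        have hS' := hS'.cumul (le_max_right i j)
        refine ⟨⟨_, _, hA', hS'.wk hA'.derivable, .refl _⟩, fun H hi => ?_⟩
        rw [List.forall_cons] at H
        obtain ⟨⟨A₁, e, a, ha⟩, H⟩ := H
        cases hA.symm.trans e
        obtain ⟨f, hf⟩ := hi
        refine h H ⟨.app f a, ?_⟩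
        have := Derivable.pi_elim (B := S.wk.erase) hf ha
        rwa [erase_wk, Tm.wk_inst] at this
      · cases hT
    · cases hT

/-- The premise `h` is a computation. Earlier theorems enter the checked term only as bound
variables, so their proofs are never unfolded or normalized again. -/
theorem IsTheorem.of_verify {hs : List Scoped} {B : Scoped} (t : El (hs.foldr Scoped.Arrow B))
    (h : verify hs B t.tm = true) (H : hs.Forall IsTheorem) : IsTheorem B := by
  unfold verify at h
  split at h
  · next T hT =>
    obtain ⟨hty, hB⟩ := of_arrows hT
    obtain ⟨r, hr⟩ := Option.isSome_iff_exists.1 h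
    obtain ⟨hr, -, e⟩ := Checker.sound_check _ (Γ := []) trivial (by rintro _ ⟨⟩; exact hty) hr
    exact hB H ⟨_, e _ rfl ▸ hr.derivable⟩
  · cases h

/-- If annotation does not change the raw term, then `A` is inhabited itself. -/
theorem IsTheorem.isInhabited {A : Scoped} {T : Tm} (h : IsTheorem A)
    (hA : A.annotate.map erase = some T) : IsInhabited T := by
  obtain ⟨A', e, h⟩ := h
  rw [e] at hA
  cases hA
  exact h

theorem IsTheorem.of_isInhabited {A : Scoped} {T : Tm} (hA : A.annotate.map erase = some T)
    (h : IsInhabited T) : IsTheorem A := by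
  cases e : A.annotate with
  | none => rw [e] at hA; cases hA
  | some A' =>
    rw [e] at hA
    cases hA
    exact ⟨A', e, h⟩

end MLTT

set_option maxRecDepth 100000

namespace MLTT
open Judgment Exp Scoped

/-! ### The axioms of the object theory, and what the type checker accepts -/

/-- Univalence of `U_j`, as a closed type. -/
def univalenceTm (j : ℕ) : Tm :=
  .pi (.univ j) (.pi (.univ j) (Tm.isEquiv (.path (.univ j) (.var 1) (.var 0))
    (Tm.equiv (.var 1) (.var 0)) (Tm.idToEquiv j (.var 1) (.var 0))))

/-- The type expressing that a dependent function is equal to its expansion, for types in `U_j`. -/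
def etaTm (j : ℕ) : Tm :=
  .pi (.univ j) (.pi (.pi (.var 0) (.univ j)) (.pi (.pi (.var 1) (.app (.var 1) (.var 0)))
    (.path (.pi (.var 2) (.app (.var 2) (.var 0))) (.var 0)
      (.lam (.var 2) (.app (.var 1) (.var 0))))))

theorem isInhabited_univalenceTm (j : ℕ) : IsInhabited (univalenceTm j) := by
  have h₁ := Derivable.univ_intro j .ctx_nil
  have hΓ₁ : Derivable (isCtx [.univ j]) := .ctx_cons .ctx_nil h₁
  have h₂ := Derivable.univ_intro j hΓ₁
  have hΓ₂ : Derivable (isCtx [.univ j, .univ j]) := .ctx_cons hΓ₁ h₂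
  exact ⟨_, .pi_intro h₁ (.pi_intro h₂ (.univalence (.var hΓ₂ (.there _ (.here _ _)))
    (.var hΓ₂ (.here _ _))))⟩

/-- The inhabitant is `refl f`, converted along the judgmental η-rule. -/
theorem isInhabited_etaTm (j : ℕ) : IsInhabited (etaTm j) := by
  have h₁ := Derivable.univ_intro j .ctx_nil
  have hΓ₁ : Derivable (isCtx [.univ j]) := .ctx_cons .ctx_nil h₁
  have hA := Derivable.var hΓ₁ (.here _ _)
  have h₂ := Derivable.pi_form (.univ_cumul hA) (.univ_intro j (.ctx_cons hΓ₁ hA))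
  have hΓ₂ := Derivable.ctx_cons hΓ₁ h₂
  have hA₂ := Derivable.var hΓ₂ (.there _ (.here _ _))
  have hΓ₃ := Derivable.ctx_cons hΓ₂ hA₂
  have hB := Derivable.var hΓ₂ (.here _ _)
  have h₃ := Derivable.pi_form hA₂ (Derivable.pi_elim
    (Derivable.var hΓ₃ (.there _ (.here _ _))) (Derivable.var hΓ₃ (.here _ _)))
  have hΓ₄ := Derivable.ctx_cons hΓ₂ h₃
  have hf := Derivable.var hΓ₄ (.here _ _)
  have hP := h₃.wkType h₃
  exact ⟨_, .pi_intro h₁ (.pi_intro h₂ (.pi_intro h₃ (.conv (.path_intro hP hf)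
    (.path_form_eq (.eq_refl hP) (.eq_refl hf) (.pi_uniq hf)))))⟩

namespace IsTheorem

/-- Three levels suffice: the descent relates `U_1` to `U_0`, and the loops of `U_1` live in `U_2`.
The computation confirms that annotation leaves exactly the raw type of the constant. -/
theorem univalence (j : ℕ) (hj : j < 3) : IsTheorem (Univalence j) := by
  refine of_isInhabited ?_ (isInhabited_univalenceTm j)
  revert j
  decide +kernel

theorem eta (j : ℕ) (hj : j < 3) : IsTheorem (Eta j) := by
  refine of_isInhabited ?_ (isInhabited_etaTm j)
  revert j
  decide +kernel

theorem fundamentalThm₂ : IsTheorem (FundamentalThm 2) :=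
  .of_verify (hs := []) (fundamentalThm 2) (by decide +kernel) trivial

theorem equivInduction₂ : IsTheorem (EquivInduction 2) :=
  .of_verify (hs := [_]) (equivInduction 2) (by decide +kernel) (univalence 2 (by decide))

theorem contrTransfer₂ : IsTheorem (ContrTransfer 2) :=
  .of_verify (hs := [_]) (contrTransfer 2) (by decide +kernel) equivInduction₂

theorem equivInduction₁ : IsTheorem (EquivInduction 1) :=
  .of_verify (hs := [_]) (equivInduction 1) (by decide +kernel) (univalence 1 (by decide))

theorem fibersContr₁ : IsTheorem (FibersContr 1) :=
  .of_verify (hs := [_]) (fibersContr 1) (by decide +kernel) equivInduction₁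

theorem postComp₁ : IsTheorem (PostComp 1) :=
  .of_verify (hs := [_, _]) (postComp 1) (by decide +kernel) ⟨eta 1 (by decide), equivInduction₁⟩

theorem projEquiv₁ : IsTheorem (ProjEquiv 1) :=
  .of_verify (hs := []) (projEquiv 1) (by decide +kernel) trivial

theorem sectionsRetract₁ : IsTheorem (SectionsRetract 1) :=
  .of_verify (hs := [_]) (sectionsRetract 1) (by decide +kernel) (eta 1 (by decide))

theorem weakFunext₁ : IsTheorem (WeakFunext 1) :=
  .of_verify (hs := [_, _, _, _]) (weakFunext 1) (by decide +kernel)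
    ⟨fibersContr₁, postComp₁, projEquiv₁, sectionsRetract₁⟩

theorem choiceContr₁ : IsTheorem (ChoiceContr 1) :=
  .of_verify (hs := [_]) (choiceContr 1) (by decide +kernel) (eta 1 (by decide))

theorem hLevelTransfer₁ : IsTheorem (HLevelTransfer 1) :=
  .of_verify (hs := [_]) (hLevelTransfer 1) (by decide +kernel) equivInduction₁

theorem fundamentalThm₁ : IsTheorem (FundamentalThm 1) :=
  .of_verify (hs := []) (fundamentalThm 1) (by decide +kernel) trivial

theorem pathPairsContr₁ : IsTheorem (PathPairsContr 1) :=
  .of_verify (hs := []) (pathPairsContr 1) (by decide +kernel) trivial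

theorem pathSigma₁ : IsTheorem (PathSigma 1) :=
  .of_verify (hs := [_, _]) (pathSigma 1) (by decide +kernel) ⟨fundamentalThm₁, pathPairsContr₁⟩

theorem hLevelSigma₁ : IsTheorem (HLevelSigma 1) :=
  .of_verify (hs := [_, _]) (hLevelSigma 1) (by decide +kernel) ⟨hLevelTransfer₁, pathSigma₁⟩

theorem isEquivIdContr₁ : IsTheorem (IsEquivIdContr 1) :=
  .of_verify (hs := [_, _, _]) (isEquivIdContr 1) (by decide +kernel)
    ⟨weakFunext₁, choiceContr₁, hLevelSigma₁⟩

theorem equivHtpyContr₁ : IsTheorem (EquivHtpyContr 1) :=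
  .of_verify (hs := [_, _, _]) (equivHtpyContr 1) (by decide +kernel)
    ⟨weakFunext₁, choiceContr₁, isEquivIdContr₁⟩

theorem coeEquiv₁ : IsTheorem (CoeEquiv 1) :=
  .of_verify (hs := [_, _, _, _]) (coeEquiv 1) (by decide +kernel)
    ⟨univalence 1 (by decide), fundamentalThm₂, contrTransfer₂, equivHtpyContr₁⟩

theorem fibersContr₂ : IsTheorem (FibersContr 2) :=
  .of_verify (hs := [_]) (fibersContr 2) (by decide +kernel) equivInduction₂

theorem postComp₂ : IsTheorem (PostComp 2) :=
  .of_verify (hs := [_, _]) (postComp 2) (by decide +kernel) ⟨eta 2 (by decide), equivInduction₂⟩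

theorem projEquiv₂ : IsTheorem (ProjEquiv 2) :=
  .of_verify (hs := []) (projEquiv 2) (by decide +kernel) trivial

theorem sectionsRetract₂ : IsTheorem (SectionsRetract 2) :=
  .of_verify (hs := [_]) (sectionsRetract 2) (by decide +kernel) (eta 2 (by decide))

theorem weakFunext₂ : IsTheorem (WeakFunext 2) :=
  .of_verify (hs := [_, _, _, _]) (weakFunext 2) (by decide +kernel)
    ⟨fibersContr₂, postComp₂, projEquiv₂, sectionsRetract₂⟩

theorem choiceContr₂ : IsTheorem (ChoiceContr 2) :=
  .of_verify (hs := [_]) (choiceContr 2) (by decide +kernel) (eta 2 (by decide))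

theorem apEquivPi₂ : IsTheorem (ApEquivPi 2) :=
  .of_verify (hs := [_, _, _, _]) (apEquivPi 2) (by decide +kernel)
    ⟨equivInduction₂, fundamentalThm₂, weakFunext₂, choiceContr₂⟩

theorem loopLiftPi₁ : IsTheorem (LoopLiftPi 1) :=
  .of_verify (hs := [_]) (loopLiftPi 1) (by decide +kernel) apEquivPi₂

theorem loopMapBase₂₁ : IsTheorem (LoopMapBase 2 1) :=
  .of_verify (hs := []) (loopMapBase 2 1) (by decide +kernel) trivial

theorem trivialSections₁ : IsTheorem (TrivialSections 1) :=
  .of_verify (hs := [_, _, _]) (trivialSections 1) (by decide +kernel)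
    ⟨coeEquiv₁, loopLiftPi₁, loopMapBase₂₁⟩

theorem hLevelPath₁ : IsTheorem (HLevelPath 1) :=
  .of_verify (hs := []) (hLevelPath 1) (by decide +kernel) trivial

theorem funext₁ : IsTheorem (Funext 1) :=
  .of_verify (hs := [_, _, _]) (funext 1) (by decide +kernel)
    ⟨fundamentalThm₁, weakFunext₁, choiceContr₁⟩

theorem hLevelPi₁ : IsTheorem (HLevelPi 1) :=
  .of_verify (hs := [_, _, _]) (hLevelPi 1) (by decide +kernel)
    ⟨hLevelTransfer₁, weakFunext₁, funext₁⟩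

theorem hLevelEquiv₁ : IsTheorem (HLevelEquiv 1) :=
  .of_verify (hs := [_, _, _]) (hLevelEquiv 1) (by decide +kernel)
    ⟨hLevelPath₁, hLevelSigma₁, hLevelPi₁⟩

theorem hLevelUniv₀ : IsTheorem (HLevelUniv 0) :=
  .of_verify (hs := [_, _, _]) (hLevelUniv 0) (by decide +kernel)
    ⟨univalence 0 (by decide), hLevelTransfer₁, hLevelEquiv₁⟩

theorem hLevelOfProp₁ : IsTheorem (HLevelOfProp 1) :=
  .of_verify (hs := [_]) (hLevelOfProp 1) (by decide +kernel) hLevelPath₁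

theorem hLevelIsProp₁ : IsTheorem (HLevelIsProp 1) :=
  .of_verify (hs := [_, _, _]) (hLevelIsProp 1) (by decide +kernel)
    ⟨hLevelPath₁, hLevelSigma₁, hLevelPi₁⟩

theorem hLevelLoop₂₁ : IsTheorem (HLevelLoop 2 1) :=
  .of_verify (hs := []) (hLevelLoop 2 1) (by decide +kernel) trivial

theorem loopAtIsSet : IsTheorem LoopAtIsSet :=
  .of_verify (hs := [_, _, _, _, _]) MLTT.loopAtIsSet (by decide +kernel)
    ⟨hLevelUniv₀, hLevelOfProp₁, hLevelIsProp₁, hLevelSigma₁, hLevelLoop₂₁⟩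

theorem hLevelLift₁ : IsTheorem (HLevelLift 1) :=
  .of_verify (hs := []) (hLevelLift 1) (by decide +kernel) trivial

theorem loopedTypesHLevel : IsTheorem LoopedTypesHLevel :=
  .of_verify (hs := [_, _, _, _, _, _, _]) MLTT.loopedTypesHLevel (by decide +kernel)
    ⟨hLevelUniv₀, hLevelOfProp₁, loopAtIsSet, hLevelSigma₁, hLevelTransfer₁, pathSigma₁,
    hLevelLift₁⟩

theorem transportLoop : IsTheorem TransportLoop :=
  .of_verify (hs := [_]) MLTT.transportLoop (by decide +kernel) hLevelIsProp₁

theorem contrTransfer₁ : IsTheorem (ContrTransfer 1) :=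
  .of_verify (hs := [_]) (contrTransfer 1) (by decide +kernel) equivInduction₁

theorem fstLoopsEquiv₁ : IsTheorem (FstLoopsEquiv 1) :=
  .of_verify (hs := [_, _, _]) (fstLoopsEquiv 1) (by decide +kernel)
    ⟨fundamentalThm₁, pathSigma₁, contrTransfer₁⟩

theorem apEquiv₁ : IsTheorem (ApEquiv 1) :=
  .of_verify (hs := [_, _]) (apEquiv 1) (by decide +kernel) ⟨equivInduction₁, fundamentalThm₁⟩

theorem loopLift₁ : IsTheorem (LoopLift 1) :=
  .of_verify (hs := [_]) (loopLift 1) (by decide +kernel) apEquiv₁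

theorem fstLoopLift₁ : IsTheorem (FstLoopLift 1) :=
  .of_verify (hs := [_, _]) (fstLoopLift 1) (by decide +kernel) ⟨fstLoopsEquiv₁, loopLift₁⟩

theorem loopedTypesLift : IsTheorem LoopedTypesLift :=
  .of_verify (hs := [_, _, _, _]) MLTT.loopedTypesLift (by decide +kernel)
    ⟨transportLoop, pathSigma₁, fstLoopLift₁, loopAtIsSet⟩

theorem loopMapBase₁₁ : IsTheorem (LoopMapBase 1 1) :=
  .of_verify (hs := []) (loopMapBase 1 1) (by decide +kernel) trivial

theorem descent : IsTheorem Descent :=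
  .of_verify (hs := [_, _, _, _]) MLTT.descent (by decide +kernel)
    ⟨trivialSections₁, loopedTypesHLevel, loopedTypesLift, loopMapBase₁₁⟩

theorem codeContr : IsTheorem CodeContr :=
  .of_verify (hs := []) MLTT.codeContr (by decide +kernel) trivial

theorem codeIsProp : IsTheorem CodeIsProp :=
  .of_verify (hs := [_]) MLTT.codeIsProp (by decide +kernel) hLevelPath₁

theorem natIsSet : IsTheorem NatIsSet :=
  .of_verify (hs := [_, _, _, _]) MLTT.natIsSet (by decide +kernel)
    ⟨fundamentalThm₁, hLevelTransfer₁, codeContr, codeIsProp⟩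

theorem nontrivialLoop : IsTheorem NontrivialLoop :=
  .of_verify (hs := [_, _]) MLTT.nontrivialLoop (by decide +kernel)
    ⟨univalence 0 (by decide), natIsSet⟩

theorem hLevelLoop₁₁ : IsTheorem (HLevelLoop 1 1) :=
  .of_verify (hs := []) (hLevelLoop 1 1) (by decide +kernel) trivial

theorem trivialOfHLevel : IsTheorem TrivialOfHLevel :=
  .of_verify (hs := [_]) MLTT.trivialOfHLevel (by decide +kernel) hLevelLoop₁₁

end IsTheorem
end MLTT

/-! ### Instances at numerals, and the final assembly. -/

namespace MLTT
open Judgment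

/-! ### H-levels at numerals -/

namespace Tm

/-- The numeral `m`. -/
def num : ℕ → Tm
  | 0 => .zero
  | m + 1 => .succ (num m)

/-- The recursion step of `hLevelFun`. -/
def hLevelStep (j : ℕ) : Tm :=
  .lam (.univ j) (.pi (.var 0) (.pi (.var 1) (.app (.var 3) (.path (.var 2) (.var 1) (.var 0)))))

/-- The internal version of `Tm.hasHLevel`, as a function of types in `U_j`. -/
def hLevelFun (j : ℕ) (k : Tm) : Tm :=
  .natInd (.pi (.univ j) (.univ j)) (.lam (.univ j) (isContr (.var 0))) (hLevelStep j) k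

theorem num_subst (m : ℕ) (σ : ℕ → Tm) : (num m).subst σ = num m := by
  induction m with
  | zero => rfl
  | succ m ih => exact congrArg succ ih

theorem hLevelFun_subst (j : ℕ) (k : Tm) (σ : ℕ → Tm) :
    (hLevelFun j k).subst σ = hLevelFun j (k.subst σ) := by
  simp [hLevelFun, hLevelStep, isContr, subst, upSub, wk, rename]

theorem hLevelFun_num_subst (j m : ℕ) (σ : ℕ → Tm) :
    (hLevelFun j (num m)).subst σ = hLevelFun j (num m) := by
  rw [hLevelFun_subst, num_subst]

theorem hLevelFun_num_wk (j m : ℕ) : (hLevelFun j (num m)).wk = hLevelFun j (num m) := by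
  rw [wk, rename_eq_subst, hLevelFun_num_subst]

theorem hLevelStep_subst (j m : ℕ) :
    (hLevelStep j).subst (consSub (hLevelFun j (num m)) (consSub (num m) var)) =
      .lam (.univ j) (.pi (.var 0) (.pi (.var 1) (.app (hLevelFun j (num m))
        (.path (.var 2) (.var 1) (.var 0))))) := by
  simp [hLevelStep, subst, upSub, consSub, hLevelFun_num_wk]

theorem instUnder_succ_inst (C n : Tm) :
    (C.instUnder 1 (.succ (.var 0))).inst n = C.inst (.succ n) := by
  rw [instUnder, inst, subst_subst, inst]
  congr 1; funext k; cases k <;> simp [subst]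

theorem shift_zero (t : Tm) : t.shift 0 = t := by
  induction t <;> simp_all [shift]

end Tm

namespace Derivable
variable {Γ : Ctx} {A : Tm} {j : ℕ}

theorem num (hΓ : Derivable (isCtx Γ)) (m : ℕ) : Derivable (hasType Γ (Tm.num m) .nat) := by
  induction m with
  | zero => exact .nat_intro₁ hΓ
  | succ m ih => exact .nat_intro₂ ih

theorem path_vars (hA : Derivable (hasType Γ A (.univ j))) :
    Derivable (hasType (A.wk :: A :: Γ) (.path A.wk.wk (.var 1) (.var 0)) (.univ j)) :=
  have h := hA.wkType hA
  have hΓ := Derivable.ctx_cons h.ctx h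
  .path_form (h.wkType h) (.var hΓ (.there _ (.here _ _))) (.var hΓ (.here _ _))

theorem isContr (hA : Derivable (hasType Γ A (.univ j))) :
    Derivable (hasType Γ (Tm.isContr A) (.univ j)) :=
  .sigma_form hA (.pi_form (hA.wkType hA) (path_vars hA))

theorem hasHLevel (hA : Derivable (hasType Γ A (.univ j))) (m : ℕ) :
    Derivable (hasType Γ (Tm.hasHLevel m A) (.univ j)) := by
  induction m generalizing Γ A with
  | zero => exact hA.isContr
  | succ m ih => exact .pi_form hA (.pi_form (hA.wkType hA) (ih (path_vars hA)))

theorem univ_arrow (hΓ : Derivable (isCtx Γ)) (j : ℕ) :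
    Derivable (hasType Γ (.pi (.univ j) (.univ j)) (.univ (j + 1))) :=
  have h := Derivable.univ_intro j hΓ
  .pi_form h (.univ_intro j (.ctx_cons hΓ h))

theorem hLevelZero (hΓ : Derivable (isCtx Γ)) (j : ℕ) :
    Derivable (hasType (.univ j :: Γ) (Tm.isContr (.var 0)) (.univ j)) :=
  (Derivable.var (.ctx_cons hΓ (.univ_intro j hΓ)) (.here _ _)).isContr

theorem hLevelBody (hΓ : Derivable (isCtx Γ)) {f : Tm}
    (hf : Derivable (hasType (.var 1 :: .var 0 :: .univ j :: Γ) f (.pi (.univ j) (.univ j)))) :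
    Derivable (hasType (.univ j :: Γ) (.pi (.var 0) (.pi (.var 1) (.app f
      (.path (.var 2) (.var 1) (.var 0))))) (.univ j)) := by
  have hX : Derivable (hasType (.univ j :: Γ) (.var 0) (.univ j)) :=
    .var (.ctx_cons hΓ (.univ_intro j hΓ)) (.here _ _)
  exact .pi_form hX (.pi_form (hX.wkType hX) (Derivable.pi_elim (B := .univ j) hf (path_vars hX)))

theorem ctx_vars (hΓ : Derivable (isCtx Γ)) (j : ℕ) :
    Derivable (isCtx (.var 1 :: .var 0 :: .univ j :: Γ)) :=
  have hX : Derivable (hasType (.univ j :: Γ) (.var 0) (.univ j)) :=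
    .var (.ctx_cons hΓ (.univ_intro j hΓ)) (.here _ _)
  .ctx_cons (.ctx_cons hX.ctx hX) (hX.wkType hX)

theorem hLevelStep (hΓ : Derivable (isCtx Γ)) (j : ℕ) : Derivable (hasType
    (.pi (.univ j) (.univ j) :: .nat :: Γ) (Tm.hLevelStep j) (.pi (.univ j) (.univ j))) :=
  have hΓ' := Derivable.ctx_cons hΓ (.nat_form 0 hΓ)
  have hC := univ_arrow hΓ' j
  have hΔ := Derivable.ctx_cons hΓ' hC
  .pi_intro (.univ_intro j hΔ) (hLevelBody hΔ (.var (ctx_vars hΔ j)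
    (.there _ (.there _ (.there _ (.here _ _))))))

theorem hLevelFun (hΓ : Derivable (isCtx Γ)) (j m : ℕ) :
    Derivable (hasType Γ (Tm.hLevelFun j (Tm.num m)) (.pi (.univ j) (.univ j))) :=
  .nat_elim (C := .pi (.univ j) (.univ j)) (univ_arrow (.ctx_cons hΓ (.nat_form 0 hΓ)) j)
    (.pi_intro (.univ_intro j hΓ) (hLevelZero hΓ j)) (hLevelStep hΓ j) (num hΓ m)

/-- At a numeral the internal recursion unfolds completely. The equality is judgmental, so passing
between the two forms costs only a conversion. -/
theorem hLevelFun_app (hA : Derivable (hasType Γ A (.univ j))) (m : ℕ) :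
    Derivable (defEq Γ (.app (Tm.hLevelFun j (Tm.num m)) A) (Tm.hasHLevel m A) (.univ j)) := by
  induction m generalizing Γ A with
  | zero =>
    have hΓ := Derivable.ctx hA
    have hU := Derivable.univ_intro j hΓ
    have h₁ := Derivable.nat_comp₁ (C := .pi (.univ j) (.univ j))
      (univ_arrow (.ctx_cons hΓ (.nat_form 0 hΓ)) j) (.pi_intro hU (hLevelZero hΓ j))
      (hLevelStep hΓ j)
    exact .eq_trans (Derivable.pi_elim_eq (B := .univ j) h₁ (.eq_refl hA))
      (.pi_comp (B := .univ j) hU (hLevelZero hΓ j) hA)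
  | succ m ih =>
    have hΓ := Derivable.ctx hA
    have hU := Derivable.univ_intro j hΓ
    have h₁ := Derivable.nat_comp₂ (C := .pi (.univ j) (.univ j))
      (univ_arrow (.ctx_cons hΓ (.nat_form 0 hΓ)) j) (.pi_intro hU (hLevelZero hΓ j))
      (hLevelStep hΓ j) (num hΓ m)
    change Derivable (defEq Γ _ ((Tm.hLevelStep j).subst (consSub (Tm.hLevelFun j (Tm.num m)) _))
      _) at h₁
    rw [Tm.hLevelStep_subst] at h₁
    refine .eq_trans (Derivable.pi_elim_eq (B := .univ j) h₁ (.eq_refl hA)) ?_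
    have h₂ := Derivable.pi_comp (B := .univ j) hU
      (hLevelBody hΓ (hLevelFun (ctx_vars hΓ j) j m)) hA
    have hP := path_vars hA
    refine .eq_trans h₂ (Derivable.eq_trans ?_ (.pi_form_eq hA (.eq_refl hA)
      (.pi_form_eq (hA.wkType hA) (.eq_refl (hA.wkType hA)) (ih hP))))
    simpa [Tm.inst, Tm.subst, upSub, Tm.hLevelFun_num_subst] using Derivable.eq_refl
      (.pi_form hA (.pi_form (hA.wkType hA)
        (Derivable.pi_elim (B := .univ j) (hLevelFun hP.ctx j m) hP)))

end Derivable

/-! ### Composition of functions between closed types -/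

theorem IsInhabited.comp {A B C : Tm} {i : ℕ} (hA : Derivable (hasType [] A (.univ i)))
    (h₁ : IsInhabited (A.arrow B)) (h₂ : IsInhabited (B.arrow C)) : IsInhabited (A.arrow C) := by
  obtain ⟨f, hf⟩ := h₁
  obtain ⟨g, hg⟩ := h₂
  have hx := Derivable.var (.ctx_cons .ctx_nil hA) (.here _ _)
  have e (A B : Tm) : (A.arrow B).wk = .pi A.wk B.wk.wk := by
    simp [Tm.arrow, Tm.wk, Tm.rename, Tm.rename_rename, upRen]
  have hf := hf.wkType hA
  have hg := hg.wkType hA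
  rw [e] at hf hg
  have h := Derivable.pi_elim hf hx
  rw [Tm.wk_inst] at h
  have h := Derivable.pi_elim hg h
  rw [Tm.wk_inst] at h
  exact ⟨_, .pi_intro hA h⟩

theorem IsInhabited.app {A B : Tm} (h : IsInhabited (.pi .nat (A.arrow B))) (m : ℕ) :
    IsInhabited ((A.inst (.num m)).arrow (B.inst (.num m))) := by
  obtain ⟨f, hf⟩ := h
  have := Derivable.pi_elim hf (.num .ctx_nil m)
  rw [Tm.inst, Tm.arrow_subst] at this
  exact ⟨_, this⟩

theorem Tm.shift_shift (m n : ℕ) (t : Tm) : (t.shift m).shift n = t.shift (n + m) := by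
  induction t <;> simp_all [shift, add_assoc]

@[simp] theorem Tm.shift_arrow (n : ℕ) (A B : Tm) :
    (A.arrow B).shift n = (A.shift n).arrow (B.shift n) := by
  simp [arrow, shift]

/-! ### Descent through the universes -/

/-- `TrivialLoops 0 k`, in the context of one variable `k`. -/
def trivialLoops : Tm := (TrivialLoops 0 (bound .Nat 0)).run 1

theorem isInhabited_descent (i m : ℕ) : IsInhabited
    (((trivialLoops.shift (i + 1)).inst (.num (m + 1))).arrow
      ((trivialLoops.shift i).inst (.num m))) := by
  -- The hypothesis of the checked descent is the conclusion with all levels raised by one and `k`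
  -- replaced by its successor, as the kernel confirms. In this form it can be shifted by any `i`.
  have h : IsInhabited (.pi .nat (((trivialLoops.shift 1).instUnder 1 (.succ (.var 0))).arrow
      trivialLoops)) := IsTheorem.descent.isInhabited (by decide +kernel)
  have := IsInhabited.app (by simpa [Tm.shift, Tm.shift_shift] using h.shift i) m
  rwa [Tm.instUnder_succ_inst] at this

theorem isInhabited_nontrivialLoop : IsInhabited ((trivialLoops.inst .zero).arrow .empty) :=
  IsTheorem.nontrivialLoop.isInhabited (by decide +kernel)

theorem isInhabited_trivialOfHLevel (n : ℕ) : IsInhabited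
    ((Tm.app (.hLevelFun (n + 1) (.num (n + 2))) (.univ n)).arrow
      ((trivialLoops.shift n).inst (.num n))) := by
  have h : IsInhabited (.pi .nat ((Tm.app (.hLevelFun 1 (.succ (.succ (.var 0)))) (.univ 0)).arrow
      trivialLoops)) := IsTheorem.trivialOfHLevel.isInhabited (by decide +kernel)
  have := IsInhabited.app (by simpa [Tm.shift, Tm.hLevelFun] using h.shift n) n
  exact this

/-- Composition of `n` descents, each lowering the universe and the dimension by one, followed by
the refutation for `U_0`. -/
theorem isInhabited_neg {A : Tm} {i : ℕ} (hA : Derivable (hasType [] A (.univ i))) (n : ℕ)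
    (h : IsInhabited (A.arrow ((trivialLoops.shift n).inst (.num n)))) :
    IsInhabited (Tm.neg A) := by
  induction n with
  | zero =>
    rw [Tm.shift_zero] at h
    exact h.comp hA isInhabited_nontrivialLoop
  | succ n ih => exact ih (h.comp hA (isInhabited_descent n n))

end MLTT

theorem theorem1 (n : ℕ) :
    MLTT.IsInhabited (MLTT.Tm.neg (MLTT.Tm.isNType n (MLTT.Tm.univ n))) := by
  open MLTT in
  have hU := Derivable.univ_intro n .ctx_nil
  have hA := hU.hasHLevel (n + 2)
  -- The identity function on the external h-level type, with its codomain converted to the internal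
  -- form in which the checked theorem is stated.
  refine isInhabited_neg hA n (.comp hA ⟨.lam _ (.var 0), .pi_intro hA ?_⟩
    (isInhabited_trivialOfHLevel n))
  exact (Derivable.var (.ctx_cons .ctx_nil hA) (.here _ _)).conv
    (.eq_symm ((hU.hLevelFun_app (n + 2)).wkEq hA))
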